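/- **Programs.** A program $\mathcal P$ has a finite set of threads, each belonging to a CTA and a GPU, an initial value for every memory location, and deterministic thread code: given the events executed so far by a thread (with the values read), the code determines its next action (a read, a write, a fence) or that there is none. A successful RMW is a read immediately followed, in its thread, by a write to the same location flagged as RMW write; a failed RMW is a read. Actions carry a memory order $\mathrm{na}\sqsubset\mathrm{rlx}\sqsubset\{\mathrm{rel},\mathrm{acq}\}\sqsubset\mathrm{acqrel}\sqsubset\mathrm{sc}$ and a scope (cta, gpu, sys). **Execution graphs.** A graph $\mathcal G=(E,po,rf,co,rmw)$ of $\mathcal P$ consists of events $E$ forming, for every thread, an initial part of a run of its code, together with an implicit non-atomic initial write to each location; $po$ orders the events of each thread and puts initial writes before all other events; $rf$ relates each read to exactly one write of the same location and value; $co$ is a strict total order on the writes to each location; $rmw$ relates the two halves of each successful RMW. $\mathcal G_\emptyset$ is the graph with $E=\emptyset$. Let $fr=rf^{-1};co$ and $eco=(rf\cup co\cup fr)^+$. Let $incl(a,b)$ hold if $a,b$ are atomic, the scope of $a$ includes the thread of $b$ or vice versa, and $a,b$ access the same location if both access memory. With $R|_{loc}$ the restriction of $R$ to pairs of accesses to the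 same location and $R|_{\ne loc}=R\setminus R|_{loc}$, and $W,F$ the sets of writes and fences, let $$rseq=[W];po|_{loc}^?;[W_{\sqsupseteq rlx}];((incl\cap rf);rmw)^*,\quad sw=[E_{\sqsupseteq rel}];([F];po)^?;rseq;(incl\cap rf);(po;[F])^?;[E_{\sqsupseteq acq}],$$ $$hb=(po\cup(incl\cap sw))^+,\quad scb=po\cup(po|_{\ne loc};hb;po|_{\ne loc})\cup hb|_{loc}\cup co\cup fr,$$ $$psc=([E_{sc}]\cup[F_{sc}];hb^?);scb;([E_{sc}]\cup hb^?;[F_{sc}])\ \cup\ [F_{sc}];(hb\cup hb;eco;hb);[F_{sc}].$$ $\mathcal G$ is *consistent* (SRC11) if $hb;eco^?$ is irreflexive, $rmw\cap(fr;co)=\emptyset$, $incl\cap psc$ is acyclic and $po\cup rf$ is acyclic. It is *full* if it is consistent and no thread has a next action. **The algorithm.** $\mathrm{Explore}(\mathcal G)$ also maintains the order $<_{exe}$ in which the events of $\mathcal G$ were added and a set of reversible reads. It starts from $\mathcal G_\emptyset$. It returns if $\mathcal G$ violates one of the four axioms. Otherwise it picks the next event $e$: the write half of a successful RMW whose read has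 just been executed, if there is one, else the enabled event that is least in a fixed, arbitrary strict total order on the pairs (thread, index in the thread). If there is no next event, it outputs $\mathcal G$. * If $e$ is a fence, it adds $e$ and calls itself recursively. * If $e$ is a read of $x$, it calls itself, for every write $w$ to $x$ in the graph (including the initial one), on the graph extended by $e$ reading from $w$; $e$ becomes reversible. * If $e=w$ is a write to $x$, it calls itself on $\mathcal G$ extended by $w$, once for every place of $w$ in $co$ after the initial write. Moreover, let $B$ be the set of events that precede $w$ by a $po\cup rf$ path. For each reversible read $r\notin B$ of $x$, let $Del=\{e\in E: r<_{exe}e,\ e\notin B\}$. If $\mathrm{CheckOptimal}$ holds, it calls itself, once for every place of $w$ in $co$ after the initial write, on $\mathcal G|_{E\setminus Del}$ extended by $w$, with $r$ changed to read from $w$; $r$ keeps its place in $<_{exe}$, $w$ comes last, and the reads in $B$ become non-reversible. $\mathrm{CheckOptimal}$ holds if for every $e\in Del\cup\{r\}$: (i) if $e$ is a read, then it does not read from an event of $Del\cup\{r\}$ that comes after $e$ in $<_{exe}$; (ii) if $e'$ is $e$ itself (when $e$ is a write) or the write from which $e$ reads (when $e$ is a read), then $e'$ is not $co$-before any event $e''$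 with $e''<_{exe}e$ or $e''\in B$. **Theorem.** Suppose that every consistent execution graph of $\mathcal P$ has at most $N$ events. Then the exploration terminates, and: 1. (Soundness) Every graph on which a call does not return at the four checks is an SRC11-consistent execution graph of $\mathcal P$, and every output graph is a full consistent execution graph of $\mathcal P$. 2. (Completeness) Every full consistent execution graph of $\mathcal P$ is output. Moreover there is a function $Prev$ on graphs with $Prev(\mathcal G_\emptyset)=\mathcal G_\emptyset$ such that each recursive call on a graph $\mathcal G'$ is made by the call on $Prev(\mathcal G')$, and for every full consistent execution graph $\mathcal G$ there is $k$ with $Prev^k(\mathcal G)=\mathcal G_\emptyset$. 3. (Optimality) No two different calls of Explore have the same graph $(E,po,rf,co,rmw)$; thus each full consistent execution graph is generated exactly once. 4. (Polynomial space) At any time the recursion depth is at most $(N+1)^2$, and the total number of events, $rf$ edges, $co$ edges and reversibility marks stored in the arguments of the calls on the recursion stack is at most $(N+3)^4$. -/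

import Mathlib

namespace SRC11

/-! ## Events of scoped C/C++ programs -/

/-- Memory orders. -/
inductive MemOrd
  | na | rlx | rel | acq | acqrel | sc

/-- `o ⊒ rlx`, that is, the access is atomic. -/
def MemOrd.IsAtomic : MemOrd → Prop
  | .na => False
  | _ => True

/-- `o ⊒ rel`. -/
def MemOrd.IsRelease : MemOrd → Prop
  | .rel | .acqrel | .sc => True
  | _ => False

/-- `o ⊒ acq`. -/
def MemOrd.IsAcquire : MemOrd → Prop
  | .acq | .acqrel | .sc => True
  | _ => False

/-- Scopes: cooperative thread array, GPU, whole system. -/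
inductive Scope
  | cta | gpu | sys

/-- Operation, location, value, memory order and scope of an event. The flag of a write tells
whether it is the write half of a successful RMW. -/
inductive Label (Loc Val : Type*)
  | read (x : Loc) (v : Val) (o : MemOrd) (s : Scope)
  | write (x : Loc) (v : Val) (o : MemOrd) (s : Scope) (rmw : Bool)
  | fence (o : MemOrd) (s : Scope)

/-- What a thread wants to execute next: a label in which a read does not carry a value yet. -/
inductive Act (Loc Val : Type*)
  | read (x : Loc) (o : MemOrd) (s : Scope)
  | write (x : Loc) (v : Val) (o : MemOrd) (s : Scope) (rmw : Bool)
  | fence (o : MemOrd) (s : Scope)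

/-- The label `l` results from executing the action. -/
def Act.Matches {Loc Val : Type*} : Act Loc Val → Label Loc Val → Prop
  | .read x o s, l => ∃ v, l = .read x v o s
  | .write x v o s b, l => l = .write x v o s b
  | .fence o s, l => l = .fence o s

/-- The action is the write half of a successful RMW. -/
def Act.IsRmwWrite {Loc Val : Type*} : Act Loc Val → Prop
  | .write _ _ _ _ b => b = true
  | _ => False

/-- A concurrent program: the CTA and the GPU of each thread, the initial memory, and for each
thread its (deterministic) code: given the labels of the events that the thread has executed so
far, in program order, `next` is its next action, or `none` if the thread has finished (or waits
forever). A successful RMW is a read followed immediately by a write to the same location that is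
flagged as an RMW write; a failed RMW is just a read. -/
structure Program (Tid Loc Val : Type*) where
  cta : Tid → ℕ
  gpu : Tid → ℕ
  initVal : Loc → Val
  next : Tid → List (Label Loc Val) → Option (Act Loc Val)
  rmw_wf : ∀ t h x v o s, next t h = some (.write x v o s true) →
    ∃ h' v' o' s', h = h' ++ [.read x v' o' s']

/-- An event is the initial write to a location, or the `n`-th event (`n = 0, 1, …`) of a thread. -/
inductive Event (Tid Loc Val : Type*)
  | init (x : Loc)
  | ev (t : Tid) (n : ℕ) (l : Label Loc Val)

namespace Event

variable {Tid Loc Val : Type*}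

def IsInit : Event Tid Loc Val → Prop
  | .init _ => True
  | _ => False

def IsRead : Event Tid Loc Val → Prop
  | .ev _ _ (.read _ _ _ _) => True
  | _ => False

def IsWrite : Event Tid Loc Val → Prop
  | .init _ => True
  | .ev _ _ (.write _ _ _ _ _) => True
  | _ => False

def IsFence : Event Tid Loc Val → Prop
  | .ev _ _ (.fence _ _) => True
  | _ => False

/-- The location accessed; `none` for fences. -/
def loc : Event Tid Loc Val → Option Loc
  | .init x => some x
  | .ev _ _ (.read x _ _ _) => some x
  | .ev _ _ (.write x _ _ _ _) => some x
  | .ev _ _ (.fence _ _) => none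

/-- The memory order; initial writes are non-atomic. -/
def ord : Event Tid Loc Val → MemOrd
  | .init _ => .na
  | .ev _ _ (.read _ _ o _) => o
  | .ev _ _ (.write _ _ o _ _) => o
  | .ev _ _ (.fence o _) => o

/-- Two events that access the same location. -/
def SameLoc (a b : Event Tid Loc Val) : Prop :=
  ∃ x, a.loc = some x ∧ b.loc = some x

/-- Program order between events: initial writes come before all other events, and the events of
a thread are ordered by their indices. -/
def PoBefore : Event Tid Loc Val → Event Tid Loc Val → Prop
  | .init _, .ev _ _ _ => True
  | .ev t n _, .ev t' n' _ => t = t' ∧ n < n'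
  | _, .init _ => False

/-- `a` is a read and `b` the write of the same successful RMW. -/
def RmwPair (a b : Event Tid Loc Val) : Prop :=
  ∃ t n x v o s v' o' s',
    a = .ev t n (.read x v o s) ∧ b = .ev t (n + 1) (.write x v' o' s' true)

/-- Replaces the value of a read. -/
def setReadVal : Event Tid Loc Val → Val → Event Tid Loc Val
  | .ev t n (.read x _ o s), v => .ev t n (.read x v o s)
  | e, _ => e

end Event

namespace Program

variable {Tid Loc Val : Type*} (P : Program Tid Loc Val)

/-- `e` writes the value `v` to the location `x`. -/
def Writes (e : Event Tid Loc Val) (x : Loc) (v : Val) : Prop :=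
  (e = .init x ∧ v = P.initVal x) ∨ ∃ t n o s b, e = .ev t n (.write x v o s b)

/-- The scope of the event `a` includes the thread of the event `b`. -/
def ScopeIncludes : Event Tid Loc Val → Event Tid Loc Val → Prop
  | .ev t _ l, .ev t' _ _ =>
    match (match l with
      | .read _ _ _ s => s
      | .write _ _ _ s _ => s
      | .fence _ s => s) with
    | .cta => P.cta t = P.cta t' ∧ P.gpu t = P.gpu t'
    | .gpu => P.gpu t = P.gpu t'
    | .sys => True
  | _, _ => False

/-- The inclusion relation `incl`. -/
def Incl (a b : Event Tid Loc Val) : Prop :=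
  (a.ord.IsAtomic ∧ b.ord.IsAtomic) ∧ (P.ScopeIncludes a b ∨ P.ScopeIncludes b a) ∧
    ∀ x y, a.loc = some x → b.loc = some y → x = y

end Program

/-! ## Execution graphs -/

/-- An execution graph `(E, po, rf, co, rmw)`. Events carry their thread, their index in the thread
and their RMW flag, so that `po` and `rmw` are determined by `E` (see `ExecGraph.po`, `ExecGraph.rmw`).
The initial writes belong to every graph and are not listed in `E`. -/
@[ext]
structure ExecGraph (Tid Loc Val : Type*) where
  E : Set (Event Tid Loc Val)
  rf : Event Tid Loc Val → Event Tid Loc Val → Prop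
  co : Event Tid Loc Val → Event Tid Loc Val → Prop

/-- Composition of relations. -/
infixr:80 " ⨾ " => Relation.Comp

/-- The identity relation `[A]`. -/
def idOn {α : Type*} (A : α → Prop) (a b : α) : Prop := a = b ∧ A a

def Acyclic {α : Type*} (R : α → α → Prop) : Prop := ∀ a, ¬ Relation.TransGen R a a

/-- `R` on same-location events. -/
def onLoc {Tid Loc Val : Type*} (R : Event Tid Loc Val → Event Tid Loc Val → Prop)
    (a b : Event Tid Loc Val) : Prop := R a b ∧ a.SameLoc b

/-- `R` without the pairs of same-location events. -/
def offLoc {Tid Loc Val : Type*} (R : Event Tid Loc Val → Event Tid Loc Val → Prop)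
    (a b : Event Tid Loc Val) : Prop := R a b ∧ ¬ a.SameLoc b

namespace ExecGraph

open Relation

variable {Tid Loc Val : Type*}

/-- The graph without events (other than the initial writes). -/
def empty : ExecGraph Tid Loc Val := ⟨∅, fun _ _ => False, fun _ _ => False⟩

variable (P : Program Tid Loc Val) (G : ExecGraph Tid Loc Val)

/-- All events of the graph, including the initial writes. -/
def Mem (e : Event Tid Loc Val) : Prop := e.IsInit ∨ e ∈ G.E

def po (a b : Event Tid Loc Val) : Prop := G.Mem a ∧ G.Mem b ∧ a.PoBefore b

def rmw (a b : Event Tid Loc Val) : Prop := G.Mem a ∧ G.Mem b ∧ a.RmwPair b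

/-- from-read: `rf⁻¹ ; co`. -/
def fr : Event Tid Loc Val → Event Tid Loc Val → Prop := (fun r w => G.rf w r) ⨾ G.co

/-- `(rf ∪ co ∪ fr)⁺`. -/
def eco : Event Tid Loc Val → Event Tid Loc Val → Prop := TransGen (G.rf ⊔ G.co ⊔ G.fr)

/-- `[W] ; po|loc? ; [W ⊒ rlx] ; ((incl ∩ rf) ; rmw)*`. -/
def rseq : Event Tid Loc Val → Event Tid Loc Val → Prop :=
  idOn Event.IsWrite ⨾ ReflGen (onLoc G.po) ⨾ idOn (fun e => e.IsWrite ∧ e.ord.IsAtomic) ⨾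
    ReflTransGen ((P.Incl ⊓ G.rf) ⨾ G.rmw)

/-- `[E ⊒ rel] ; ([F] ; po)?`. -/
def prel : Event Tid Loc Val → Event Tid Loc Val → Prop :=
  idOn (fun e => e.ord.IsRelease) ⨾ ReflGen (idOn Event.IsFence ⨾ G.po)

/-- `(po ; [F])? ; [E ⊒ acq]`. -/
def pacq : Event Tid Loc Val → Event Tid Loc Val → Prop :=
  ReflGen (G.po ⨾ idOn Event.IsFence) ⨾ idOn (fun e => e.ord.IsAcquire)

/-- synchronizes-with. -/
def sw : Event Tid Loc Val → Event Tid Loc Val → Prop :=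
  G.prel ⨾ G.rseq P ⨾ (P.Incl ⊓ G.rf) ⨾ G.pacq

/-- happens-before. -/
def hb : Event Tid Loc Val → Event Tid Loc Val → Prop :=
  TransGen (G.po ⊔ (P.Incl ⊓ G.sw P))

def scb : Event Tid Loc Val → Event Tid Loc Val → Prop :=
  G.po ⊔ (offLoc G.po ⨾ G.hb P ⨾ offLoc G.po) ⊔ onLoc (G.hb P) ⊔ G.co ⊔ G.fr

/-- The identity on SC events. -/
def idSC : Event Tid Loc Val → Event Tid Loc Val → Prop := idOn (fun e => e.ord = .sc)

/-- The identity on SC fences. -/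
def idFenceSC : Event Tid Loc Val → Event Tid Loc Val → Prop :=
  idOn (fun e => e.IsFence ∧ e.ord = .sc)

def pscBase : Event Tid Loc Val → Event Tid Loc Val → Prop :=
  (idSC ⊔ (idFenceSC ⨾ ReflGen (G.hb P))) ⨾ G.scb P ⨾ (idSC ⊔ (ReflGen (G.hb P) ⨾ idFenceSC))

def pscFence : Event Tid Loc Val → Event Tid Loc Val → Prop :=
  idFenceSC ⨾ (G.hb P ⊔ (G.hb P ⨾ G.eco ⨾ G.hb P)) ⨾ idFenceSC

def psc : Event Tid Loc Val → Event Tid Loc Val → Prop := G.pscBase P ⊔ G.pscFence P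

/-- (No-Thin-Air). -/
def PoRfAcyclic : Prop := Acyclic (G.po ⊔ G.rf)

/-- (Coherence): `hb ; eco?` is irreflexive. -/
def Coherent : Prop := ∀ a, ¬ (G.hb P ⨾ ReflGen G.eco) a a

/-- (Atomicity): `rmw ∩ (fr ; co)` is empty. -/
def Atomic : Prop := ∀ a b, ¬ (G.rmw a b ∧ (G.fr ⨾ G.co) a b)

/-- (SC): `incl ∩ psc` is acyclic. -/
def InclPscAcyclic : Prop := Acyclic (P.Incl ⊓ G.psc P)

/-- Consistency in the scoped RC11 model. -/
structure Consistent : Prop where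
  poRfAcyclic : G.PoRfAcyclic
  coherent : G.Coherent P
  atomic : G.Atomic
  inclPscAcyclic : G.InclPscAcyclic P

/-- `h` lists the labels of the events of the thread `t` in program order. -/
def IsHistory (t : Tid) (h : List (Label Loc Val)) : Prop :=
  ∀ n l, .ev t n l ∈ G.E ↔ h[n]? = some l

/-- `G` is a (possibly partial, possibly inconsistent) execution graph of the program `P`. -/
structure IsExecution : Prop where
  init_notMem : ∀ x, .init x ∉ G.E
  /-- every thread has executed an initial part of its code, given the values that it read -/
  history : ∀ t, ∃ h, G.IsHistory t h ∧
    ∀ n l, h[n]? = some l → ∃ a, P.next t (h.take n) = some a ∧ a.Matches l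
  /-- `rf` goes from writes to reads of the same location and value -/
  rf_wf : ∀ w r, G.rf w r → G.Mem w ∧ G.Mem r ∧
    ∃ x v t n o s, P.Writes w x v ∧ r = .ev t n (.read x v o s)
  /-- every read reads from exactly one write -/
  rf_unique : ∀ r ∈ G.E, r.IsRead → ∃! w, G.rf w r
  /-- `co` is a strict total order on the writes to each location -/
  co_wf : ∀ a b, G.co a b →
    G.Mem a ∧ G.Mem b ∧ a.IsWrite ∧ b.IsWrite ∧ a.SameLoc b
  co_irrefl : ∀ a, ¬ G.co a a
  co_trans : ∀ a b c, G.co a b → G.co b c → G.co a c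
  co_total : ∀ a b, G.Mem a → G.Mem b → a.IsWrite → b.IsWrite → a.SameLoc b →
    a ≠ b → G.co a b ∨ G.co b a

/-- A full consistent execution graph of `P`: no thread has a next event. -/
structure IsFull : Prop where
  isExecution : G.IsExecution P
  consistent : G.Consistent P
  finished : ∀ t h, G.IsHistory t h → P.next t h = none

/-- Adds an event without any `rf` or `co` edge. -/
def addEvent (e : Event Tid Loc Val) : ExecGraph Tid Loc Val := ⟨insert e G.E, G.rf, G.co⟩

/-- The events before `w` in `po ∪ rf`, once `w` has been added to `G`. -/
def porfBefore (w : Event Tid Loc Val) : Set (Event Tid Loc Val) :=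
  {e | TransGen ((G.addEvent w).po ⊔ G.rf) e w}

end ExecGraph

/-! ## The exploration algorithm -/

/-- The argument of a call of the exploration procedure: a graph whose events are listed in the
order `<exe` in which they were added, and the set of its reversible reads. -/
structure State (Tid Loc Val : Type*) where
  exe : List (Event Tid Loc Val)
  rf : Event Tid Loc Val → Event Tid Loc Val → Prop
  co : Event Tid Loc Val → Event Tid Loc Val → Prop
  rev : Set (Event Tid Loc Val)

/-- What a call of the exploration procedure does: it returns at once because its graph is
inconsistent, or outputs its graph because there is no next event, or makes recursive calls, in the
order listed. -/
inductive Outcome (α : Type*)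
  | pruned
  | output
  | recurse (calls : List α)

/-- The list of recursive calls. -/
def Outcome.calls {α : Type*} : Outcome α → List α
  | .recurse l => l
  | _ => []

namespace State

open Classical

variable {Tid Loc Val : Type*}

/-- The empty graph, with which the exploration starts. -/
def start : State Tid Loc Val := ⟨[], fun _ _ => False, fun _ _ => False, ∅⟩

variable (P : Program Tid Loc Val) (nev : Tid × ℕ → Tid × ℕ → Prop) (S : State Tid Loc Val)

def graph : ExecGraph Tid Loc Val := ⟨{e | e ∈ S.exe}, S.rf, S.co⟩

/-- The labels of the events of thread `t`. -/
noncomputable def hist (t : Tid) : List (Label Loc Val) :=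
  S.exe.filterMap fun
    | .ev t' _ l => if t' = t then some l else none
    | .init _ => none

/-- The next action of thread `t`. -/
noncomputable def nextAct (t : Tid) : Option (Act Loc Val) := P.next t (S.hist t)

/-- The thread `t` is about to perform the write half of a successful RMW. -/
def PendingRmw (t : Tid) : Prop := ∃ a, S.nextAct P t = some a ∧ a.IsRmwWrite

/-- The threads among which the scheduler chooses: those that have a next action; if one of them
is in the middle of an RMW, then it must complete the RMW. -/
def Candidate (t : Tid) : Prop :=
  S.nextAct P t ≠ none ∧ ((∃ t', S.PendingRmw P t') → S.PendingRmw P t)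

/-- The next event of `t` is the least candidate with respect to the order `nev` on the pairs of a
thread and an index in the thread. -/
def IsNext (t : Tid) : Prop :=
  S.Candidate P t ∧ ∀ t', S.Candidate P t' → t' ≠ t →
    nev (t, (S.hist t).length) (t', (S.hist t').length)

/-- `NextEvent`, as the thread that is scheduled; `none` if no thread has a next event. -/
noncomputable def nextThread : Option Tid :=
  if h : ∃ t, S.IsNext P nev t then some h.choose else none

/-- The writes to `x` in the graph with their values, the initial write first. -/
noncomputable def writes (x : Loc) : List (Event Tid Loc Val × Val) :=
  (.init x, P.initVal x) :: S.exe.filterMap fun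
    | .ev t n (.write y v o s b) => if y = x then some (.ev t n (.write y v o s b), v) else none
    | _ => none

/-- Adds `w` to `co`, immediately after `a`. -/
def insertCo (co : Event Tid Loc Val → Event Tid Loc Val → Prop) (a w : Event Tid Loc Val)
    (b c : Event Tid Loc Val) : Prop :=
  co b c ∨ (c = w ∧ (b = a ∨ co b a)) ∨ (b = w ∧ co a c)

def addFence (e : Event Tid Loc Val) : State Tid Loc Val :=
  ⟨S.exe ++ [e], S.rf, S.co, S.rev⟩

/-- Adds the read `r`, reading from `w`, and marks it as reversible. -/
def addRead (w r : Event Tid Loc Val) : State Tid Loc Val :=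
  ⟨S.exe ++ [r], fun a b => S.rf a b ∨ (a = w ∧ b = r), S.co, insert r S.rev⟩

/-- Adds the write `w`, placed immediately after `a` in `co`. -/
def addWrite (a w : Event Tid Loc Val) : State Tid Loc Val :=
  ⟨S.exe ++ [w], S.rf, insertCo S.co a w, S.rev⟩

/-- `a <exe b`. -/
def Before (a b : Event Tid Loc Val) : Prop := [a, b].Sublist S.exe

/-- The events to be deleted when the read `r` is to read from the new write `w`. -/
def deleted (w r : Event Tid Loc Val) : Set (Event Tid Loc Val) :=
  {e | S.Before r e ∧ e ∉ S.graph.porfBefore w}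

/-- `CheckOptimal` for a set `D` of events. -/
def CheckOptimal (D : Set (Event Tid Loc Val)) (w : Event Tid Loc Val) : Prop :=
  ∀ e ∈ D,
    (∀ w', S.rf w' e → ¬ (S.Before e w' ∧ w' ∈ D)) ∧
    ∀ e', ((e.IsWrite ∧ e' = e) ∨ S.rf e' e) →
      ∀ e'', S.Before e'' e ∨ e'' ∈ S.graph.porfBefore w → ¬ S.co e' e''

/-- Removes the events in `D`. -/
noncomputable def remove (D : Set (Event Tid Loc Val)) : State Tid Loc Val :=
  ⟨S.exe.filter (fun e => decide (e ∉ D)), fun a b => S.rf a b ∧ a ∉ D ∧ b ∉ D,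
    fun a b => S.co a b ∧ a ∉ D ∧ b ∉ D, S.rev \ D⟩

/-- Changes the read `r` so that it reads from the write `w` of the value `v`, where `w` is new
and is placed immediately after `a` in `co`. The read keeps its place in `<exe` and `w` comes last.
The reads before `w` in `po ∪ rf` are no longer reversible. -/
noncomputable def reverse (r w a : Event Tid Loc Val) (v : Val) : State Tid Loc Val :=
  ⟨S.exe.map (fun e => if e = r then r.setReadVal v else e) ++ [w],
    fun b c => (S.rf b c ∧ c ≠ r) ∨ (b = w ∧ c = r.setReadVal v),
    insertCo S.co a w,
    insert (r.setReadVal v) ((S.rev \ {r}) \ S.graph.porfBefore w)⟩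

/-- The reversible reads of `x` that may be made to read from the new write `w`. -/
noncomputable def reversals (w : Event Tid Loc Val) (x : Loc) : List (Event Tid Loc Val) :=
  S.exe.filter fun r => decide (r.IsRead ∧ r.loc = some x ∧ r ∈ S.rev ∧
    r ∉ S.graph.porfBefore w ∧ S.CheckOptimal (insert r (S.deleted w r)) w)

/-- The recursive calls for the new write `w` of `v` to `x`: first all the ways to add `w` to `co`,
then, for each suitable read `r`, the calls in which `r` is made to read from `w`. -/
noncomputable def writeCalls (w : Event Tid Loc Val) (x : Loc) (v : Val) :
    List (State Tid Loc Val) :=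
  (S.writes P x).map (fun a => S.addWrite a.1 w) ++
    (S.reversals w x).flatMap fun r =>
      ((S.remove (S.deleted w r)).writes P x).map fun a =>
        (S.remove (S.deleted w r)).reverse r w a.1 v

/-- One call of the exploration procedure. -/
noncomputable def explore : Outcome (State Tid Loc Val) :=
  if ¬ S.graph.PoRfAcyclic then .pruned
  else if ¬ S.graph.Coherent P then .pruned
  else if ¬ S.graph.Atomic then .pruned
  else if ¬ S.graph.InclPscAcyclic P then .pruned
  else match S.nextThread P nev with
    | none => .output
    | some t =>
      match S.nextAct P t with
      | none => .output
      | some (.fence o s) => .recurse [S.addFence (.ev t (S.hist t).length (.fence o s))]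
      | some (.read x o s) => .recurse <| (S.writes P x).map fun w =>
          S.addRead w.1 (.ev t (S.hist t).length (.read x w.2 o s))
      | some (.write x v o s b) => .recurse <|
          S.writeCalls P (.ev t (S.hist t).length (.write x v o s b)) x v

/-- The call that is reached from the call with argument `S` by following the given positions in
the lists of recursive calls, if there is one. -/
noncomputable def callAt : State Tid Loc Val → List ℕ → Option (State Tid Loc Val)
  | S, [] => some S
  | S, i :: p =>
    match (S.explore P nev).calls[i]? with
    | none => none
    | some S' => callAt S' p

/-- The number of events, `rf` edges, `co` edges and reversibility marks that are stored. -/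
noncomputable def size : ℕ∞ :=
  S.exe.length + {p : Event Tid Loc Val × Event Tid Loc Val | S.rf p.1 p.2}.encard +
    {p : Event Tid Loc Val × Event Tid Loc Val | S.co p.1 p.2}.encard + S.rev.encard

end State

/-- The recursive call at position `p` (a list of child indices) of the call tree of the
exploration of `P`; the empty list is the initial call. Each call occurs at one position. -/
noncomputable def call {Tid Loc Val : Type*} (P : Program Tid Loc Val)
    (nev : Tid × ℕ → Tid × ℕ → Prop) (p : List ℕ) : Option (State Tid Loc Val) :=
  State.start.callAt P nev p

/-- The total size of the arguments on the recursion stack while the call at position `p` runs. -/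
noncomputable def stackSize {Tid Loc Val : Type*} (P : Program Tid Loc Val)
    (nev : Tid × ℕ → Tid × ℕ → Prop) (p : List ℕ) : ℕ∞ :=
  ∑ k ∈ Finset.range (p.length + 1), ((call P nev (p.take k)).map State.size).getD 0

end SRC11

open SRC11

/-!
Soundness rests on the invariants `State.Inv`, which a call passes on to the calls that it makes
(`Inv.forward`, `Inv.reversal`). A forward step adds a single event to the graph. A reversal
deletes the dropped events and the read, adds the write, and adds the read again with its new
source, so both kinds of steps reduce to `ExecGraph.del` and `ExecGraph.add`. The events that are
deleted can be deleted at all, because they are closed under successors in `po ∪ rf`.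

For termination and space, consider the set `State.fixedSet` of the writes that have reversed a
read and of all events before such a write. None of them is ever deleted. Suppose that `w` has
reversed `r`, and that the reversal of a read `r₁` deletes `w` or an event before `w`. As the
deleted events are closed under successors, `w` is deleted, so `r₁` was executed before `w`. If it
was executed after `r`, then it is before `w` and no longer reversible. Otherwise `r` is `r₁` itself
or deleted as well, although it reads from a later deleted event, which `CheckOptimal` forbids.
A reversal strictly enlarges the set (`Reversal.fixedSet_ssubset`), and a forward step adds one
event. Hence the number `(N + 1) * |fixedSet| + |exe|` increases from each call to the calls that it
makes, which bounds the depth (`depth_le`).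

Optimality and completeness both come from one relation, `State.OnTrack`: a state lies on the way
to a graph `G`. What has to be built next is described by a `Guide`, which consists of a graph `H`
that the state has to become a part of and of a write that is awaited, if any. At first `H = G`,
and nothing is awaited. When the next event is a read whose source `w` in `H` has not been
executed, the read is postponed: it reads from a `co`-maximal write for the time being, `w` is
awaited, and the new guide consists of the events executed so far, those before `w`, and the read.
Events outside of the guide may be executed only while a write is awaited, and only in a maximal
way: reading from a `co`-maximal write, or becoming `co`-maximal. When `w` has arrived and has
reversed the read, the events that were added in the meantime and are not before `w` are gone.

The executed events determine the guide (`Guide.Run.unique`), because there is at most one maximal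
way to add the next event of a thread. The parent of a state on the way to `G` is on the way to `G`
as well (`OnTrack.parent`). For reversals this uses `CheckOptimal`, which says that every dropped
event was added in a maximal way (`Reversal.exists_del_eq_add`), so that they can be put back one
by one. At most one child of a state on the way to `G` is on the way to `G`
(`OnTrack.child_unique`), and none is if `G` is the graph of the state itself
(`OnTrack.not_child_self`). Every state is on the way to its own graph. So if two calls have the
same graph `G`, then the paths from the root to both of them consist of states on the way to `G`;
they cannot branch, and neither can properly extend the other (`eq_of_graph_eq`). The function
`Prev` then exists by choice.

For completeness, let `G` be full. The root is on the way to `G`, and a state on the way to `G` has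
a child on the way to `G` (`OnTrack.exists_child`) unless no thread has a next action, in which
case its graph is `G` (`OnTrack.graph_eq_of_finished`). What has to be shown is that the calls
involved are not pruned: their graphs are parts of guides, and guides stay consistent since a
maximal addition preserves consistency (`Consistent.add`). The exception is the atomicity of an RMW
whose read does not read from a `co`-maximal write; the predicate `Guide.Good` rules it out for the
threads that are in the middle of an RMW.
-/

namespace SRC11

open Relation

variable {Tid Loc Val : Type*}

/-! ### Positions, program order and histories -/

namespace Event

/-- The thread of an event and its index in the thread; initial writes have no position. In an
execution graph, an event other than an initial write is determined by its position. -/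
def pos : Event Tid Loc Val → Option (Tid × ℕ)
  | .init _ => none
  | .ev t n _ => some (t, n)

lemma pos_ev (t : Tid) (n : ℕ) (l : Label Loc Val) : (Event.ev t n l).pos = some (t, n) := rfl

lemma pos_eq_some {e : Event Tid Loc Val} {t : Tid} {n : ℕ} :
    e.pos = some (t, n) ↔ ∃ l, e = .ev t n l := by
  cases e <;> simp [pos]

lemma PoBefore.irrefl (a : Event Tid Loc Val) : ¬ a.PoBefore a := by
  cases a <;> simp [PoBefore]

lemma PoBefore.not_init {a b : Event Tid Loc Val} (h : a.PoBefore b) : ¬ b.IsInit := by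
  cases a <;> cases b <;> simp_all [PoBefore, IsInit]

lemma PoBefore.congr_pos {a b c : Event Tid Loc Val} (h : a.PoBefore b) (hp : b.pos = c.pos) :
    a.PoBefore c := by
  cases a <;> cases b <;> cases c <;> simp_all [PoBefore, pos]

lemma isRead_iff {e : Event Tid Loc Val} :
    e.IsRead ↔ ∃ t n x v o s, e = .ev t n (.read x v o s) := by
  rcases e with _ | ⟨t, n, _ | _ | _⟩ <;> simp [IsRead]

lemma IsRead.not_isWrite {e : Event Tid Loc Val} (h : e.IsRead) : ¬ e.IsWrite := by
  rcases e with _ | ⟨t, n, _ | _ | _⟩ <;> simp_all [IsRead, IsWrite]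

lemma IsRead.not_isInit {e : Event Tid Loc Val} (h : e.IsRead) : ¬ e.IsInit := by
  rcases e with _ | ⟨t, n, _ | _ | _⟩ <;> simp_all [IsRead, IsInit]

lemma IsFence.not_isRead {e : Event Tid Loc Val} (h : e.IsFence) : ¬ e.IsRead := by
  rcases e with _ | ⟨t, n, _ | _ | _⟩ <;> simp_all [IsRead, IsFence]

lemma IsFence.not_isWrite {e : Event Tid Loc Val} (h : e.IsFence) : ¬ e.IsWrite := by
  rcases e with _ | ⟨t, n, _ | _ | _⟩ <;> simp_all [IsWrite, IsFence]

lemma SameLoc.symm {a b : Event Tid Loc Val} : a.SameLoc b → b.SameLoc a :=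
  fun ⟨x, h, h'⟩ => ⟨x, h', h⟩

lemma SameLoc.trans {a b c : Event Tid Loc Val} : a.SameLoc b → b.SameLoc c → a.SameLoc c := by
  rintro ⟨x, h, h'⟩ ⟨y, h1, h1'⟩
  exact ⟨x, h, by rw [h1'] ; rw [h'] at h1; exact h1.symm⟩

lemma isInit_iff {e : Event Tid Loc Val} : e.IsInit ↔ ∃ x, e = .init x := by
  cases e <;> simp [IsInit]

lemma pos_eq_none {e : Event Tid Loc Val} : e.pos = none ↔ e.IsInit := by
  cases e <;> simp [IsInit, pos]

lemma isWrite_or_isRead_of_not_isFence {e : Event Tid Loc Val} (h : ¬ e.IsFence) :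
    e.IsWrite ∨ e.IsRead := by
  rcases e with _ | ⟨t, n, _ | _ | _⟩ <;> simp_all [IsWrite, IsRead, IsFence]

end Event

namespace ExecGraph

variable {P : Program Tid Loc Val} {G : ExecGraph Tid Loc Val} {t : Tid}

/-- The union of `po` and `rf`. -/
abbrev porf (G : ExecGraph Tid Loc Val) : Event Tid Loc Val → Event Tid Loc Val → Prop :=
  G.po ⊔ G.rf

lemma porf_iff {a b : Event Tid Loc Val} : G.porf a b ↔ G.po a b ∨ G.rf a b := Iff.rfl

lemma po.mem_right {a b : Event Tid Loc Val} (h : G.po a b) : b ∈ G.E :=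
  h.2.1.resolve_left h.2.2.not_init

lemma mem_of_mem {e : Event Tid Loc Val} (h : e ∈ G.E) : G.Mem e := Or.inr h

lemma IsHistory.unique {h h' : List (Label Loc Val)} (H : G.IsHistory t h)
    (H' : G.IsHistory t h') : h = h' := by
  apply List.ext_getElem?
  intro n
  ext l
  exact (H n l).symm.trans (H' n l)

lemma IsHistory.lt_length {h : List (Label Loc Val)} (H : G.IsHistory t h) {n : ℕ}
    {l : Label Loc Val} (hl : .ev t n l ∈ G.E) : n < h.length := by
  have := (H n l).1 hl
  exact (List.getElem?_eq_some_iff.1 this).1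

lemma IsHistory.mem_of_lt {h : List (Label Loc Val)} (H : G.IsHistory t h) {n : ℕ}
    (hn : n < h.length) : .ev t n h[n] ∈ G.E :=
  (H n _).2 (List.getElem?_eq_getElem hn)

namespace IsExecution

lemma not_isInit (hG : G.IsExecution P) {e : Event Tid Loc Val} (he : e ∈ G.E) : ¬ e.IsInit := by
  rw [Event.isInit_iff]
  rintro ⟨x, rfl⟩
  exact hG.init_notMem x he

lemma eq_of_pos (hG : G.IsExecution P) {a b : Event Tid Loc Val} (ha : a ∈ G.E) (hb : b ∈ G.E)
    (h : a.pos = b.pos) : a = b := by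
  rcases a with _ | ⟨t, n, l⟩
  · exact absurd ha (hG.init_notMem _)
  rcases b with _ | ⟨t', n', l'⟩
  · exact absurd hb (hG.init_notMem _)
  simp only [Event.pos, Option.some.injEq, Prod.mk.injEq] at h
  obtain ⟨rfl, rfl⟩ := h
  obtain ⟨h, H, -⟩ := hG.history t
  have h1 := (H _ _).1 ha
  have h2 := (H _ _).1 hb
  rw [h1] at h2
  simp_all

lemma exists_pos (hG : G.IsExecution P) {a : Event Tid Loc Val} (ha : a ∈ G.E) :
    ∃ t n l, a = .ev t n l := by
  rcases a with _ | ⟨t, n, l⟩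
  · exact absurd ha (hG.init_notMem _)
  exact ⟨_, _, _, rfl⟩

lemma exists_mem_of_lt (hG : G.IsExecution P) {n m : ℕ} {l : Label Loc Val}
    (hl : .ev t n l ∈ G.E) (hm : m < n) : ∃ l', .ev t m l' ∈ G.E := by
  obtain ⟨h, H, -⟩ := hG.history t
  exact ⟨_, H.mem_of_lt (hm.trans (H.lt_length hl))⟩

lemma rf_read (hG : G.IsExecution P) {a b : Event Tid Loc Val} (h : G.rf a b) : b.IsRead := by
  obtain ⟨-, -, x, v, t, n, o, s, -, rfl⟩ := hG.rf_wf _ _ h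
  trivial

lemma rf_mem (hG : G.IsExecution P) {a b : Event Tid Loc Val} (h : G.rf a b) : b ∈ G.E :=
  (hG.rf_wf _ _ h).2.1.resolve_left (hG.rf_read h).not_isInit

lemma rf_write (hG : G.IsExecution P) {a b : Event Tid Loc Val} (h : G.rf a b) : a.IsWrite := by
  obtain ⟨-, -, x, v, t, n, o, s, (⟨rfl, -⟩ | ⟨_, _, _, _, _, rfl⟩), -⟩ := hG.rf_wf _ _ h <;> trivial

lemma rf_sameLoc (hG : G.IsExecution P) {a b : Event Tid Loc Val} (h : G.rf a b) :
    a.SameLoc b := by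
  obtain ⟨-, -, x, v, t, n, o, s, (⟨rfl, -⟩ | ⟨_, _, _, _, _, rfl⟩), rfl⟩ := hG.rf_wf _ _ h <;>
    exact ⟨x, rfl, rfl⟩

lemma rf_functional (hG : G.IsExecution P) {a a' b : Event Tid Loc Val} (h : G.rf a b)
    (h' : G.rf a' b) : a = a' :=
  (hG.rf_unique b (hG.rf_mem h) (hG.rf_read h)).unique h h'

lemma porf_mem_right (hG : G.IsExecution P) {a b : Event Tid Loc Val} (h : G.porf a b) :
    b ∈ G.E := h.elim po.mem_right hG.rf_mem

lemma porf_mem_left (hG : G.IsExecution P) {a b : Event Tid Loc Val} (h : G.porf a b) :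
    G.Mem a := h.elim (fun h => h.1) (fun h => (hG.rf_wf _ _ h).1)

lemma transGen_porf_mem_right (hG : G.IsExecution P) {a b : Event Tid Loc Val}
    (h : TransGen G.porf a b) : b ∈ G.E := by
  cases h with
  | single h => exact hG.porf_mem_right h
  | tail _ h => exact hG.porf_mem_right h

lemma transGen_porf_mem_left (hG : G.IsExecution P) {a b : Event Tid Loc Val}
    (h : TransGen G.porf a b) : G.Mem a := by
  induction h using TransGen.head_induction_on with
  | single h => exact hG.porf_mem_left h
  | head h _ _ => exact hG.porf_mem_left h

/-- A read has no outgoing `rf` edge, so that a `po ∪ rf` path from it starts with `po`. -/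
lemma exists_po_of_read (hG : G.IsExecution P) {a b : Event Tid Loc Val} (ha : a.IsRead)
    (h : TransGen G.porf a b) : ∃ c, G.po a c ∧ ReflTransGen G.porf c b := by
  obtain ⟨c, hc, hcb⟩ := TransGen.head'_iff.1 h
  refine ⟨c, ?_, hcb⟩
  rcases hc with hc | hc
  · exact hc
  · exact absurd (hG.rf_write hc) ha.not_isWrite

lemma co_mem (hG : G.IsExecution P) {a b : Event Tid Loc Val} (h : G.co a b) :
    G.Mem a ∧ G.Mem b := ⟨(hG.co_wf _ _ h).1, (hG.co_wf _ _ h).2.1⟩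

end IsExecution

/-! ### Removing events from a graph -/

/-- The graph without the events of `D`. -/
def del (G : ExecGraph Tid Loc Val) (D : Set (Event Tid Loc Val)) : ExecGraph Tid Loc Val :=
  ⟨G.E \ D, fun a b => G.rf a b ∧ a ∉ D ∧ b ∉ D, fun a b => G.co a b ∧ a ∉ D ∧ b ∉ D⟩

/-- A set of events that contains, with an event, all later ones in `po ∪ rf`. -/
structure UpClosed (G : ExecGraph Tid Loc Val) (D : Set (Event Tid Loc Val)) : Prop where
  subset : D ⊆ G.E
  closed : ∀ a b, G.porf a b → a ∈ D → b ∈ D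

variable {D : Set (Event Tid Loc Val)}

lemma UpClosed.not_init (hG : G.IsExecution P) (hD : G.UpClosed D) {e : Event Tid Loc Val}
    (he : e.IsInit) : e ∉ D :=
  fun h => hG.not_isInit (hD.subset h) he

lemma mem_del (hG : G.IsExecution P) (hD : G.UpClosed D) {e : Event Tid Loc Val} :
    (G.del D).Mem e ↔ G.Mem e ∧ e ∉ D := by
  constructor
  · rintro (h | h)
    · exact ⟨.inl h, hD.not_init hG h⟩
    · exact ⟨.inr h.1, h.2⟩
  · rintro ⟨h | h, h'⟩
    · exact .inl h
    · exact .inr ⟨h, h'⟩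

lemma porf_del (hG : G.IsExecution P) (hD : G.UpClosed D) {a b : Event Tid Loc Val} :
    (G.del D).porf a b ↔ G.porf a b ∧ b ∉ D := by
  simp only [porf_iff]
  constructor
  · rintro (h | h)
    · refine ⟨.inl ⟨((mem_del hG hD).1 h.1).1, ((mem_del hG hD).1 h.2.1).1, h.2.2⟩, ?_⟩
      exact ((mem_del hG hD).1 h.2.1).2
    · exact ⟨.inr h.1, h.2.2⟩
  · rintro ⟨h, hb⟩
    have ha : a ∉ D := fun ha => hb (hD.closed _ _ h ha)
    rcases h with h | h
    · exact .inl ⟨(mem_del hG hD).2 ⟨h.1, ha⟩, (mem_del hG hD).2 ⟨h.2.1, hb⟩, h.2.2⟩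
    · exact .inr ⟨h, ha, hb⟩

lemma transGen_porf_del (hG : G.IsExecution P) (hD : G.UpClosed D) {a b : Event Tid Loc Val} :
    TransGen (G.del D).porf a b ↔ TransGen G.porf a b ∧ b ∉ D := by
  constructor
  · intro h
    refine ⟨TransGen.mono (fun _ _ h => ((porf_del hG hD).1 h).1) _ _ h, ?_⟩
    cases h with
    | single h => exact ((porf_del hG hD).1 h).2
    | tail _ h => exact ((porf_del hG hD).1 h).2
  · rintro ⟨h, hb⟩
    induction h with
    | single h => exact .single ((porf_del hG hD).2 ⟨h, hb⟩)
    | tail _ h ih => exact .tail (ih fun h' => hb (hD.closed _ _ h h')) ((porf_del hG hD).2 ⟨h, hb⟩)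

lemma UpClosed.transGen (hD : G.UpClosed D) {a b : Event Tid Loc Val}
    (h : TransGen G.porf a b) (ha : a ∈ D) : b ∈ D := by
  induction h with
  | single h => exact hD.closed _ _ h ha
  | tail _ h ih => exact hD.closed _ _ h ih

lemma isHistory_del (hG : G.IsExecution P) (hD : G.UpClosed D) {h : List (Label Loc Val)}
    (H : G.IsHistory t h) : ∃ m ≤ h.length, (G.del D).IsHistory t (h.take m) ∧
      (m < h.length → ∃ l, .ev t m l ∈ D) := by
  classical
  -- the first index of an event of the thread that is not kept
  have hex : ∃ m, ∀ l, .ev t m l ∈ G.E → .ev t m l ∈ D :=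
    ⟨h.length, fun l hl => absurd (H.lt_length hl) (lt_irrefl _)⟩
  have hspec := Nat.find_spec hex
  refine ⟨Nat.find hex, Nat.find_min' hex fun l hl => absurd (H.lt_length hl) (lt_irrefl _), ?_, ?_⟩
  · intro n l
    rw [List.getElem?_take]
    constructor
    · rintro ⟨hE, hnD⟩
      have hlt : n < Nat.find hex := by
        by_contra hge
        rcases (not_lt.1 hge).lt_or_eq with hlt | heq
        · obtain ⟨l', hl'⟩ := hG.exists_mem_of_lt hE hlt
          exact hnD (hD.closed (.ev t _ l') _
            (.inl ⟨.inr hl', .inr hE, rfl, hlt⟩) (hspec l' hl'))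
        · rw [← heq] at hE hnD
          exact hnD (hspec l hE)
      rw [if_pos hlt]
      exact (H n l).1 hE
    · split_ifs with hlt
      · intro hl
        have hmin := Nat.find_min hex hlt
        push Not at hmin
        obtain ⟨l', hE', hD'⟩ := hmin
        have hE := (H n l).2 hl
        have := hG.eq_of_pos hE hE' rfl
        exact ⟨hE, this ▸ hD'⟩
      · simp
  · intro hlt
    exact ⟨_, hspec _ (H.mem_of_lt hlt)⟩

/-- If `f` is the first event of its thread that is removed, then the events before `f` are left. -/
lemma isHistory_del_of_first (hD : G.UpClosed D) {h : List (Label Loc Val)}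
    (H : G.IsHistory t h) {n : ℕ} {l : Label Loc Val} (hf : .ev t n l ∈ D)
    (hpred : ∀ m l', m < n → .ev t m l' ∉ D) : (G.del D).IsHistory t (h.take n) := by
  intro k l'
  rw [List.getElem?_take]
  split_ifs with hk
  · rw [← H k l']
    exact ⟨fun h => h.1, fun h => ⟨h, hpred _ _ hk⟩⟩
  · simp only [iff_false]
    rintro ⟨hE, hnD⟩
    rcases (not_lt.1 hk).lt_or_eq with hlt | rfl
    · exact hnD (hD.closed _ _ (.inl ⟨.inr (hD.subset hf), .inr hE, rfl, hlt⟩) hf)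
    · have h1 := (H _ _).1 hE
      have h2 := (H _ _).1 (hD.subset hf)
      rw [h1] at h2
      simp only [Option.some.injEq] at h2
      exact hnD (h2 ▸ hf)

lemma IsExecution.del (hG : G.IsExecution P) (hD : G.UpClosed D) : (G.del D).IsExecution P where
  init_notMem x h := hG.init_notMem x h.1
  history t := by
    obtain ⟨h, H, hnext⟩ := hG.history t
    obtain ⟨m, hm, Hm, -⟩ := isHistory_del hG hD H
    refine ⟨_, Hm, fun n l hl => ?_⟩
    rw [List.getElem?_take] at hl
    split_ifs at hl with hnm
    obtain ⟨a, ha, hal⟩ := hnext n l hl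
    exact ⟨a, by rw [List.take_take, min_eq_left hnm.le]; exact ha, hal⟩
  rf_wf w r h := by
    obtain ⟨h1, h2, h3⟩ := hG.rf_wf w r h.1
    exact ⟨(mem_del hG hD).2 ⟨h1, h.2.1⟩, (mem_del hG hD).2 ⟨h2, h.2.2⟩, h3⟩
  rf_unique r hr hread := by
    obtain ⟨w, hw, huniq⟩ := hG.rf_unique r hr.1 hread
    exact ⟨w, ⟨hw, fun h => hr.2 (hD.closed _ _ (.inr hw) h), hr.2⟩, fun w' hw' => huniq _ hw'.1⟩
  co_wf a b h := by
    obtain ⟨h1, h2, h3⟩ := hG.co_wf a b h.1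
    exact ⟨(mem_del hG hD).2 ⟨h1, h.2.1⟩, (mem_del hG hD).2 ⟨h2, h.2.2⟩, h3⟩
  co_irrefl a h := hG.co_irrefl a h.1
  co_trans a b c h h' := ⟨hG.co_trans a b c h.1 h'.1, h.2.1, h'.2.2⟩
  co_total a b ha hb hwa hwb hl hne := by
    rw [mem_del hG hD] at ha hb
    rcases hG.co_total a b ha.1 hb.1 hwa hwb hl hne with h | h
    · exact .inl ⟨h, ha.2, hb.2⟩
    · exact .inr ⟨h, hb.2, ha.2⟩

lemma PoRfAcyclic.del (hG : G.IsExecution P) (hD : G.UpClosed D) (h : G.PoRfAcyclic) :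
    (G.del D).PoRfAcyclic :=
  fun a ha => h a ((transGen_porf_del hG hD).1 ha).1

lemma del_empty : G.del ∅ = G := by
  ext <;> simp [ExecGraph.del]

/-! ### Adding an event to a graph -/

/-- Adds the event `e`. If `e` is a read, it reads from `m`; if `e` is a write, it is placed
immediately after `m` in `co`; if `e` is a fence, `m` does not matter. -/
def add (G : ExecGraph Tid Loc Val) (m e : Event Tid Loc Val) : ExecGraph Tid Loc Val :=
  ⟨insert e G.E, fun a b => G.rf a b ∨ (e.IsRead ∧ a = m ∧ b = e),
    fun a b => G.co a b ∨ (e.IsWrite ∧ ((b = e ∧ (a = m ∨ G.co a m)) ∨ (a = e ∧ G.co m b)))⟩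

/-- The event `e` is the next event of its thread in `G`, and if it accesses memory, then `m` is a
write of `G` from which it may read, or after which it may be placed in `co`. -/
def Fits (P : Program Tid Loc Val) (G : ExecGraph Tid Loc Val) (m e : Event Tid Loc Val) : Prop :=
  ∃ t h a l, e = .ev t h.length l ∧ G.IsHistory t h ∧ P.next t h = some a ∧ a.Matches l ∧
    (¬ e.IsFence → G.Mem m ∧ m.IsWrite ∧ m.SameLoc e) ∧
    ∀ x v o s, l = .read x v o s → P.Writes m x v

variable {m e : Event Tid Loc Val}

lemma Fits.not_init (h : G.Fits P m e) : ¬ e.IsInit := by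
  obtain ⟨t, h, a, l, rfl, -⟩ := h
  exact id

lemma Fits.pos_ne (h : G.Fits P m e) {b : Event Tid Loc Val} (hb : b ∈ G.E) : b.pos ≠ e.pos := by
  obtain ⟨t, h, a, l, rfl, H, -⟩ := h
  rw [Event.pos_ev]
  intro hp
  obtain ⟨l', rfl⟩ := Event.pos_eq_some.1 hp
  exact lt_irrefl _ (H.lt_length hb)

lemma Fits.notMem (h : G.Fits P m e) : e ∉ G.E := fun he => h.pos_ne he rfl

lemma Fits.not_mem (h : G.Fits P m e) : ¬ G.Mem e := fun he => he.elim h.not_init h.notMem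

lemma Fits.not_poBefore (h : G.Fits P m e) {b : Event Tid Loc Val} (hb : G.Mem b) :
    ¬ e.PoBefore b := by
  obtain ⟨t, h, a, l, rfl, H, -⟩ := h
  rcases b with _ | ⟨t', n, l'⟩
  · exact id
  · rintro ⟨rfl, hlt⟩
    exact (H.lt_length (hb.resolve_left id)).not_gt hlt

lemma mem_add {b : Event Tid Loc Val} : (G.add m e).Mem b ↔ G.Mem b ∨ b = e := by
  unfold Mem add
  simp only [Set.mem_insert_iff]
  tauto

lemma porf_add (hG : G.IsExecution P) (he : G.Fits P m e) {a b : Event Tid Loc Val}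
    (h : (G.add m e).porf a b) : a ≠ e ∧ (b ≠ e → G.porf a b) := by
  rcases h with h | h
  · have h1 := mem_add.1 h.1
    have h2 := mem_add.1 h.2.1
    refine ⟨?_, fun hb => .inl ⟨?_, h2.resolve_right hb, h.2.2⟩⟩
    · rintro rfl
      rcases h2 with h2 | rfl
      · exact he.not_poBefore h2 h.2.2
      · exact h.2.2.irrefl
    · refine h1.resolve_right ?_
      rintro rfl
      exact he.not_poBefore (h2.resolve_right hb) h.2.2
  · rcases h with h | ⟨hr, rfl, rfl⟩
    · refine ⟨?_, fun _ => .inr h⟩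
      rintro rfl
      exact he.not_mem (hG.rf_wf _ _ h).1
    · refine ⟨?_, fun hb => absurd rfl hb⟩
      rintro rfl
      obtain ⟨t, h, a, l, rfl, -, -, -, h5, -⟩ := he
      exact hr.not_isWrite (h5 fun hf => hf.not_isRead hr).2.1

lemma transGen_porf_add (hG : G.IsExecution P) (he : G.Fits P m e) {a b : Event Tid Loc Val}
    (h : TransGen (G.add m e).porf a b) : a ≠ e ∧ (b ≠ e → TransGen G.porf a b) := by
  induction h with
  | single h =>
    exact ⟨(porf_add hG he h).1, fun hb => .single ((porf_add hG he h).2 hb)⟩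
  | tail _ h ih =>
    exact ⟨ih.1, fun hb => .tail (ih.2 (porf_add hG he h).1) ((porf_add hG he h).2 hb)⟩

lemma PoRfAcyclic.add (h : G.PoRfAcyclic) (hG : G.IsExecution P) (he : G.Fits P m e) :
    (G.add m e).PoRfAcyclic := fun a ha =>
  have := transGen_porf_add hG he ha
  h a (this.2 this.1)

lemma IsHistory.add {h : List (Label Loc Val)} (H : G.IsHistory t h) {l : Label Loc Val} :
    (G.add m (.ev t h.length l)).IsHistory t (h ++ [l]) := by
  intro n l'
  simp only [ExecGraph.add, Set.mem_insert_iff, Event.ev.injEq, true_and]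
  rw [H n l']
  rcases lt_trichotomy n h.length with hn | rfl | hn
  · rw [List.getElem?_append_left hn]
    simp [hn.ne]
  · simp [eq_comm]
  · rw [List.getElem?_eq_none hn.le, List.getElem?_eq_none (by simp; omega)]
    simp [hn.ne']

lemma IsHistory.add_of_ne {h : List (Label Loc Val)} (H : G.IsHistory t h) {t' : Tid} {n : ℕ}
    {l : Label Loc Val} (hne : t ≠ t') : (G.add m (.ev t' n l)).IsHistory t h := by
  intro n' l'
  rw [← H n' l']
  simp [ExecGraph.add, hne]

lemma IsExecution.add (hG : G.IsExecution P) (he : G.Fits P m e) : (G.add m e).IsExecution P := by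
  have hnm := he.not_mem
  have hni := he.not_init
  obtain ⟨t, h, a, l, rfl, H, hnext, hal, hm, hval⟩ := id he
  refine ⟨?_, ?_, ?_, ?_, ?_, ?_, ?_, ?_⟩
  · rintro x (hx | hx)
    · cases hx
    · exact hG.init_notMem x hx
  · intro t'
    obtain ⟨h', H', hn'⟩ := hG.history t'
    by_cases ht : t' = t
    · subst ht
      obtain rfl := H.unique H'
      refine ⟨_, H.add, fun n l' hl' => ?_⟩
      rw [List.getElem?_append] at hl'
      split_ifs at hl' with hlt
      · rw [List.take_append_of_le_length hlt.le]
        exact hn' n l' hl'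
      · obtain ⟨hlt', hl'⟩ := List.getElem?_eq_some_iff.1 hl'
        have hn : n = h.length := by simp at hlt'; omega
        subst hn
        simp only [tsub_self, List.getElem_cons_zero] at hl'
        subst hl'
        exact ⟨a, by simpa using hnext, hal⟩
    · exact ⟨h', H'.add_of_ne ht, hn'⟩
  · rintro w r (hr | ⟨hr, rfl, rfl⟩)
    · obtain ⟨h1, h2, h3⟩ := hG.rf_wf w r hr
      exact ⟨mem_add.2 (.inl h1), mem_add.2 (.inl h2), h3⟩
    · refine ⟨mem_add.2 (.inl (hm fun hf => hf.not_isRead hr).1), mem_add.2 (.inr rfl), ?_⟩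
      obtain ⟨t', n, x, v, o, s, heq⟩ := Event.isRead_iff.1 hr
      rw [heq]
      cases heq
      exact ⟨x, v, _, _, o, s, hval _ _ _ _ rfl, rfl⟩
  · rintro r (rfl | hr) hread
    · refine ⟨m, .inr ⟨hread, rfl, rfl⟩, ?_⟩
      rintro w (hw | hw)
      · exact absurd (hG.rf_wf _ _ hw).2.1 hnm
      · exact hw.2.1
    · obtain ⟨w, hw, huniq⟩ := hG.rf_unique r hr hread
      refine ⟨w, .inl hw, ?_⟩
      rintro w' (hw' | ⟨-, -, rfl⟩)
      · exact huniq _ hw'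
      · exact absurd (.inr hr) hnm
  · rintro b c (hbc | ⟨hw, ⟨rfl, hb⟩ | ⟨rfl, hc⟩⟩)
    · obtain ⟨h1, h2, h3⟩ := hG.co_wf _ _ hbc
      exact ⟨mem_add.2 (.inl h1), mem_add.2 (.inl h2), h3⟩
    · obtain ⟨hm1, hm2, hm3⟩ := hm fun hf => hf.not_isWrite hw
      rcases hb with rfl | hb
      · exact ⟨mem_add.2 (.inl hm1), mem_add.2 (.inr rfl), hm2, hw, hm3⟩
      · obtain ⟨h1, h2, h3, h4, h5⟩ := hG.co_wf _ _ hb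
        exact ⟨mem_add.2 (.inl h1), mem_add.2 (.inr rfl), h3, hw, h5.trans hm3⟩
    · obtain ⟨hm1, hm2, hm3⟩ := hm fun hf => hf.not_isWrite hw
      obtain ⟨h1, h2, h3, h4, h5⟩ := hG.co_wf _ _ hc
      exact ⟨mem_add.2 (.inr rfl), mem_add.2 (.inl h2), hw, h4, hm3.symm.trans h5⟩
  · rintro b (hb | ⟨hw, ⟨rfl, rfl | hb⟩ | ⟨rfl, hb⟩⟩)
    · exact hG.co_irrefl _ hb
    · exact hnm (hm fun hf => hf.not_isWrite hw).1
    · exact hnm (hG.co_mem hb).1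
    · exact hnm (hG.co_mem hb).2
  · have hn1 : ∀ b, ¬ G.co (.ev t h.length l) b := fun b hb => hnm (hG.co_mem hb).1
    have hn2 : ∀ b, ¬ G.co b (.ev t h.length l) := fun b hb => hnm (hG.co_mem hb).2
    have htr := hG.co_trans
    have hirr := hG.co_irrefl
    rintro b c d (hbc | ⟨hw, ⟨rfl, hb⟩ | ⟨rfl, hc⟩⟩) (hcd | ⟨hw', ⟨hd, hc'⟩ | ⟨hc', hd⟩⟩)
    · exact .inl (htr _ _ _ hbc hcd)
    · subst hd
      exact .inr ⟨hw', .inl ⟨rfl, .inr (hc'.elim (fun h => h ▸ hbc) (htr _ _ _ hbc))⟩⟩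
    · subst hc'
      exact absurd hbc (hn2 _)
    · exact absurd hcd (hn1 _)
    · rcases hc' with rfl | hc'
      · exact absurd (hm fun hf => hf.not_isWrite hw).1 hnm
      · exact absurd hc' (hn1 _)
    · exact .inl (hb.elim (fun h => h ▸ hd) fun h => htr _ _ _ h hd)
    · exact .inr ⟨hw, .inr ⟨rfl, htr _ _ _ hc hcd⟩⟩
    · rcases hc' with rfl | hc'
      · exact absurd hc (hirr _)
      · exact absurd (htr _ _ _ hc hc') (hirr _)
    · subst hc'
      exact absurd hc (hn2 _)
  · intro b c hb hc hwb hwc hloc hne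
    rw [mem_add] at hb hc
    -- the new write comes after `m` and what is before `m`, and before everything after `m`
    have key : ∀ d, G.Mem d → d.IsWrite → d.SameLoc (.ev t h.length l) →
        Event.IsWrite (.ev t h.length l) →
        (d = m ∨ G.co d m) ∨ G.co m d := fun d hd hwd hld hw => by
      obtain ⟨hm1, hm2, hm3⟩ := hm fun hf => hf.not_isWrite hw
      by_cases hdm : d = m
      · exact .inl (.inl hdm)
      · rcases hG.co_total d m hd hm1 hwd hm2 (hld.trans hm3.symm) hdm with h | h
        · exact .inl (.inr h)
        · exact .inr h
    rcases hb with hb | rfl <;> rcases hc with hc | rfl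
    · rcases hG.co_total b c hb hc hwb hwc hloc hne with h | h
      · exact .inl (.inl h)
      · exact .inr (.inl h)
    · rcases key b hb hwb hloc hwc with h | h
      · exact .inl (.inr ⟨hwc, .inl ⟨rfl, h⟩⟩)
      · exact .inr (.inr ⟨hwc, .inr ⟨rfl, h⟩⟩)
    · rcases key c hc hwc hloc.symm hwb with h | h
      · exact .inr (.inr ⟨hwb, .inl ⟨rfl, h⟩⟩)
      · exact .inl (.inr ⟨hwb, .inr ⟨rfl, h⟩⟩)
    · exact absurd rfl hne

end ExecGraph

/-! ### Consistency of subgraphs and of maximal extensions -/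

lemma comp_mono {α : Type*} {R R' S S' : α → α → Prop} (h : R ≤ R') (h' : S ≤ S') :
    (R ⨾ S) ≤ (R' ⨾ S') :=
  fun _ _ ⟨c, h1, h2⟩ => ⟨c, h _ _ h1, h' _ _ h2⟩

lemma reflGen_mono {α : Type*} {R R' : α → α → Prop} (h : R ≤ R') : ReflGen R ≤ ReflGen R' :=
  fun _ _ h1 => ReflGen.mono h _ _ h1

lemma reflTransGen_mono {α : Type*} {R R' : α → α → Prop} (h : R ≤ R') :
    ReflTransGen R ≤ ReflTransGen R' :=
  fun _ _ h1 => ReflTransGen.mono h _ _ h1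

lemma transGen_mono {α : Type*} {R R' : α → α → Prop} (h : R ≤ R') :
    TransGen R ≤ TransGen R' :=
  fun _ _ h1 => TransGen.mono h _ _ h1

lemma onLoc_mono {R R' : Event Tid Loc Val → Event Tid Loc Val → Prop} (h : R ≤ R') :
    onLoc R ≤ onLoc R' := fun _ _ h1 => ⟨h _ _ h1.1, h1.2⟩

lemma offLoc_mono {R R' : Event Tid Loc Val → Event Tid Loc Val → Prop} (h : R ≤ R') :
    offLoc R ≤ offLoc R' := fun _ _ h1 => ⟨h _ _ h1.1, h1.2⟩

namespace ExecGraph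

variable {P : Program Tid Loc Val} {G G' : ExecGraph Tid Loc Val}

/-- `G` is a subgraph of `G'`. -/
structure Sub (G G' : ExecGraph Tid Loc Val) : Prop where
  mem : ∀ e, G.Mem e → G'.Mem e
  rf : G.rf ≤ G'.rf
  co : G.co ≤ G'.co

namespace Sub

lemma po (h : G.Sub G') : G.po ≤ G'.po := fun _ _ h1 => ⟨h.mem _ h1.1, h.mem _ h1.2.1, h1.2.2⟩

lemma rmw (h : G.Sub G') : G.rmw ≤ G'.rmw := fun _ _ h1 => ⟨h.mem _ h1.1, h.mem _ h1.2.1, h1.2.2⟩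

lemma fr (h : G.Sub G') : G.fr ≤ G'.fr := comp_mono (fun _ _ h1 => h.rf _ _ h1) h.co

lemma eco (h : G.Sub G') : G.eco ≤ G'.eco :=
  transGen_mono (sup_le_sup (sup_le_sup h.rf h.co) h.fr)

lemma porf (h : G.Sub G') : G.porf ≤ G'.porf := sup_le_sup h.po h.rf

lemma rseq (h : G.Sub G') : G.rseq P ≤ G'.rseq P :=
  comp_mono le_rfl <| comp_mono (reflGen_mono (onLoc_mono h.po)) <| comp_mono le_rfl <|
    reflTransGen_mono <| comp_mono (inf_le_inf le_rfl h.rf) h.rmw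

lemma sw (h : G.Sub G') : G.sw P ≤ G'.sw P :=
  comp_mono (comp_mono le_rfl (reflGen_mono (comp_mono le_rfl h.po))) <| comp_mono h.rseq <|
    comp_mono (inf_le_inf le_rfl h.rf) <| comp_mono (reflGen_mono (comp_mono h.po le_rfl)) le_rfl

lemma hb (h : G.Sub G') : G.hb P ≤ G'.hb P :=
  transGen_mono (sup_le_sup h.po (inf_le_inf le_rfl h.sw))

lemma scb (h : G.Sub G') : G.scb P ≤ G'.scb P :=
  sup_le_sup (sup_le_sup (sup_le_sup (sup_le_sup h.po
    (comp_mono (offLoc_mono h.po) (comp_mono h.hb (offLoc_mono h.po)))) (onLoc_mono h.hb))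
    h.co) h.fr

lemma psc (h : G.Sub G') : G.psc P ≤ G'.psc P :=
  sup_le_sup
    (comp_mono (sup_le_sup le_rfl (comp_mono le_rfl (reflGen_mono h.hb))) <| comp_mono h.scb <|
      sup_le_sup le_rfl (comp_mono (reflGen_mono h.hb) le_rfl))
    (comp_mono le_rfl <| comp_mono (sup_le_sup h.hb (comp_mono h.hb (comp_mono h.eco h.hb))) le_rfl)

/-- All relations of the model are monotone, hence so are its axioms. -/
lemma consistent (h : G.Sub G') (hG' : G'.Consistent P) : G.Consistent P where
  poRfAcyclic a ha := hG'.poRfAcyclic a (transGen_mono h.porf _ _ ha)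
  coherent a ha := hG'.coherent a (comp_mono h.hb (reflGen_mono h.eco) _ _ ha)
  atomic a b hab := hG'.atomic a b ⟨h.rmw _ _ hab.1, comp_mono h.fr h.co _ _ hab.2⟩
  inclPscAcyclic a ha := hG'.inclPscAcyclic a (transGen_mono (inf_le_inf le_rfl h.psc) _ _ ha)

end Sub

lemma sub_add (G : ExecGraph Tid Loc Val) (m e : Event Tid Loc Val) : G.Sub (G.add m e) :=
  ⟨fun _ h => mem_add.2 (.inl h), fun _ _ h => .inl h, fun _ _ h => .inl h⟩

lemma del_sub (G : ExecGraph Tid Loc Val) (D : Set (Event Tid Loc Val)) : (G.del D).Sub G :=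
  ⟨fun _ h => h.imp_right And.left, fun _ _ h => h.1, fun _ _ h => h.1⟩

end ExecGraph

/-- The relation `R'` extends `R` by edges into `e` only, and by nothing else. -/
def ExtInto {α : Type*} (e : α) (R R' : α → α → Prop) : Prop :=
  ∀ a b, R' a b → a ≠ e ∧ (b ≠ e → R a b)

/-- The relation `R'` extends `R` by edges into `e` only, and possibly by a loop at `e`. -/
def WeakExtInto {α : Type*} (e : α) (R R' : α → α → Prop) : Prop :=
  ∀ a b, R' a b → b ≠ e → a ≠ e ∧ R a b

section ExtInto

variable {α : Type*} {e : α} {R R' S S' : α → α → Prop}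

lemma ExtInto.weak (h : ExtInto e R R') : WeakExtInto e R R' :=
  fun a b hab hb => ⟨(h a b hab).1, (h a b hab).2 hb⟩

lemma ExtInto.comp_weak (h : ExtInto e R R') (h' : WeakExtInto e S S') :
    ExtInto e (R ⨾ S) (R' ⨾ S') := fun a c ⟨b, hab, hbc⟩ =>
  ⟨(h a b hab).1, fun hc => have := h' b c hbc hc; ⟨b, (h a b hab).2 this.1, this.2⟩⟩

lemma WeakExtInto.comp_ext (h : WeakExtInto e R R') (h' : ExtInto e S S') :
    ExtInto e (R ⨾ S) (R' ⨾ S') := fun a c ⟨b, hab, hbc⟩ =>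
  have h1 := h' b c hbc
  have h2 := h a b hab h1.1
  ⟨h2.1, fun hc => ⟨b, h2.2, h1.2 hc⟩⟩

lemma WeakExtInto.comp (h : WeakExtInto e R R') (h' : WeakExtInto e S S') :
    WeakExtInto e (R ⨾ S) (R' ⨾ S') := fun a c ⟨b, hab, hbc⟩ hc =>
  have h1 := h' b c hbc hc
  have h2 := h a b hab h1.1
  ⟨h2.1, ⟨b, h2.2, h1.2⟩⟩

lemma ExtInto.sup (h : ExtInto e R R') (h' : ExtInto e S S') : ExtInto e (R ⊔ S) (R' ⊔ S') := by
  rintro a b (hab | hab)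
  · exact ⟨(h a b hab).1, fun hb => .inl ((h a b hab).2 hb)⟩
  · exact ⟨(h' a b hab).1, fun hb => .inr ((h' a b hab).2 hb)⟩

lemma WeakExtInto.sup (h : WeakExtInto e R R') (h' : WeakExtInto e S S') :
    WeakExtInto e (R ⊔ S) (R' ⊔ S') := by
  rintro a b (hab | hab) hb
  · exact ⟨(h a b hab hb).1, .inl (h a b hab hb).2⟩
  · exact ⟨(h' a b hab hb).1, .inr (h' a b hab hb).2⟩

lemma ExtInto.inf (h : ExtInto e R R') (T : α → α → Prop) : ExtInto e (T ⊓ R) (T ⊓ R') :=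
  fun a b hab => ⟨(h a b hab.2).1, fun hb => ⟨hab.1, (h a b hab.2).2 hb⟩⟩

lemma ExtInto.transGen (h : ExtInto e R R') : ExtInto e (TransGen R) (TransGen R') := by
  intro a b hab
  induction hab with
  | single hab => exact ⟨(h _ _ hab).1, fun hb => .single ((h _ _ hab).2 hb)⟩
  | tail _ hbc ih => exact ⟨ih.1, fun hc => .tail (ih.2 (h _ _ hbc).1) ((h _ _ hbc).2 hc)⟩

lemma ExtInto.reflGen (h : ExtInto e R R') : WeakExtInto e (ReflGen R) (ReflGen R') := by
  rintro a b (_ | hab) hb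
  · exact ⟨hb, .refl⟩
  · exact ⟨(h _ _ hab).1, .single ((h _ _ hab).2 hb)⟩

lemma ExtInto.reflTransGen (h : ExtInto e R R') :
    WeakExtInto e (ReflTransGen R) (ReflTransGen R') := by
  intro a b hab hb
  rcases reflTransGen_iff_eq_or_transGen.1 hab with rfl | hab
  · exact ⟨hb, .refl⟩
  · exact ⟨(h.transGen _ _ hab).1, ((h.transGen _ _ hab).2 hb).to_reflTransGen⟩

lemma weakExtInto_idOn (A : α → Prop) : WeakExtInto e (idOn A) (idOn A) := by
  rintro a b ⟨rfl, ha⟩ hb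
  exact ⟨hb, rfl, ha⟩

lemma ExtInto.acyclic (h : ExtInto e R R') (hR : Acyclic R) : Acyclic R' := fun a ha =>
  have := h.transGen a a ha
  hR a (this.2 this.1)

end ExtInto

lemma ExtInto.onLoc {e : Event Tid Loc Val} {R R' : Event Tid Loc Val → Event Tid Loc Val → Prop}
    (h : ExtInto e R R') : ExtInto e (onLoc R) (onLoc R') :=
  fun a b hab => ⟨(h a b hab.1).1, fun hb => ⟨(h a b hab.1).2 hb, hab.2⟩⟩

lemma ExtInto.offLoc {e : Event Tid Loc Val} {R R' : Event Tid Loc Val → Event Tid Loc Val → Prop}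
    (h : ExtInto e R R') : ExtInto e (offLoc R) (offLoc R') :=
  fun a b hab => ⟨(h a b hab.1).1, fun hb => ⟨(h a b hab.1).2 hb, hab.2⟩⟩

namespace ExecGraph

variable {P : Program Tid Loc Val} {G : ExecGraph Tid Loc Val} {m e : Event Tid Loc Val}

/-- No event comes after `m` in `co`. -/
def IsMax (G : ExecGraph Tid Loc Val) (m : Event Tid Loc Val) : Prop := ∀ b, ¬ G.co m b

/-- An event that reads from, or is placed after, a `co`-maximal write has no outgoing edge
in `po`, `rf`, `co` and `fr`. Thus it is not on any cycle that the model forbids; only the atomicity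
axiom needs an assumption. -/
lemma Consistent.add (h : G.Consistent P) (hG : G.IsExecution P) (he : G.Fits P m e)
    (hmax : ¬ e.IsFence → G.IsMax m)
    (hrmw : ∀ r w, r.RmwPair e → G.rf w r → G.IsMax w) : (G.add m e).Consistent P := by
  have hem := he.not_mem
  have hpo : ExtInto e G.po (G.add m e).po := by
    intro a b hab
    have h1 := porf_add hG he (.inl hab)
    refine ⟨h1.1, fun hb => ⟨?_, ?_, hab.2.2⟩⟩
    · exact (mem_add.1 hab.1).resolve_right h1.1
    · exact (mem_add.1 hab.2.1).resolve_right hb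
  have hrf : ExtInto e G.rf (G.add m e).rf := by
    intro a b hab
    have h1 := porf_add hG he (.inr hab)
    exact ⟨h1.1, fun hb => hab.resolve_right fun h => hb h.2.2⟩
  have hco : ExtInto e G.co (G.add m e).co := by
    rintro a b (hab | ⟨hw, ⟨rfl, hab⟩ | ⟨rfl, hab⟩⟩)
    · exact ⟨fun h => hem (h ▸ (hG.co_mem hab).1), fun _ => hab⟩
    · refine ⟨?_, fun hb => absurd rfl hb⟩
      rintro rfl
      obtain ⟨t, h, ac, l, rfl, -, -, -, h5, -⟩ := he
      rcases hab with rfl | hab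
      · exact hem (h5 fun hf => hf.not_isWrite hw).1
      · exact hem (hG.co_mem hab).1
    · exact absurd hab (hmax (fun hf => hf.not_isWrite hw) _)
  have hfr : ExtInto e G.fr (G.add m e).fr := by
    rintro a b ⟨w, hwa, hwb⟩
    have hwe : w ≠ e := (hco _ _ hwb).1
    rcases hwa with hwa | ⟨hr, rfl, rfl⟩
    · refine ⟨fun h => hem (h ▸ (hG.rf_wf _ _ hwa).2.1), fun hb => ⟨w, hwa, (hco _ _ hwb).2 hb⟩⟩
    · exfalso
      rcases hwb with hwb | ⟨hw, -⟩
      · exact hmax (fun hf => hf.not_isRead hr) _ hwb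
      · exact hr.not_isWrite hw
  have hrm : ExtInto e G.rmw (G.add m e).rmw := by
    rintro a b ⟨ha, hb, hab⟩
    have hpoab : a.PoBefore b := by
      obtain ⟨t, n, x, v, o, s, v', o', s', rfl, rfl⟩ := hab
      exact ⟨rfl, Nat.lt_succ_self n⟩
    have h1 := (hpo a b ⟨ha, hb, hpoab⟩).1
    exact ⟨h1, fun hb' => ⟨(mem_add.1 ha).resolve_right h1, (mem_add.1 hb).resolve_right hb', hab⟩⟩
  have heco := ((hrf.sup hco).sup hfr).transGen
  have hrseq : WeakExtInto e (G.rseq P) ((G.add m e).rseq P) :=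
    (weakExtInto_idOn _).comp <| hpo.onLoc.reflGen.comp <| (weakExtInto_idOn _).comp <|
      ((hrf.inf _).comp_weak hrm.weak).reflTransGen
  have hsw : ExtInto e (G.sw P) ((G.add m e).sw P) :=
    ((weakExtInto_idOn _).comp ((weakExtInto_idOn _).comp_ext hpo).reflGen).comp_ext <|
      hrseq.comp_ext <| (hrf.inf _).comp_weak <|
        (hpo.comp_weak (weakExtInto_idOn _)).reflGen.comp (weakExtInto_idOn _)
  have hhb : ExtInto e (G.hb P) ((G.add m e).hb P) := (hpo.sup (hsw.inf _)).transGen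
  have hscb : ExtInto e (G.scb P) ((G.add m e).scb P) :=
    (((hpo.sup (hpo.offLoc.comp_weak (hhb.comp_weak hpo.offLoc.weak).weak)).sup hhb.onLoc).sup
      hco).sup hfr
  have hpsc : ExtInto e (G.psc P) ((G.add m e).psc P) :=
    (((weakExtInto_idOn _).sup ((weakExtInto_idOn _).comp hhb.reflGen)).comp_ext <|
      hscb.comp_weak <| (weakExtInto_idOn _).sup (hhb.reflGen.comp (weakExtInto_idOn _))).sup
    ((weakExtInto_idOn _).comp_ext <| (hhb.sup <| hhb.comp_weak
      (heco.comp_weak hhb.weak).weak).comp_weak (weakExtInto_idOn _))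
  refine ⟨h.poRfAcyclic.add hG he, ?_, ?_, (hpsc.inf _).acyclic h.inclPscAcyclic⟩
  · intro a ha
    have := hhb.comp_weak heco.reflGen a a ha
    exact h.coherent a (this.2 this.1)
  · rintro a b ⟨hab, c, hac, hcb⟩
    by_cases hb : b = e
    · subst hb
      obtain ⟨w, hwa, hwc⟩ := hac
      have hwa' : G.rf w a := hwa.resolve_right fun h => (hrm _ _ hab).1 h.2.2
      exact hrmw a w hab.2.2 hwa' c ((hco _ _ hwc).2 (hco _ _ hcb).1)
    · exact h.atomic a b ⟨(hrm _ _ hab).2 hb, (hfr.comp_weak hco.weak a b ⟨c, hac, hcb⟩).2 hb⟩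

end ExecGraph

/-! ### The order of the events in a list -/

section Order

variable {α : Type*} {l l₁ l₂ : List α} {a b c : α}

lemma pair_sublist_append :
    [a, b].Sublist (l₁ ++ l₂) ↔
      [a, b].Sublist l₁ ∨ (a ∈ l₁ ∧ b ∈ l₂) ∨ [a, b].Sublist l₂ := by
  induction l₁ with
  | nil => simp
  | cons x l ih =>
    rw [List.cons_append, List.cons_sublist_cons', List.cons_sublist_cons', ih,
      List.singleton_sublist, List.singleton_sublist, List.mem_append, List.mem_cons]
    tauto

lemma pair_sublist_cons : [a, b].Sublist (c :: l) ↔ [a, b].Sublist l ∨ (a = c ∧ b ∈ l) := by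
  rw [List.cons_sublist_cons', List.singleton_sublist]

lemma pair_sublist_concat : [a, b].Sublist (l ++ [c]) ↔ [a, b].Sublist l ∨ (a ∈ l ∧ b = c) := by
  rw [pair_sublist_append]
  have : ¬ [a, b].Sublist [c] := fun h => by simpa using h.length_le
  simp [this]

lemma pair_mem_left (h : [a, b].Sublist l) : a ∈ l := h.subset (by simp)

lemma pair_mem_right (h : [a, b].Sublist l) : b ∈ l := h.subset (by simp)

lemma pair_ne (hl : l.Nodup) (h : [a, b].Sublist l) : a ≠ b := by
  have := hl.sublist h
  simpa using this

/-- Splits a list without repetitions at an element. -/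
lemma pair_split (hl : (l₁ ++ c :: l₂).Nodup) :
    ([a, c].Sublist (l₁ ++ c :: l₂) ↔ a ∈ l₁) ∧ ([c, a].Sublist (l₁ ++ c :: l₂) ↔ a ∈ l₂) := by
  have h := hl
  rw [List.nodup_append, List.nodup_cons] at h
  obtain ⟨-, ⟨h2, -⟩, h4⟩ := h
  have hc1 : c ∉ l₁ := fun h => h4 c h c (by simp) rfl
  constructor
  · rw [pair_sublist_append, pair_sublist_cons]
    constructor
    · rintro (h | h | h | h)
      · exact absurd (pair_mem_right h) hc1
      · exact h.1
      · exact absurd (pair_mem_right h) h2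
      · exact absurd h.2 h2
    · exact fun h => .inr (.inl ⟨h, by simp⟩)
  · rw [pair_sublist_append, pair_sublist_cons]
    constructor
    · rintro (h | h | h | h)
      · exact absurd (pair_mem_left h) hc1
      · exact absurd h.1 hc1
      · exact absurd (pair_mem_left h) h2
      · exact h.2
    · exact fun h => .inr (.inr (.inr ⟨rfl, h⟩))

lemma pair_asymm (hl : l.Nodup) (h : [a, b].Sublist l) : ¬ [b, a].Sublist l := by
  intro h'
  obtain ⟨s, t, rfl⟩ := List.append_of_mem (pair_mem_left h)
  have h1 := (pair_split hl).2.1 h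
  have h2 := (pair_split hl).1.1 h'
  rw [List.nodup_append] at hl
  exact hl.2.2 _ h2 _ (by simp [h1]) rfl

lemma pair_trans (hl : l.Nodup) (h : [a, b].Sublist l) (h' : [b, c].Sublist l) :
    [a, c].Sublist l := by
  obtain ⟨s, t, rfl⟩ := List.append_of_mem (pair_mem_left h')
  have h1 := (pair_split hl).1.1 h
  have h2 := (pair_split hl).2.1 h'
  exact pair_sublist_append.2 (.inr (.inl ⟨h1, by simp [h2]⟩))

lemma pair_total (ha : a ∈ l) (hb : b ∈ l) (hne : a ≠ b) :
    [a, b].Sublist l ∨ [b, a].Sublist l := by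
  obtain ⟨s, t, rfl⟩ := List.append_of_mem ha
  rcases List.mem_append.1 hb with h | h
  · exact .inr (pair_sublist_append.2 (.inr (.inl ⟨h, by simp⟩)))
  · refine .inl (pair_sublist_append.2 (.inr (.inr (pair_sublist_cons.2 (.inr ⟨rfl, ?_⟩)))))
    exact (List.mem_cons.1 h).resolve_left hne.symm

end Order

namespace State

variable {P : Program Tid Loc Val} {nev : Tid × ℕ → Tid × ℕ → Prop} {S S' : State Tid Loc Val}
  {t : Tid} {m e : Event Tid Loc Val}

/-! ### The shape of the recursive calls -/

@[simp] lemma mem_graph_E : e ∈ S.graph.E ↔ e ∈ S.exe := Iff.rfl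

/-- The events are listed in an order that extends program order. -/
def PoSorted (l : List (Event Tid Loc Val)) : Prop := l.Pairwise fun a b => ¬ b.PoBefore a

lemma PoSorted.before {l : List (Event Tid Loc Val)} (hl : PoSorted l)
    {a b : Event Tid Loc Val} (ha : a ∈ l) (hb : b ∈ l) (hab : a.PoBefore b) :
    [a, b].Sublist l := by
  have hne : a ≠ b := by
    rintro rfl
    exact hab.irrefl
  refine (pair_total ha hb hne).resolve_right fun h => ?_
  have := hl.sublist h
  simp only [List.pairwise_cons, List.mem_singleton, forall_eq] at this
  exact this.1 hab

/-- In a list that extends program order, the events of a thread occur in program order. -/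
lemma hist_eq {l : List (Event Tid Loc Val)} (hl : PoSorted l) (hn : l.Nodup)
    {h : List (Label Loc Val)} (H : ∀ n a, .ev t n a ∈ l ↔ h[n]? = some a) :
    (l.filterMap fun
      | .ev t' _ a => open Classical in if t' = t then some a else none
      | .init _ => none) = h := by
  induction l using List.reverseRecOn generalizing h with
  | nil =>
    rcases h with _ | ⟨a, h⟩
    · rfl
    · have := (H 0 a).2 rfl
      simp at this
  | append_singleton l e ih =>
    have hl' : PoSorted l := (List.pairwise_append.1 hl).1
    have hle : ∀ b ∈ l, ¬ e.PoBefore b := fun b hb =>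
      (List.pairwise_append.1 hl).2.2 b hb e (by simp)
    have hn' : l.Nodup := (List.nodup_append.1 hn).1
    have hel : e ∉ l := fun h => (List.nodup_append.1 hn).2.2 e h e (by simp) rfl
    have hskip : (∀ n a, e ≠ .ev t n a) → ∀ n a, .ev t n a ∈ l ↔ h[n]? = some a := by
      intro hne n a
      rw [← H n a, List.mem_append, List.mem_singleton]
      exact ⟨.inl, fun h => h.resolve_right fun h => hne _ _ h.symm⟩
    rw [List.filterMap_append]
    rcases e with x | ⟨t', n, a⟩
    · rw [ih hl' hn' (hskip fun _ _ h => by cases h)]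
      simp
    · by_cases ht : t' = t
      · subst ht
        have hna := (H n a).1 (by simp)
        obtain ⟨hlt, hna'⟩ := List.getElem?_eq_some_iff.1 hna
        -- the last event of the list is the last event of its thread
        have hlen : h.length = n + 1 := by
          by_contra hne
          have hlt' : n + 1 < h.length := by omega
          have hm : .ev t' (n + 1) h[n + 1] ∈ l ++ [Event.ev t' n a] :=
            (H _ _).2 (List.getElem?_eq_getElem hlt')
          rw [List.mem_append, List.mem_singleton] at hm
          rcases hm with hm | hm
          · exact hle _ hm ⟨rfl, Nat.lt_succ_self n⟩
          · simp at hm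
        have hh : h = h.take n ++ [a] := by
          rw [← hna', List.take_append_getElem, ← hlen, List.take_length]
        rw [ih hl' hn' (h := h.take n)]
        · conv_rhs => rw [hh]
          simp
        · intro k b
          rw [List.getElem?_take]
          split_ifs with hk
          · rw [← H k b, List.mem_append, List.mem_singleton]
            refine ⟨.inl, fun h => h.resolve_right ?_⟩
            simp only [Event.ev.injEq, true_and, not_and]
            exact fun h => absurd h hk.ne
          · simp only [iff_false]
            intro hkl
            have hk1 := (H k b).1 (by simp [hkl])
            have := (List.getElem?_eq_some_iff.1 hk1).1
            obtain rfl : k = n := by omega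
            rw [hna] at hk1
            simp only [Option.some.injEq] at hk1
            exact hel (hk1 ▸ hkl)
      · rw [ih hl' hn' (hskip fun _ _ h => ht (by cases h; rfl))]
        simp [ht]

lemma isHistory_hist (hG : S.graph.IsExecution P) (hl : PoSorted S.exe) (hn : S.exe.Nodup)
    (t : Tid) : S.graph.IsHistory t (S.hist t) := by
  obtain ⟨h, H, -⟩ := hG.history t
  have : S.hist t = h := by
    rw [← hist_eq hl hn H]
    rfl
  rw [this]
  exact H

/-- The state after a forward step. The read `e` reads from `m`, or the write `e` is placed
immediately after `m`. -/
def addEv (S : State Tid Loc Val) (m e : Event Tid Loc Val) : State Tid Loc Val :=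
  ⟨S.exe ++ [e], (S.graph.add m e).rf, (S.graph.add m e).co, {x | x ∈ S.rev ∨ (x = e ∧ e.IsRead)}⟩

lemma graph_addEv : (S.addEv m e).graph = S.graph.add m e := by
  ext x
  · simp [addEv, graph, ExecGraph.add, or_comm]
  · rfl
  · rfl

/-- The new write `w` reverses the read `r`, which becomes `r'`, and is placed immediately after
`a` in `co`. -/
structure Reversal (P : Program Tid Loc Val) (S : State Tid Loc Val)
    (w r r' a : Event Tid Loc Val) (S' : State Tid Loc Val) : Prop where
  fits : ∃ m, S.graph.Fits P m w
  mem : r ∈ S.exe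
  rev : r ∈ S.rev
  not_before : r ∉ S.graph.porfBefore w
  check : S.CheckOptimal (insert r (S.deleted w r)) w
  labels : ∃ t n x v₀ v o s t' n' o' s' b, r = .ev t n (.read x v₀ o s) ∧
    r' = .ev t n (.read x v o s) ∧ w = .ev t' n' (.write x v o' s' b) ∧
    S' = (S.remove (S.deleted w r)).reverse r w a v
  place : (a.IsInit ∨ (a ∈ S.exe ∧ a ∉ S.deleted w r)) ∧ a.IsWrite ∧ a.SameLoc w

/-- The two kinds of recursive calls. -/
inductive Child (P : Program Tid Loc Val) (nev : Tid × ℕ → Tid × ℕ → Prop)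
    (S S' : State Tid Loc Val) : Prop
  | forward (t : Tid) (n : ℕ) (l : Label Loc Val) (m : Event Tid Loc Val)
      (ht : S.nextThread P nev = some t) (he : S.graph.Fits P m (.ev t n l))
      (h : S' = S.addEv m (.ev t n l))
  | reversal (t : Tid) (n : ℕ) (l : Label Loc Val) (r r' a : Event Tid Loc Val)
      (ht : S.nextThread P nev = some t) (h : S.Reversal P (.ev t n l) r r' a S')

lemma mem_writes {x : Loc} {a : Event Tid Loc Val} {v : Val} :
    (a, v) ∈ S.writes P x ↔ S.graph.Mem a ∧ P.Writes a x v := by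
  classical
  simp only [writes, List.mem_cons, Prod.mk.injEq, List.mem_filterMap]
  constructor
  · rintro (⟨rfl, rfl⟩ | ⟨b, hb, heq⟩)
    · exact ⟨.inl trivial, .inl ⟨rfl, rfl⟩⟩
    · rcases b with _ | ⟨t, n, _ | ⟨y, v', o, s, bb⟩ | _⟩ <;> simp only [reduceCtorEq] at heq
      split_ifs at heq with hy
      simp only [Option.some.injEq, Prod.mk.injEq] at heq
      obtain ⟨rfl, rfl⟩ := heq
      subst hy
      exact ⟨.inr hb, .inr ⟨_, _, _, _, _, rfl⟩⟩
  · rintro ⟨hm, ⟨rfl, rfl⟩ | ⟨t, n, o, s, b, rfl⟩⟩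
    · exact .inl ⟨rfl, rfl⟩
    · exact .inr ⟨_, hm.resolve_left id, by simp⟩

lemma nextThread_candidate (h : S.nextThread P nev = some t) : S.Candidate P t := by
  unfold nextThread at h
  split_ifs at h with hex
  simp only [Option.some.injEq] at h
  exact h ▸ hex.choose_spec.1

/-- A finite nonempty set of candidates has a least one. -/
lemma exists_isNext [Finite Tid] [IsStrictTotalOrder (Tid × ℕ) nev] (h : S.nextAct P t ≠ none) :
    ∃ t, S.IsNext P nev t := by
  classical
  have hc : {t | S.Candidate P t}.Nonempty := by
    by_cases hp : ∃ t', S.PendingRmw P t'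
    · obtain ⟨t', ht'⟩ := hp
      refine ⟨t', ?_, fun _ => ht'⟩
      obtain ⟨a, ha, -⟩ := ht'
      simp [ha]
    · exact ⟨t, h, fun h' => absurd h' hp⟩
  let f : Tid → Tid × ℕ := fun t => (t, (S.hist t).length)
  have : IsTrans Tid fun a b => nev (f a) (f b) := ⟨fun _ _ _ h h' => _root_.trans h h'⟩
  have : Std.Irrefl fun a b : Tid => nev (f a) (f b) := ⟨fun a h => irrefl (f a) h⟩
  obtain ⟨t₀, ht₀, hmin⟩ :=
    (Finite.wellFounded_of_trans_of_irrefl fun a b => nev (f a) (f b)).has_min _ hc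
  refine ⟨t₀, ht₀, fun t' ht' hne => ?_⟩
  rcases trichotomous_of nev (f t₀) (f t') with h | h | h
  · exact h
  · exact absurd (Prod.ext_iff.1 h).1.symm hne
  · exact absurd h (hmin t' ht')

lemma nextThread_eq_none [Finite Tid] [IsStrictTotalOrder (Tid × ℕ) nev]
    (h : S.nextThread P nev = none) (t : Tid) : S.nextAct P t = none := by
  by_contra ht
  unfold nextThread at h
  rw [dif_pos (exists_isNext ht)] at h
  cases h

lemma explore_of_consistent (h : S.graph.Consistent P) :
    S.explore P nev = match S.nextThread P nev with
      | none => .output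
      | some t =>
        match S.nextAct P t with
        | none => .output
        | some (.fence o s) => .recurse [S.addFence (.ev t (S.hist t).length (.fence o s))]
        | some (.read x o s) => .recurse <| (S.writes P x).map fun w =>
            S.addRead w.1 (.ev t (S.hist t).length (.read x w.2 o s))
        | some (.write x v o s b) => .recurse <|
            S.writeCalls P (.ev t (S.hist t).length (.write x v o s b)) x v := by
  exact (if_neg (not_not.2 h.poRfAcyclic)).trans <| (if_neg (not_not.2 h.coherent)).trans <|
    (if_neg (not_not.2 h.atomic)).trans (if_neg (not_not.2 h.inclPscAcyclic))

lemma consistent_of_explore (h : S.explore P nev ≠ .pruned) : S.graph.Consistent P := by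
  have h1 : S.graph.PoRfAcyclic := by_contra fun h1 => h (by unfold explore; rw [if_pos h1])
  have h2 : S.graph.Coherent P := by_contra fun h2 => h (by
    unfold explore; rw [if_neg (not_not.2 h1), if_pos h2])
  have h3 : S.graph.Atomic := by_contra fun h3 => h (by
    unfold explore; rw [if_neg (not_not.2 h1), if_neg (not_not.2 h2), if_pos h3])
  exact ⟨h1, h2, h3, by_contra fun h4 => h (by
    unfold explore
    rw [if_neg (not_not.2 h1), if_neg (not_not.2 h2), if_neg (not_not.2 h3), if_pos h4])⟩

lemma consistent_of_mem_calls (h : S' ∈ (S.explore P nev).calls) : S.graph.Consistent P := by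
  refine consistent_of_explore (nev := nev) fun h' => ?_
  rw [h'] at h
  simp [Outcome.calls] at h

lemma addFence_eq (he : e.IsFence) : S.addFence e = S.addEv m e := by
  simp [addFence, addEv, ExecGraph.add, graph, he.not_isRead, he.not_isWrite]

lemma addRead_eq (he : e.IsRead) : S.addRead m e = S.addEv m e := by
  simp [addRead, addEv, ExecGraph.add, graph, he, he.not_isWrite]
  ext x
  simp [or_comm]

lemma addWrite_eq (he : e.IsWrite) : S.addWrite m e = S.addEv m e := by
  have : ¬ e.IsRead := fun h => h.not_isWrite he
  simp only [addWrite, addEv, ExecGraph.add, graph, this, he, true_and, false_and, or_false,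
    and_false, mk.injEq, true_and, Set.ofPred_mem_eq, and_true]
  rfl

lemma writes_mem_loc {x : Loc} {a : Event Tid Loc Val} {v : Val} (h : P.Writes a x v) :
    a.IsWrite ∧ a.loc = some x := by
  rcases h with ⟨rfl, -⟩ | ⟨_, _, _, _, _, rfl⟩ <;> exact ⟨trivial, rfl⟩

lemma exists_writes {x : Loc} {a : Event Tid Loc Val} (h : a.IsWrite) (h' : a.loc = some x) :
    ∃ v, P.Writes a x v := by
  rcases a with y | ⟨t, n, _ | ⟨y, v, o, s, b⟩ | _⟩
  · simp only [Event.loc, Option.some.injEq] at h'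
    exact ⟨_, .inl ⟨by rw [h'], rfl⟩⟩
  · exact h.elim
  · simp only [Event.loc, Option.some.injEq] at h'
    subst h'
    exact ⟨v, .inr ⟨_, _, _, _, _, rfl⟩⟩
  · exact h.elim

lemma writes_functional {x y : Loc} {a : Event Tid Loc Val} {v v' : Val} (h : P.Writes a x v)
    (h' : P.Writes a y v') : v = v' := by
  rcases h with ⟨rfl, rfl⟩ | ⟨_, _, _, _, _, rfl⟩ <;>
    rcases h' with ⟨h', rfl⟩ | ⟨_, _, _, _, _, h'⟩ <;> cases h' <;> rfl

/-- The recursive calls of a consistent state are its children. -/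
lemma mem_calls_iff (hG : S.graph.IsExecution P) (hl : PoSorted S.exe) (hn : S.exe.Nodup) :
    S' ∈ (S.explore P nev).calls ↔ S.graph.Consistent P ∧ S.Child P nev S' := by
  classical
  have hH := isHistory_hist hG hl hn
  constructor
  · intro h
    have hc := consistent_of_mem_calls h
    refine ⟨hc, ?_⟩
    rw [explore_of_consistent hc] at h
    split at h
    · simp [Outcome.calls] at h
    rename_i t ht
    split at h
    · simp [Outcome.calls] at h
    · rename_i o s hact
      simp only [Outcome.calls, List.mem_singleton] at h
      rw [addFence_eq (e := .ev t _ (.fence o s)) (m := .ev t 0 (.fence o s)) trivial] at h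
      refine .forward t _ _ _ ht ⟨t, _, _, _, rfl, hH t, hact, rfl, fun h => absurd trivial h, ?_⟩ h
      intro x v o' s' heq
      cases heq
    · rename_i x o s hact
      simp only [Outcome.calls, List.mem_map] at h
      obtain ⟨⟨a, v⟩, ha, rfl⟩ := h
      obtain ⟨ha1, ha2⟩ := mem_writes.1 ha
      rw [addRead_eq (e := .ev t _ (.read x v o s)) trivial]
      refine .forward t _ _ _ ht ⟨t, _, _, _, rfl, hH t, hact, ⟨v, rfl⟩, fun _ =>
        ⟨ha1, (writes_mem_loc ha2).1, x, (writes_mem_loc ha2).2, rfl⟩, ?_⟩ rfl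
      rintro _ _ _ _ ⟨⟩
      exact ha2
    · rename_i x v o s b hact
      simp only [Outcome.calls, writeCalls, List.mem_append, List.mem_map, List.mem_flatMap] at h
      have hfit : ∀ a v', S.graph.Mem a → P.Writes a x v' →
          S.graph.Fits P a (.ev t (S.hist t).length (.write x v o s b)) := by
        intro a v' ha1 ha2
        refine ⟨t, _, _, _, rfl, hH t, hact, rfl, fun _ =>
          ⟨ha1, (writes_mem_loc ha2).1, x, (writes_mem_loc ha2).2, rfl⟩, ?_⟩
        rintro _ _ _ _ ⟨⟩
      rcases h with ⟨⟨a, v'⟩, ha, rfl⟩ | ⟨r, hr, ⟨a, v'⟩, ha, rfl⟩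
      · obtain ⟨ha1, ha2⟩ := mem_writes.1 ha
        rw [addWrite_eq (e := .ev t _ (.write x v o s b)) trivial]
        exact .forward t _ _ _ ht (hfit _ _ ha1 ha2) rfl
      · obtain ⟨ha1, ha2⟩ := mem_writes.1 ha
        simp only [reversals, List.mem_filter, decide_eq_true_eq] at hr
        obtain ⟨hr1, hr2, hr3, hr4, hr5, hr6⟩ := hr
        obtain ⟨tr, n, x', v₀, o', s', rfl⟩ := Event.isRead_iff.1 hr2
        obtain rfl : x' = x := by simpa [Event.loc] using hr3
        refine .reversal t _ _ _ (.ev tr n (.read x' v o' s')) a ht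
          ⟨⟨.init x', hfit _ _ (.inl trivial) (.inl ⟨rfl, rfl⟩)⟩, hr1, hr4, hr5, hr6,
          ⟨tr, n, x', v₀, v, o', s', t, _, o, s, b, rfl, rfl, rfl, rfl⟩, ?_,
          (writes_mem_loc ha2).1, x', (writes_mem_loc ha2).2, rfl⟩
        simpa [ExecGraph.Mem, remove, graph] using ha1
  · rintro ⟨hc, h⟩
    rw [explore_of_consistent hc]
    rcases h with ⟨t, n, l, m, ht, he, rfl⟩ | ⟨t, n, l, r, r', a, ht, h⟩
    · obtain ⟨t', h', ac, l', heq, H, hnext, hal, hm, hval⟩ := he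
      obtain rfl := H.unique (hH _)
      cases heq
      rw [ht]
      simp only [nextAct, hnext]
      rcases ac with ⟨x, o, s⟩ | ⟨x, v, o, s, b⟩ | ⟨o, s⟩
      · obtain ⟨v, rfl⟩ := hal
        simp only [Outcome.calls, List.mem_map]
        refine ⟨(m, v), mem_writes.2 ⟨(hm id).1, hval _ _ _ _ rfl⟩,
          addRead_eq (e := .ev t _ (.read x v o s)) trivial⟩
      · cases hal
        simp only [Outcome.calls, writeCalls, List.mem_append, List.mem_map]
        obtain ⟨hm1, hm2, y, hy, hy'⟩ := hm id
        simp only [Event.loc, Option.some.injEq] at hy'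
        subst hy'
        obtain ⟨v', hv'⟩ := exists_writes (P := P) hm2 hy
        exact .inl ⟨(m, v'), mem_writes.2 ⟨hm1, hv'⟩,
          addWrite_eq (e := .ev t _ (.write x v o s b)) trivial⟩
      · cases hal
        simp only [Outcome.calls, List.mem_singleton]
        exact (addFence_eq (e := .ev t _ (.fence o s)) trivial).symm
    · obtain ⟨⟨m, hfit⟩, hmem, hrev, hnb, hcheck, ⟨tr, n', x, v₀, v, o, s, tw, nw, o', s', b, rfl,
        rfl, heq, rfl⟩, hp1, hp2, y, hy, hy'⟩ := h
      cases heq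
      obtain ⟨t', h', ac, l', heq, H, hnext, hal, -⟩ := hfit
      obtain rfl := H.unique (hH _)
      cases heq
      rw [ht]
      simp only [nextAct, hnext]
      have : ac = .write x v o' s' b := by
        rcases ac with ⟨x, o, s⟩ | ⟨x, v, o, s, b⟩ | ⟨o, s⟩
        · obtain ⟨_, h⟩ := hal
          cases h
        · cases hal
          rfl
        · cases hal
      subst this
      simp only [Outcome.calls, writeCalls, List.mem_append, List.mem_map, List.mem_flatMap]
      simp only [Event.loc, Option.some.injEq] at hy'
      subst hy'
      obtain ⟨v', hv'⟩ := exists_writes (P := P) hp2 hy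
      refine .inr ⟨_, ?_, (a, v'), mem_writes.2 ⟨?_, hv'⟩, rfl⟩
      · simp only [reversals, List.mem_filter, decide_eq_true_eq]
        exact ⟨hmem, trivial, rfl, hrev, hnb, hcheck⟩
      · simpa [ExecGraph.Mem, remove, graph] using hp1

lemma explore_eq_output_iff (hc : S.graph.Consistent P) :
    (S.explore P nev = .output ↔ S.nextThread P nev = none) := by
  rw [explore_of_consistent hc]
  constructor
  · intro h
    by_contra hne
    obtain ⟨t, ht⟩ := Option.ne_none_iff_exists'.1 hne
    have hcand := (nextThread_candidate ht).1
    rw [ht] at h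
    obtain ⟨a, ha⟩ := Option.ne_none_iff_exists'.1 hcand
    simp only [ha] at h
    rcases a with _ | _ | _ <;> cases h
  · intro h
    rw [h]

end State

/-! ### Invariants of the exploration -/

namespace ExecGraph

variable {P : Program Tid Loc Val} {G : ExecGraph Tid Loc Val} {m w : Event Tid Loc Val}

/-- The events before a new write `w` are those from which a `po`-predecessor of `w` is
reachable. -/
lemma Fits.mem_porfBefore_iff (hG : G.IsExecution P) (hw : G.Fits P m w) (hww : w.IsWrite)
    {y : Event Tid Loc Val} :
    y ∈ G.porfBefore w ↔ ∃ z, G.Mem z ∧ z.PoBefore w ∧ ReflTransGen G.porf y z := by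
  have heq : (G.addEvent w).po ⊔ G.rf = (G.add m w).porf := by
    have : ¬ w.IsRead := fun h => h.not_isWrite hww
    simp only [add, this, false_and, or_false]
    rfl
  unfold porfBefore
  rw [heq]
  constructor
  · intro h
    obtain ⟨z, hyz, hzw⟩ := TransGen.tail'_iff.1 h
    have hz := (porf_add hG hw hzw).1
    have hzw' : (G.add m w).po z w := hzw.resolve_right fun h =>
      ((hG.add hw).rf_read h).not_isWrite hww
    refine ⟨z, (mem_add.1 hzw'.1).resolve_right hz, hzw'.2.2, ?_⟩
    rcases reflTransGen_iff_eq_or_transGen.1 hyz with rfl | hyz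
    · exact .refl
    · exact ((transGen_porf_add hG hw hyz).2 hz).to_reflTransGen
  · rintro ⟨z, hz, hzw, hyz⟩
    exact .tail' (reflTransGen_mono (G.sub_add m w).porf _ _ hyz)
      (.inl ⟨mem_add.2 (.inl hz), mem_add.2 (.inr rfl), hzw⟩)

end ExecGraph

namespace State

variable {P : Program Tid Loc Val} {nev : Tid × ℕ → Tid × ℕ → Prop} {S S' : State Tid Loc Val}
  {t : Tid} {m e : Event Tid Loc Val}

/-- The event `z` is the write from which `a` was reversed to read, or comes before it in
`po ∪ rf`. -/
def Guarded (S : State Tid Loc Val) (a z : Event Tid Loc Val) : Prop :=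
  ∃ w, S.rf w a ∧ S.Before a w ∧ (z = w ∨ TransGen S.graph.porf z w)

/-- The invariants of the states that the exploration reaches. -/
structure Inv (P : Program Tid Loc Val) (S : State Tid Loc Val) : Prop where
  exec : S.graph.IsExecution P
  acyclic : S.graph.PoRfAcyclic
  nodup : S.exe.Nodup
  sorted : PoSorted S.exe
  rev_mem : ∀ r ∈ S.rev, r ∈ S.exe ∧ r.IsRead
  co_init : ∀ a b, S.co a b → ¬ b.IsInit
  /-- An `rf` edge against the order `<exe` stems from a reversal. Then everything before the write
  was executed before it and is not reversible, and nothing else is between the two events. -/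
  locked : ∀ w r, S.rf w r → S.Before r w →
    (∀ y, TransGen S.graph.porf y w → y ∉ S.rev ∧ (y ∈ S.exe → S.Before y w)) ∧
    ∀ z, S.Before r z → S.Before z w → TransGen S.graph.porf z w
  /-- An RMW is interrupted only by events that made its read be reversed. -/
  rmw_pair : ∀ a b z, a.RmwPair b → S.Before a z → S.Before z b → S.Guarded a z
  rmw_pending : ∀ t n l z, S.PendingRmw P t → n + 1 = (S.hist t).length →
    S.Before (.ev t n l) z → S.Guarded (.ev t n l) z

namespace Inv

lemma isHistory (hS : S.Inv P) (t : Tid) : S.graph.IsHistory t (S.hist t) :=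
  isHistory_hist hS.exec hS.sorted hS.nodup t

lemma rev_not_locked (hS : S.Inv P) {w r z : Event Tid Loc Val} (hz : z ∈ S.rev) (h : S.rf w r)
    (h1 : S.Before r z) (h2 : S.Before z w) : False :=
  have h3 := hS.locked w r h (pair_trans hS.nodup h1 h2)
  (h3.1 z (h3.2 z h1 h2)).1 hz

/-- The reads before a reversible read have their sources before it. -/
lemma rf_before_of_rev (hS : S.Inv P) {w a r : Event Tid Loc Val} (hr : r ∈ S.rev)
    (h : S.rf w a) (har : S.Before a r) : w.IsInit ∨ S.Before w r := by
  rcases (hS.exec.rf_wf _ _ h).1 with hw | hw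
  · exact .inl hw
  refine .inr ((pair_total hw (hS.rev_mem r hr).1 ?_).resolve_right ?_)
  · rintro rfl
    exact (hS.rev_mem _ hr).2.not_isWrite (hS.exec.rf_write h)
  · exact fun hrw => hS.rev_not_locked hr h har hrw

lemma exists_of_pending (hS : S.Inv P) (h : S.PendingRmw P t) :
    ∃ n x v o s v' o' s', .ev t n (.read x v o s) ∈ S.exe ∧ n + 1 = (S.hist t).length ∧
      S.nextAct P t = some (.write x v' o' s' true) := by
  obtain ⟨a, ha, hr⟩ := h
  rcases a with _ | ⟨x, v', o', s', b⟩ | _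
  · exact hr.elim
  · obtain rfl : b = true := hr
    obtain ⟨h', v, o, s, hh⟩ := P.rmw_wf _ _ _ _ _ _ ha
    refine ⟨h'.length, x, v, o, s, v', o', s', ?_, by simp [hh], ha⟩
    exact (hS.isHistory t _ _).2 (by simp [hh])
  · exact hr.elim

lemma pending_unique (hS : S.Inv P) {t₁ t₂ : Tid} (h₁ : S.PendingRmw P t₁)
    (h₂ : S.PendingRmw P t₂) : t₁ = t₂ := by
  -- a pending read is not `po ∪ rf`-before anything
  have key : ∀ {t₁ t₂ : Tid} {n₁ n₂ : ℕ} {l₁ l₂ : Label Loc Val}, S.PendingRmw P t₁ →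
      n₁ + 1 = (S.hist t₁).length → n₂ + 1 = (S.hist t₂).length →
      (Event.ev t₂ n₂ l₂).IsRead → ¬ S.Before (.ev t₁ n₁ l₁) (.ev t₂ n₂ l₂) := by
    intro t₁ t₂ n₁ n₂ l₁ l₂ h₁ hn₁ hn₂ hread hb
    obtain ⟨w, hw, -, rfl | hz⟩ := hS.rmw_pending _ _ _ _ h₁ hn₁ hb
    · exact hread.not_isWrite (hS.exec.rf_write hw)
    · obtain ⟨c, hc, -⟩ := hS.exec.exists_po_of_read hread hz
      obtain ⟨t, n, l, rfl⟩ := hS.exec.exists_pos hc.mem_right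
      obtain ⟨rfl, hlt⟩ := hc.2.2
      have := (hS.isHistory _).lt_length hc.mem_right
      omega
  obtain ⟨n₁, x₁, v₁, o₁, s₁, -, -, -, hm₁, hn₁, -⟩ := hS.exists_of_pending h₁
  obtain ⟨n₂, x₂, v₂, o₂, s₂, -, -, -, hm₂, hn₂, -⟩ := hS.exists_of_pending h₂
  by_contra hne
  rcases pair_total hm₁ hm₂ (fun h => hne (by cases h; rfl)) with h | h
  · exact key (l₂ := .read x₂ v₂ o₂ s₂) h₁ hn₁ hn₂ trivial h
  · exact key (l₂ := .read x₁ v₁ o₁ s₁) h₂ hn₂ hn₁ trivial h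

lemma pending_eq_of_candidate (hS : S.Inv P) {t₁ : Tid} (h₁ : S.PendingRmw P t₁)
    (h : S.Candidate P t) : t₁ = t := hS.pending_unique h₁ (h.2 ⟨_, h₁⟩)

end Inv

lemma inv_start : (start : State Tid Loc Val).Inv P where
  exec := {
    init_notMem := fun x h => by simp [graph, start] at h
    history := fun t => ⟨[], fun n l => by simp [graph, start], by simp⟩
    rf_wf := fun _ _ h => h.elim
    rf_unique := fun r h => by simp [graph, start] at h
    co_wf := fun _ _ h => h.elim
    co_irrefl := fun _ h => h
    co_trans := fun _ _ _ h => h.elim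
    co_total := by
      rintro a b (ha | ha) (hb | hb) - - ⟨x, hx, hx'⟩ hne
      · obtain ⟨y, rfl⟩ := Event.isInit_iff.1 ha
        obtain ⟨z, rfl⟩ := Event.isInit_iff.1 hb
        simp only [Event.loc, Option.some.injEq] at hx hx'
        exact absurd (by rw [hx, hx']) hne
      all_goals simp [graph, start] at ha hb }
  acyclic := fun a ha => by
    have : ∀ a b, ¬ (start : State Tid Loc Val).graph.porf a b := by
      rintro a b (h | h)
      · have := h.mem_right
        simp [start] at this
      · exact h
    obtain ⟨b, hb, -⟩ := TransGen.head'_iff.1 ha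
    exact this _ _ hb
  nodup := List.nodup_nil
  sorted := List.Pairwise.nil
  rev_mem := fun _ h => h.elim
  co_init := fun _ _ h => h.elim
  locked := fun _ _ h => h.elim
  rmw_pair := fun a b z _ h => by simp [Before, start] at h
  rmw_pending := fun t n l z _ _ h => by simp [Before, start] at h

section Forward

variable {n : ℕ} {l : Label Loc Val}

lemma before_addEv {a b : Event Tid Loc Val} :
    (S.addEv m e).Before a b ↔ S.Before a b ∨ (a ∈ S.exe ∧ b = e) := pair_sublist_concat

lemma Guarded.addEv {a z : Event Tid Loc Val} (h : S.Guarded a z) : (S.addEv m e).Guarded a z := by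
  obtain ⟨w, hw, hb, hz⟩ := h
  refine ⟨w, .inl hw, before_addEv.2 (.inl hb), hz.imp_right fun hz => ?_⟩
  rw [graph_addEv]
  exact transGen_mono (S.graph.sub_add m e).porf _ _ hz

lemma nodup_addEv (hS : S.Inv P) (he : S.graph.Fits P m e) : (S.addEv m e).exe.Nodup := by
  have : e ∉ S.exe := he.notMem
  have h := hS.nodup
  simp only [addEv, List.nodup_append, List.mem_singleton, List.nodup_singleton]
  exact ⟨h, trivial, fun a ha b hb hab => this (hb ▸ hab ▸ ha)⟩

lemma sorted_addEv (hS : S.Inv P) (he : S.graph.Fits P m e) : PoSorted (S.addEv m e).exe := by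
  refine List.pairwise_append.2 ⟨hS.sorted, List.pairwise_singleton _ _, fun a ha b hb => ?_⟩
  rw [List.mem_singleton.1 hb]
  exact he.not_poBefore (.inr ha)

lemma exec_addEv (hS : S.Inv P) (he : S.graph.Fits P m e) : (S.addEv m e).graph.IsExecution P := by
  rw [graph_addEv]
  exact hS.exec.add he

lemma hist_addEv_of_ne (hS : S.Inv P) (he : S.graph.Fits P m (.ev t n l)) {t' : Tid}
    (hne : t' ≠ t) : (S.addEv m (.ev t n l)).hist t' = S.hist t' := by
  have h1 := isHistory_hist (exec_addEv hS he) (sorted_addEv hS he) (nodup_addEv hS he) t'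
  rw [graph_addEv] at h1
  exact h1.unique ((hS.isHistory t').add_of_ne hne)

lemma fits_index (hS : S.Inv P) (he : S.graph.Fits P m (.ev t n l)) :
    n = (S.hist t).length ∧ ∃ a, S.nextAct P t = some a ∧ a.Matches l := by
  obtain ⟨t', h, a, l', heq, H, hnext, hal, -⟩ := he
  cases heq
  obtain rfl := H.unique (hS.isHistory t)
  exact ⟨rfl, a, hnext, hal⟩

lemma fits_hist_addEv (hS : S.Inv P) (he : S.graph.Fits P m (.ev t n l)) :
    (S.addEv m (.ev t n l)).hist t = S.hist t ++ [l] := by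
  have h1 := isHistory_hist (exec_addEv hS he) (sorted_addEv hS he) (nodup_addEv hS he) t
  obtain ⟨rfl, -⟩ := fits_index hS he
  rw [graph_addEv] at h1
  exact h1.unique (hS.isHistory t).add

lemma Inv.forward (hS : S.Inv P) (hcand : S.Candidate P t)
    (he : S.graph.Fits P m (.ev t n l)) : (S.addEv m (.ev t n l)).Inv P := by
  have hne : .ev t n l ∉ S.exe := he.notMem
  obtain ⟨hn, act, hact, hal⟩ := fits_index hS he
  have hback : ∀ {a b}, b ∈ S.exe → (S.addEv m (.ev t n l)).Before a b → S.Before a b :=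
    fun hb h => (before_addEv.1 h).resolve_right fun h => hne (h.2 ▸ hb)
  refine ⟨exec_addEv hS he, ?_, nodup_addEv hS he, sorted_addEv hS he, ?_, ?_, ?_, ?_, ?_⟩
  · rw [graph_addEv]
    exact hS.acyclic.add hS.exec he
  · rintro r (hr | ⟨rfl, hr⟩)
    · exact ⟨List.mem_append_left _ (hS.rev_mem r hr).1, (hS.rev_mem r hr).2⟩
    · exact ⟨by simp [State.addEv], hr⟩
  · rintro a b (hab | ⟨hw, ⟨rfl, -⟩ | ⟨rfl, hab⟩⟩)
    · exact hS.co_init _ _ hab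
    · exact id
    · exact hS.co_init _ _ hab
  · rintro w r (hwr | ⟨hr, rfl, rfl⟩) hrw
    · have hwE : w ∈ S.exe := by
        rcases (hS.exec.rf_wf _ _ hwr).1 with hw | hw
        · have := pair_mem_right hrw
          exact absurd hw ((exec_addEv hS he).not_isInit this)
        · exact hw
      obtain ⟨h1, h2⟩ := hS.locked w r hwr (hback hwE hrw)
      have hwne : w ≠ .ev t n l := fun h => hne (h ▸ hwE)
      refine ⟨fun y hy => ?_, fun z hz hzw => ?_⟩
      · rw [graph_addEv] at hy
        obtain ⟨hy1, hy2⟩ := ExecGraph.transGen_porf_add hS.exec he hy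
        obtain ⟨hy3, hy4⟩ := h1 y (hy2 hwne)
        refine ⟨fun h => h.elim hy3 fun h => hy1 h.1, fun h => before_addEv.2 (.inl (hy4 ?_))⟩
        exact (List.mem_append.1 h).resolve_right fun h => hy1 (List.mem_singleton.1 h)
      · have hzw' := hback hwE hzw
        rw [graph_addEv]
        exact transGen_mono (S.graph.sub_add _ _).porf _ _
          (h2 z (hback (pair_mem_left hzw') hz) hzw')
    · have := pair_mem_left hrw
      rcases before_addEv.1 hrw with h | h
      · exact absurd (pair_mem_left h) hne
      · exact absurd h.1 hne
  · intro a b z hab haz hzb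
    by_cases hb : b = .ev t n l
    · -- the write half of the pending RMW has just been executed
      subst hb
      obtain ⟨t', k, x, v, o, s, v', o', s', rfl, heq⟩ := hab
      cases heq
      have hz : z ∈ S.exe := by
        rcases before_addEv.1 hzb with h | h
        · exact absurd (pair_mem_right h) hne
        · exact h.1
      refine (hS.rmw_pending _ _ _ z ⟨act, hact, ?_⟩ hn (hback hz haz)).addEv
      rcases act with _ | _ | _
      · obtain ⟨_, h⟩ := hal
        cases h
      · cases hal
        rfl
      · cases hal
    · have hb' : b ∈ S.exe := (List.mem_append.1 (pair_mem_right hzb)).resolve_right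
        fun h => hb (List.mem_singleton.1 h)
      have hzb' := hback hb' hzb
      exact (hS.rmw_pair a b z hab (hback (pair_mem_left hzb') haz) hzb').addEv
  · intro t' k l' z hp hk hz
    by_cases ht : t' = t
    · subst ht
      rw [fits_hist_addEv hS he] at hk
      simp only [List.length_append, List.length_cons, List.length_nil] at hk
      obtain rfl : k = n := by omega
      exfalso
      have hmem : .ev t' k l' ∈ S.exe ∨ l' = l := by
        have := pair_mem_left hz
        simp only [State.addEv, List.mem_append, List.mem_singleton, Event.ev.injEq,
          true_and] at this
        exact this
      rcases hmem with hmem | rfl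
      · exact hn.not_lt ((hS.isHistory t').lt_length hmem)
      · rcases before_addEv.1 hz with h | h
        · exact hne (pair_mem_left h)
        · exact hne h.1
    · exfalso
      obtain ⟨a, ha, har⟩ := hp
      rw [nextAct, hist_addEv_of_ne hS he ht] at ha
      exact ht (hS.pending_eq_of_candidate ⟨a, ha, har⟩ hcand)

end Forward

end State

namespace State

variable {P : Program Tid Loc Val} {nev : Tid × ℕ → Tid × ℕ → Prop} {S S' : State Tid Loc Val}
  {t : Tid} {w r r' a : Event Tid Loc Val}

/-! ### Reversals -/

/-- The events that lose their `rf` or `co` edges when the new write `w` reverses `r`. -/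
def dropped (S : State Tid Loc Val) (w r : Event Tid Loc Val) : Set (Event Tid Loc Val) :=
  insert r (S.deleted w r)

namespace Reversal

lemma isRead (h : S.Reversal P w r r' a S') : r.IsRead := by
  obtain ⟨t, n, x, v₀, v, o, s, t', n', o', s', b, rfl, rfl, rfl, -⟩ := h.labels
  trivial

lemma isRead' (h : S.Reversal P w r r' a S') : r'.IsRead := by
  obtain ⟨t, n, x, v₀, v, o, s, t', n', o', s', b, rfl, rfl, rfl, -⟩ := h.labels
  trivial

lemma isWrite (h : S.Reversal P w r r' a S') : w.IsWrite := by
  obtain ⟨t, n, x, v₀, v, o, s, t', n', o', s', b, rfl, rfl, rfl, -⟩ := h.labels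
  trivial

lemma pos_eq (h : S.Reversal P w r r' a S') : r'.pos = r.pos := by
  obtain ⟨t, n, x, v₀, v, o, s, t', n', o', s', b, rfl, rfl, rfl, -⟩ := h.labels
  rfl

lemma ne_write (h : S.Reversal P w r r' a S') : r' ≠ w :=
  fun h' => h.isRead'.not_isWrite (h' ▸ h.isWrite)

lemma write_notMem (h : S.Reversal P w r r' a S') : w ∉ S.exe :=
  h.fits.choose_spec.notMem

lemma mem_porfBefore_iff (hS : S.Inv P) (h : S.Reversal P w r r' a S')
    {y : Event Tid Loc Val} :
    y ∈ S.graph.porfBefore w ↔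
      ∃ z, S.graph.Mem z ∧ z.PoBefore w ∧ ReflTransGen S.graph.porf y z :=
  h.fits.choose_spec.mem_porfBefore_iff hS.exec h.isWrite

lemma porfBefore_closed (hS : S.Inv P) (h : S.Reversal P w r r' a S') {x y : Event Tid Loc Val}
    (hxy : TransGen S.graph.porf x y) (hy : y ∈ S.graph.porfBefore w) :
    x ∈ S.graph.porfBefore w := by
  rw [mem_porfBefore_iff hS h] at hy ⊢
  obtain ⟨z, h1, h2, h3⟩ := hy
  exact ⟨z, h1, h2, hxy.to_reflTransGen.trans h3⟩

lemma before_notMem (h : S.Reversal P w r r' a S') {x : Event Tid Loc Val}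
    (hx : x ∈ S.graph.porfBefore w) : x ∉ S.dropped w r := by
  rintro (rfl | hx')
  · exact h.not_before hx
  · exact hx'.2 hx

lemma mem_dropped_iff {x : Event Tid Loc Val} :
    x ∈ S.dropped w r ↔ x = r ∨ (S.Before r x ∧ x ∉ S.graph.porfBefore w) := Iff.rfl

lemma not_dropped_of_before (hS : S.Inv P) {x : Event Tid Loc Val} (hx : S.Before x r) :
    x ∉ S.dropped w r := by
  rintro (rfl | hx')
  · exact pair_ne hS.nodup hx rfl
  · exact pair_asymm hS.nodup hx hx'.1

/-- Apart from events before `w`, everything after `r` is dropped, and nothing that stays depends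
on it. -/
lemma upClosed (hS : S.Inv P) (h : S.Reversal P w r r' a S') :
    S.graph.UpClosed (S.dropped w r) := by
  constructor
  · rintro x (rfl | hx)
    · exact h.mem
    · exact pair_mem_right hx.1
  · intro x y hxy hx
    have hy : y ∈ S.exe := hS.exec.porf_mem_right hxy
    have hyB : y ∉ S.graph.porfBefore w := fun hy' =>
      h.before_notMem (porfBefore_closed hS h (.single hxy) hy') hx
    have hxE : x ∈ S.exe := by
      rcases hx with rfl | hx
      · exact h.mem
      · exact pair_mem_right hx.1
    by_cases hyr : y = r
    · exact .inl hyr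
    refine .inr ⟨?_, hyB⟩
    have hrx : x = r ∨ S.Before r x := hx.imp_right fun h => h.1
    rcases hxy with hxy | hxy
    · have := hS.sorted.before hxE hy hxy.2.2
      rcases hrx with rfl | hrx
      · exact this
      · exact pair_trans hS.nodup hrx this
    · rcases hrx with rfl | hrx
      · exact absurd (hS.exec.rf_write hxy) h.isRead.not_isWrite
      · refine (pair_total h.mem hy (Ne.symm hyr)).resolve_right fun hyr => ?_
        exact hS.rev_not_locked h.rev hxy hyr hrx

/-- The graph of a reversal arises by dropping events and adding first the write, then the read. -/
lemma graph_eq (hS : S.Inv P) (h : S.Reversal P w r r' a S') :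
    S'.graph = ((S.graph.del (S.dropped w r)).add a w).add w r' := by
  have hr := h.isRead
  have hww := h.isWrite
  have hr' := h.isRead'
  have hrd : r ∉ S.deleted w r := fun h => pair_ne hS.nodup h.1 rfl
  obtain ⟨t, n, x, v₀, v, o, s, t', n', o', s', b, hreq, hreq', hw, rfl⟩ := h.labels
  have hset : r.setReadVal v = r' := by rw [hreq, hreq']; rfl
  have hrm : ∀ {b}, ¬ S.rf r b := fun h => hr.not_isWrite (hS.exec.rf_write h)
  have hrc : ∀ {b}, ¬ S.co r b := fun h => hr.not_isWrite (hS.exec.co_wf _ _ h).2.2.1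
  have hrc' : ∀ {b}, ¬ S.co b r := fun h => hr.not_isWrite (hS.exec.co_wf _ _ h).2.2.2.1
  have hwr : ¬ w.IsRead := fun h => h.not_isWrite hww
  have hrw : ¬ r'.IsWrite := hr'.not_isWrite
  ext b c
  · simp only [graph, reverse, remove, hset, List.mem_append, List.mem_map, List.mem_filter,
      decide_eq_true_eq, List.mem_singleton, ExecGraph.add, ExecGraph.del, dropped,
      Set.mem_insert_iff, Set.mem_sdiff, Set.mem_ofPred_eq]
    constructor
    · rintro (⟨y, ⟨hy1, hy2⟩, rfl⟩ | rfl)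
      · split_ifs with hyr
        · exact .inl rfl
        · exact .inr (.inr ⟨hy1, fun h => h.elim hyr hy2⟩)
      · exact .inr (.inl rfl)
    · rintro (rfl | rfl | ⟨h1, h2⟩)
      · exact .inl ⟨r, ⟨h.mem, hrd⟩, if_pos rfl⟩
      · exact .inr rfl
      · exact .inl ⟨b, ⟨h1, fun h => h2 (.inr h)⟩, if_neg fun h => h2 (.inl h)⟩
  · simp only [graph, reverse, remove, hset, ExecGraph.add, ExecGraph.del, dropped,
      Set.mem_insert_iff, hr', hwr, false_and, or_false, true_and]
    constructor
    · rintro (⟨⟨h1, h2, h3⟩, h4⟩ | h)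
      · exact .inl ⟨h1, fun h => h.elim (fun h => hrm (h ▸ h1)) h2, fun h => h.elim h4 h3⟩
      · exact .inr h
    · rintro (⟨h1, h2, h3⟩ | h)
      · exact .inl ⟨⟨h1, fun h => h2 (.inr h), fun h => h3 (.inr h)⟩, fun h => h3 (.inl h)⟩
      · exact .inr h
  · have hco : ∀ b c, (S.co b c ∧ b ∉ S.deleted w r ∧ c ∉ S.deleted w r) ↔
        (S.co b c ∧ b ∉ insert r (S.deleted w r) ∧ c ∉ insert r (S.deleted w r)) := by
      intro b c
      refine and_congr_right fun h => ?_
      have h1 : b ≠ r := fun hb => hrc (hb ▸ h)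
      have h2 : c ≠ r := fun hb => hrc' (hb ▸ h)
      simp [h1, h2]
    simp only [graph, reverse, remove, insertCo, hco, ExecGraph.add, ExecGraph.del, dropped, hww,
      hrw, false_and, or_false, true_and]

lemma place_mem (h : S.Reversal P w r r' a S') :
    (S.graph.del (S.dropped w r)).Mem a := by
  refine h.place.1.imp_right fun ha => ⟨ha.1, ?_⟩
  rintro (rfl | hd)
  · exact h.isRead.not_isWrite h.place.2.1
  · exact ha.2 hd

/-- The threads of the read and of the write are different. -/
lemma not_same_thread (hS : S.Inv P) (h : S.Reversal P w r r' a S') {t : Tid} {n n' : ℕ}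
    {l l' : Label Loc Val} (hr : r = .ev t n l) (hw : w = .ev t n' l') : False := by
  obtain ⟨m, hm⟩ := h.fits
  refine h.not_before ((mem_porfBefore_iff hS h).2 ⟨r, .inr h.mem, ?_, .refl⟩)
  obtain ⟨t', hh, ac, l'', heq, H, -⟩ := hm
  have hmem := h.mem
  subst hr
  rw [hw] at heq ⊢
  cases heq
  exact ⟨rfl, H.lt_length hmem⟩

lemma fits_write (hS : S.Inv P) (h : S.Reversal P w r r' a S') :
    (S.graph.del (S.dropped w r)).Fits P a w := by
  obtain ⟨m, hm⟩ := h.fits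
  have hww := h.isWrite
  have hB : ∀ z, S.graph.Mem z → z.PoBefore w → z ∈ S.graph.porfBefore w := fun z h1 h2 =>
    (mem_porfBefore_iff hS h).2 ⟨z, h1, h2, .refl⟩
  have hnd := fun x hx => h.before_notMem (x := x) hx
  have hpl := h.place_mem
  have hpl' := h.place.2
  obtain ⟨t, hh, ac, l, rfl, H, hnext, hal, -, hval⟩ := hm
  refine ⟨t, hh, ac, l, rfl, ?_, hnext, hal, fun _ => ⟨hpl, hpl'⟩, ?_⟩
  · intro n l'
    rw [← H n l']
    refine ⟨fun h => h.1, fun h => ⟨h, hnd _ (hB _ (.inr h) ⟨rfl, ?_⟩)⟩⟩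
    exact H.lt_length h
  · rintro x v o s rfl
    exact hww.elim

lemma fits_read (hS : S.Inv P) (h : S.Reversal P w r r' a S') :
    ((S.graph.del (S.dropped w r)).add a w).Fits P w r' := by
  have hnt := fun t n n' l l' => h.not_same_thread hS (t := t) (n := n) (n' := n') (l := l) (l' := l')
  have hup := h.upClosed hS
  have hmem := h.mem
  have hsort := hS.sorted
  have hnb := fun x hx => not_dropped_of_before (w := w) (r := r) hS (x := x) hx
  obtain ⟨t, n, x, v₀, v, o, s, t', n', o', s', b, rfl, rfl, rfl, rfl⟩ := h.labels
  have htt : t ≠ t' := by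
    rintro rfl
    exact hnt _ _ _ _ _ rfl rfl
  obtain ⟨hh, H, hnext⟩ := hS.exec.history t
  obtain ⟨ac, hac, hal⟩ := hnext n _ ((H _ _).1 hmem)
  have hlen : (hh.take n).length = n := by
    rw [List.length_take, min_eq_left (H.lt_length hmem).le]
  refine ⟨t, hh.take n, ac, _, by rw [hlen], ?_, hac, ?_, fun _ => ?_, ?_⟩
  · refine ExecGraph.IsHistory.add_of_ne ?_ htt
    refine ExecGraph.isHistory_del_of_first hup H (.inl rfl) fun m l' hm hd => ?_
    have : S.Before (.ev t m l') (.ev t n (.read x v₀ o s)) :=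
      hsort.before (hup.subset hd) hmem ⟨rfl, hm⟩
    exact hnb _ this hd
  · rcases ac with ⟨y, o1, s1⟩ | _ | _
    · obtain ⟨v1, h1⟩ := hal
      cases h1
      exact ⟨v, rfl⟩
    · cases hal
    · cases hal
  · exact ⟨ExecGraph.mem_add.2 (.inr rfl), trivial, x, rfl, rfl⟩
  · rintro _ _ _ _ ⟨⟩
    exact .inr ⟨_, _, _, _, _, rfl⟩

lemma exec_cut (hS : S.Inv P) (h : S.Reversal P w r r' a S') :
    (S.graph.del (S.dropped w r)).IsExecution P := hS.exec.del (h.upClosed hS)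

lemma exec (hS : S.Inv P) (h : S.Reversal P w r r' a S') : S'.graph.IsExecution P := by
  rw [h.graph_eq hS]
  exact ((h.exec_cut hS).add (h.fits_write hS)).add (h.fits_read hS)

lemma acyclic (hS : S.Inv P) (h : S.Reversal P w r r' a S') : S'.graph.PoRfAcyclic := by
  rw [h.graph_eq hS]
  exact ((hS.acyclic.del hS.exec (h.upClosed hS)).add (h.exec_cut hS) (h.fits_write hS)).add
    ((h.exec_cut hS).add (h.fits_write hS)) (h.fits_read hS)

/-- Paths to an event other than `w` and `r'` after a reversal are paths before it. -/
lemma porf_of_porf' (hS : S.Inv P) (h : S.Reversal P w r r' a S') {x y : Event Tid Loc Val}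
    (hxy : TransGen S'.graph.porf x y) (h1 : y ≠ r') (h2 : y ≠ w) :
    TransGen S.graph.porf x y ∧ y ∉ S.dropped w r ∧ x ≠ r' ∧ x ≠ w := by
  rw [h.graph_eq hS] at hxy
  have h3 := ExecGraph.transGen_porf_add ((h.exec_cut hS).add (h.fits_write hS)) (h.fits_read hS) hxy
  have h4 := ExecGraph.transGen_porf_add (h.exec_cut hS) (h.fits_write hS) (h3.2 h1)
  have h5 := (ExecGraph.transGen_porf_del hS.exec (h.upClosed hS)).1 (h4.2 h2)
  exact ⟨h5.1, h5.2, h3.1, h4.1⟩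

lemma ne_of_porf' (hS : S.Inv P) (h : S.Reversal P w r r' a S') {x y : Event Tid Loc Val}
    (hxy : TransGen S'.graph.porf x y) : x ≠ r' := by
  rw [h.graph_eq hS] at hxy
  exact (ExecGraph.transGen_porf_add ((h.exec_cut hS).add (h.fits_write hS)) (h.fits_read hS) hxy).1

lemma cut_sub (hS : S.Inv P) (h : S.Reversal P w r r' a S') :
    (S.graph.del (S.dropped w r)).Sub S'.graph := by
  rw [h.graph_eq hS]
  exact ⟨fun e he => ExecGraph.mem_add.2 (.inl (ExecGraph.mem_add.2 (.inl he))),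
    fun _ _ h => .inl (.inl h), fun _ _ h => .inl (.inl h)⟩

/-- Paths to an event that is not dropped remain. -/
lemma porf'_of_porf (hS : S.Inv P) (h : S.Reversal P w r r' a S') {x y : Event Tid Loc Val}
    (hxy : TransGen S.graph.porf x y) (hy : y ∉ S.dropped w r) : TransGen S'.graph.porf x y :=
  transGen_mono (h.cut_sub hS).porf _ _
    ((ExecGraph.transGen_porf_del hS.exec (h.upClosed hS)).2 ⟨hxy, hy⟩)

lemma mem_exe (hS : S.Inv P) (h : S.Reversal P w r r' a S') {x : Event Tid Loc Val} :
    x ∈ S'.exe ↔ (x ∈ S.exe ∧ x ∉ S.dropped w r) ∨ x = w ∨ x = r' := by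
  have : x ∈ S'.graph.E ↔ x ∈ (((S.graph.del (S.dropped w r)).add a w).add w r').E := by
    rw [h.graph_eq hS]
  rw [mem_graph_E] at this
  rw [this]
  simp only [ExecGraph.add, ExecGraph.del, Set.mem_insert_iff, Set.mem_sdiff, mem_graph_E]
  tauto

lemma rf_iff (hS : S.Inv P) (h : S.Reversal P w r r' a S') {x y : Event Tid Loc Val} :
    S'.rf x y ↔ (S.rf x y ∧ y ∉ S.dropped w r) ∨ (x = w ∧ y = r') := by
  have h1 : S'.rf x y ↔ (((S.graph.del (S.dropped w r)).add a w).add w r').rf x y := by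
    rw [← h.graph_eq hS]
    rfl
  have hwr : ¬ w.IsRead := fun h' => h'.not_isWrite h.isWrite
  rw [h1]
  simp only [ExecGraph.add, ExecGraph.del, hwr, false_and, or_false, h.isRead', true_and]
  refine or_congr_left ⟨fun h => ⟨h.1, h.2.2⟩, fun h' => ⟨h'.1, fun hx => ?_, h'.2⟩⟩
  exact h'.2 ((h.upClosed hS).closed _ _ (.inr h'.1) hx)

lemma mem_porfBefore_of_porf' (hS : S.Inv P) (h : S.Reversal P w r r' a S')
    {y : Event Tid Loc Val} : TransGen S'.graph.porf y w ↔ y ∈ S.graph.porfBefore w := by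
  rw [mem_porfBefore_iff hS h]
  constructor
  · intro hy
    obtain ⟨z, hyz, hzw⟩ := TransGen.tail'_iff.1 hy
    have hzw' : S'.graph.po z w := hzw.resolve_right fun h' =>
      ((h.exec hS).rf_read h').not_isWrite h.isWrite
    have hz1 : z ≠ w := by
      rintro rfl
      exact hzw'.2.2.irrefl
    have hz2 : z ≠ r' := fun hz => h.ne_of_porf' hS (.single hzw) hz
    have hz : S.graph.Mem z := hzw'.1.imp_right fun hz => by
      rcases (h.mem_exe hS).1 hz with h' | h' | h'
      · exact h'.1
      · exact absurd h' hz1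
      · exact absurd h' hz2
    refine ⟨z, hz, hzw'.2.2, ?_⟩
    rcases reflTransGen_iff_eq_or_transGen.1 hyz with rfl | hyz
    · exact .refl
    · exact (h.porf_of_porf' hS hyz hz2 hz1).1.to_reflTransGen
  · rintro ⟨z, hz, hzw, hyz⟩
    have hzd : z ∉ S.dropped w r :=
      h.before_notMem ((mem_porfBefore_iff hS h).2 ⟨z, hz, hzw, .refl⟩)
    have hw' : S'.graph.Mem w := .inr ((h.mem_exe hS).2 (.inr (.inl rfl)))
    have hz' : S'.graph.Mem z := hz.imp_right fun hz => (h.mem_exe hS).2 (.inl ⟨hz, hzd⟩)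
    have hlast : S'.graph.porf z w := .inl ⟨hz', hw', hzw⟩
    rcases reflTransGen_iff_eq_or_transGen.1 hyz with rfl | hyz
    · exact .single hlast
    · exact .tail (h.porf'_of_porf hS hyz hzd) hlast

/-- The order of the events before and after a reversal. -/
lemma exists_split (hS : S.Inv P) (h : S.Reversal P w r r' a S') :
    ∃ A Y X, S.exe = A ++ r :: Y ∧ S'.exe = A ++ r' :: X ++ [w] ∧
      X.Sublist Y ∧ (∀ x, x ∈ X ↔ x ∈ Y ∧ x ∈ S.graph.porfBefore w) ∧
      (∀ x, x ∈ A ↔ S.Before x r) ∧ (∀ x, x ∈ Y ↔ S.Before r x) := by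
  classical
  obtain ⟨A, Y, hAY⟩ := List.append_of_mem h.mem
  have hnd := hS.nodup
  rw [hAY] at hnd
  have hA : ∀ x, x ∈ A ↔ S.Before x r := fun x => by
    unfold Before
    rw [hAY]
    exact (pair_split hnd).1.symm
  have hY : ∀ x, x ∈ Y ↔ S.Before r x := fun x => by
    unfold Before
    rw [hAY]
    exact (pair_split hnd).2.symm
  refine ⟨A, Y, Y.filter (· ∈ S.graph.porfBefore w), hAY, ?_, List.filter_sublist,
    fun x => by simp, hA, hY⟩
  obtain ⟨t, n, x, v₀, v, o, s, t', n', o', s', b, hreq, hreq', hw, heq⟩ := h.labels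
  have hset : r.setReadVal v = r' := by rw [hreq, hreq']; rfl
  have hrd : r ∉ S.deleted w r := fun h => pair_ne hS.nodup h.1 rfl
  have hAd : ∀ x ∈ A, x ∉ S.deleted w r ∧ x ≠ r := fun x hx => by
    have := not_dropped_of_before (w := w) hS ((hA x).1 hx)
    exact ⟨fun h => this (.inr h), fun h => this (.inl h)⟩
  rw [heq]
  simp only [reverse, remove, hset, hAY, List.filter_append, List.filter_cons, hrd,
    not_false_eq_true, decide_true, if_true, List.map_append, List.map_cons]
  congr 2
  · rw [List.filter_eq_self.2 fun x hx => by simp [(hAd x hx).1]]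
    exact (List.map_congr_left fun x hx => if_neg (hAd x hx).2).trans (List.map_id _)
  · congr 1
    have h1 : Y.filter (fun e => decide (e ∉ S.deleted w r)) =
        Y.filter (· ∈ S.graph.porfBefore w) := by
      refine List.filter_congr fun x hx => ?_
      have := (hY x).1 hx
      simp [deleted, this]
    rw [h1]
    refine (List.map_congr_left fun x hx => if_neg ?_).trans (List.map_id _)
    rintro rfl
    exact pair_ne hS.nodup ((hY _).1 (List.mem_filter.1 hx).1) rfl

lemma rev_eq (h : S.Reversal P w r r' a S') {x : Event Tid Loc Val} (hS : S.Inv P) :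
    x ∈ S'.rev ↔ x = r' ∨ (x ∈ S.rev ∧ x ∉ S.dropped w r ∧ x ∉ S.graph.porfBefore w) := by
  have hB := h.mem_porfBefore_of_porf' hS (y := x)
  have hww := h.isWrite
  have hfw := (h.fits_write hS)
  have hup := h.upClosed hS
  have hpB := mem_porfBefore_iff hS h (y := x)
  have hnB := fun z hz => h.before_notMem (x := z) hz
  have hpB' := fun z => mem_porfBefore_iff hS h (y := z)
  obtain ⟨t, n, y, v₀, v, o, s, t', n', o', s', b, hreq, hreq', hw, heq⟩ := h.labels
  have hset : r.setReadVal v = r' := by rw [hreq, hreq']; rfl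
  -- no event before `w` is dropped, so that removing events does not change what is before `w`
  have hBB : x ∈ (S.remove (S.deleted w r)).graph.porfBefore w → x ∈ S.graph.porfBefore w := by
    intro hx
    refine transGen_mono ?_ _ _ hx
    refine sup_le_sup (fun b c hbc => ?_) fun b c hbc => hbc.1
    refine ⟨hbc.1.imp_right ?_, hbc.2.1.imp_right ?_, hbc.2.2⟩ <;>
    · rintro (rfl | h)
      · exact .inl rfl
      · exact .inr (by simpa [graph, remove] using (List.mem_filter.1 h).1)
  have hBB' : x ∈ S.graph.porfBefore w → x ∈ (S.remove (S.deleted w r)).graph.porfBefore w := by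
    intro hx
    have hx' : x ∈ (S.graph.del (S.dropped w r)).porfBefore w := by
      rw [hfw.mem_porfBefore_iff (hS.exec.del hup) hww]
      obtain ⟨z, hz, hzw, hxz⟩ := hpB.1 hx
      have hzd : z ∉ S.dropped w r := hnB z ((hpB' z).2 ⟨z, hz, hzw, .refl⟩)
      refine ⟨z, (ExecGraph.mem_del hS.exec hup).2 ⟨hz, hzd⟩, hzw, ?_⟩
      rcases reflTransGen_iff_eq_or_transGen.1 hxz with rfl | hxz
      · exact .refl
      · exact ((ExecGraph.transGen_porf_del hS.exec hup).2 ⟨hxz, hzd⟩).to_reflTransGen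
    refine transGen_mono ?_ _ _ hx'
    refine sup_le_sup (fun b c hbc => ?_) fun b c hbc =>
      ⟨hbc.1, fun h => hbc.2.1 (.inr h), fun h => hbc.2.2 (.inr h)⟩
    refine ⟨hbc.1.imp_right ?_, hbc.2.1.imp_right ?_, hbc.2.2⟩ <;>
    · rintro (rfl | h)
      · exact .inl rfl
      · refine .inr ?_
        simp only [graph, remove, Set.mem_ofPred_eq, List.mem_filter, decide_eq_true_eq]
        exact ⟨h.1, fun h' => h.2 (.inr h')⟩
  rw [heq]
  simp only [reverse, hset, Set.mem_insert_iff, Set.mem_sdiff, Set.mem_singleton_iff]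
  refine or_congr_right ?_
  constructor
  · rintro ⟨⟨⟨h1, h2⟩, h3⟩, h4⟩
    exact ⟨h1, fun h => h.elim h3 h2, fun h => h4 (hBB' h)⟩
  · rintro ⟨h1, h2, h3⟩
    exact ⟨⟨⟨h1, fun h => h2 (.inr h)⟩, fun h => h2 (.inl h)⟩, fun h => h3 (hBB h)⟩

end Reversal

end State

namespace State

variable {P : Program Tid Loc Val} {nev : Tid × ℕ → Tid × ℕ → Prop} {S S' : State Tid Loc Val}
  {t : Tid} {w r r' a : Event Tid Loc Val}

namespace Reversal

lemma before_iff (hS : S.Inv P) (h : S.Reversal P w r r' a S') {b c : Event Tid Loc Val} :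
    S'.Before b c ↔ (S.Before b c ∧ b ∉ S.dropped w r ∧ c ∉ S.dropped w r) ∨
      (S.Before b r ∧ c = r') ∨ (b = r' ∧ c ∈ S.graph.porfBefore w ∧ S.Before r c) ∨
      (c = w ∧ (b = r' ∨ (b ∈ S.exe ∧ b ∉ S.dropped w r))) := by
  obtain ⟨A, Y, X, hAY, hAX, hXY, hX, hA, hY⟩ := h.exists_split hS
  have hAd : ∀ x ∈ A, x ∉ S.dropped w r := fun x hx => not_dropped_of_before hS ((hA x).1 hx)
  have hXd : ∀ x ∈ X, x ∉ S.dropped w r := fun x hx => h.before_notMem ((hX x).1 hx).2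
  have hnd := hS.nodup
  have hSB : ∀ b c, S.Before b c ↔ [b, c].Sublist A ∨ (b ∈ A ∧ (c = r ∨ c ∈ Y)) ∨
      [b, c].Sublist Y ∨ (b = r ∧ c ∈ Y) := fun b c => by
    unfold Before
    rw [hAY, pair_sublist_append, pair_sublist_cons, List.mem_cons]
  have hSB' : ∀ b c, S'.Before b c ↔ [b, c].Sublist A ∨ (b ∈ A ∧ (c = r' ∨ c ∈ X)) ∨
      [b, c].Sublist X ∨ (b = r' ∧ c ∈ X) ∨ ((b ∈ A ∨ b = r' ∨ b ∈ X) ∧ c = w) := fun b c => by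
    unfold Before
    rw [hAX, pair_sublist_concat, pair_sublist_append, pair_sublist_cons]
    simp only [List.mem_append, List.mem_cons]
    tauto
  have hmemS : ∀ b, b ∈ S.exe ↔ b ∈ A ∨ b = r ∨ b ∈ Y := fun b => by
    rw [hAY]
    simp
  have hYX : ∀ x ∈ Y, x ∉ S.dropped w r → x ∈ X := fun x hx hxd => by
    by_contra hx'
    exact hxd (.inr ⟨(hY x).1 hx, fun hxB => hx' ((hX x).2 ⟨hx, hxB⟩)⟩)
  have hsub : ∀ {b c}, [b, c].Sublist X → S.Before b c := fun hbc =>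
    (hSB _ _).2 (.inr (.inr (.inl (hbc.trans hXY))))
  rw [hSB', ← hA b]
  constructor
  · rintro (h1 | ⟨h1, rfl | h2⟩ | h1 | ⟨rfl, h1⟩ | ⟨h1 | h1 | h1, rfl⟩)
    · exact .inl ⟨(hSB _ _).2 (.inl h1), hAd _ (pair_mem_left h1), hAd _ (pair_mem_right h1)⟩
    · exact .inr (.inl ⟨h1, rfl⟩)
    · exact .inl ⟨(hSB _ _).2 (.inr (.inl ⟨h1, .inr (hXY.subset h2)⟩)), hAd _ h1, hXd _ h2⟩
    · exact .inl ⟨hsub h1, hXd _ (pair_mem_left h1), hXd _ (pair_mem_right h1)⟩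
    · exact .inr (.inr (.inl ⟨rfl, ((hX _).1 h1).2, (hY _).1 (hXY.subset h1)⟩))
    · exact .inr (.inr (.inr ⟨rfl, .inr ⟨(hmemS _).2 (.inl h1), hAd _ h1⟩⟩))
    · exact .inr (.inr (.inr ⟨rfl, .inl h1⟩))
    · exact .inr (.inr (.inr ⟨rfl, .inr ⟨(hmemS _).2 (.inr (.inr (hXY.subset h1))), hXd _ h1⟩⟩))
  · rintro (⟨h1, h2, h3⟩ | ⟨h1, rfl⟩ | ⟨rfl, h1, h2⟩ | ⟨rfl, rfl | ⟨h1, h2⟩⟩)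
    · rcases (hSB _ _).1 h1 with h4 | ⟨h4, rfl | h5⟩ | h4 | ⟨rfl, -⟩
      · exact .inl h4
      · exact absurd (.inl rfl) h3
      · exact .inr (.inl ⟨h4, .inr (hYX _ h5 h3)⟩)
      · refine .inr (.inr (.inl ?_))
        refine (pair_total (hYX _ (pair_mem_left h4) h2) (hYX _ (pair_mem_right h4) h3)
          (pair_ne hnd h1)).resolve_right fun h5 => ?_
        exact pair_asymm hnd h1 (hsub h5)
      · exact absurd (.inl rfl) h2
    · exact .inr (.inl ⟨h1, .inl rfl⟩)
    · exact .inr (.inr (.inr (.inl ⟨rfl, (hX _).2 ⟨(hY _).2 h2, h1⟩⟩)))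
    · exact .inr (.inr (.inr (.inr ⟨.inr (.inl rfl), rfl⟩)))
    · refine .inr (.inr (.inr (.inr ⟨?_, rfl⟩)))
      rcases (hmemS _).1 h1 with h3 | rfl | h3
      · exact .inl h3
      · exact absurd (.inl rfl) h2
      · exact .inr (.inr (hYX _ h3 h2))

lemma pos_ne_of_mem (hS : S.Inv P) (h : S.Reversal P w r r' a S') {x : Event Tid Loc Val}
    (hx : x ∈ S.exe) (hxd : x ∉ S.dropped w r) : x ≠ r' := by
  rintro rfl
  have := hS.exec.eq_of_pos (a := x) (b := r) hx h.mem h.pos_eq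
  exact hxd (.inl this)

lemma ne_write_of_mem (h : S.Reversal P w r r' a S') {x : Event Tid Loc Val}
    (hx : x ∈ S.exe) : x ≠ w := fun hxw => h.write_notMem (hxw ▸ hx)

lemma nodup (hS : S.Inv P) (h : S.Reversal P w r r' a S') : S'.exe.Nodup := by
  obtain ⟨A, Y, X, hAY, hAX, hXY, hX, hA, hY⟩ := h.exists_split hS
  have hAXr : (A ++ r :: X).Nodup := by
    have := hS.nodup
    rw [hAY] at this
    exact this.sublist ((List.Sublist.refl A).append (hXY.cons_cons r))
  have hmem : ∀ x ∈ A ++ X, x ∈ S.exe ∧ x ∉ S.dropped w r := by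
    intro x hx
    rcases List.mem_append.1 hx with hx | hx
    · exact ⟨pair_mem_left ((hA x).1 hx), not_dropped_of_before hS ((hA x).1 hx)⟩
    · exact ⟨pair_mem_right ((hY x).1 (hXY.subset hx)), h.before_notMem ((hX x).1 hx).2⟩
  rw [hAX]
  have hAX' : (A ++ X).Nodup := hAXr.sublist ((List.Sublist.refl A).append (List.sublist_cons_self _ _))
  have h1 : (A ++ r' :: X).Nodup := by
    rw [List.nodup_middle, List.nodup_cons]
    exact ⟨fun hr => h.pos_ne_of_mem hS (hmem _ hr).1 (hmem _ hr).2 rfl, hAX'⟩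
  rw [List.nodup_append]
  refine ⟨h1, List.nodup_singleton _, fun x hx y hy => ?_⟩
  rw [List.mem_singleton.1 hy]
  simp only [List.mem_append, List.mem_cons] at hx
  rcases hx with hx | rfl | hx
  · exact h.ne_write_of_mem (hmem _ (List.mem_append_left _ hx)).1
  · exact h.ne_write
  · exact h.ne_write_of_mem (hmem _ (List.mem_append_right _ hx)).1

lemma sorted (hS : S.Inv P) (h : S.Reversal P w r r' a S') : PoSorted S'.exe := by
  -- it suffices that every pair of events that is related by program order is in the right order
  have key : ∀ b c, S'.Before b c → ¬ c.PoBefore b := by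
    intro b c hbc hpo
    have hrp : ∀ {b c : Event Tid Loc Val}, S.Before b c → ¬ c.PoBefore b := fun hbc hpo =>
      pair_asymm hS.nodup hbc (hS.sorted.before (pair_mem_right hbc) (pair_mem_left hbc) hpo)
    have hcl : ∀ {b c d : Event Tid Loc Val}, b.pos = c.pos → b.PoBefore d → ¬ b.IsInit →
        c.PoBefore d := by
      intro b c d h1 h2 h3
      rcases b with _ | _ <;> rcases c with _ | _ <;> rcases d with _ | _ <;>
        simp_all [Event.PoBefore, Event.pos, Event.IsInit]
    rcases (h.before_iff hS).1 hbc with h1 | ⟨h1, rfl⟩ | ⟨rfl, h1, h2⟩ | ⟨rfl, h1⟩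
    · exact hrp h1.1 hpo
    · exact hrp h1 (hcl h.pos_eq hpo h.isRead'.not_isInit)
    · exact hrp h2 (hpo.congr_pos h.pos_eq)
    · obtain ⟨m, hm⟩ := h.fits
      rcases h1 with rfl | h1
      · exact hm.not_poBefore (.inr h.mem) (hpo.congr_pos h.pos_eq)
      · exact hm.not_poBefore (.inr h1.1) hpo
  refine List.pairwise_iff_forall_sublist.2 fun {b c} hbc => key b c hbc

/-- The source of a read that stays also stays, and it keeps its side of the read. -/
lemma guarded (hS : S.Inv P) (h : S.Reversal P w r r' a S') {b z : Event Tid Loc Val}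
    (hg : S.Guarded b z) (hb : b ∉ S.dropped w r) : S'.Guarded b z := by
  obtain ⟨u, hu, hbu, hz⟩ := hg
  have hud : u ∉ S.dropped w r := fun hu' => hb ((h.upClosed hS).closed _ _ (.inr hu) hu')
  exact ⟨u, (h.rf_iff hS).2 (.inl ⟨hu, hb⟩), (h.before_iff hS).2 (.inl ⟨hbu, hb, hud⟩),
    hz.imp_right fun hz => h.porf'_of_porf hS hz hud⟩

/-- The reversed read does not interrupt an RMW or guard anything that stays. -/
lemma not_guarded_read (hS : S.Inv P) (h : S.Reversal P w r r' a S') {b : Event Tid Loc Val} :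
    ¬ S.Guarded b r := by
  rintro ⟨u, hu, hbu, rfl | hru⟩
  · exact h.isRead.not_isWrite (hS.exec.rf_write hu)
  · exact ((hS.locked u b hu hbu).1 r hru).1 h.rev

end Reversal

lemma Inv.reversal (hS : S.Inv P) (hcand : S.Candidate P t) {n : ℕ} {l : Label Loc Val}
    (hw : w = .ev t n l) (h : S.Reversal P w r r' a S') : S'.Inv P := by
  have hex := h.exec hS
  have hhist' : ∀ t, S'.graph.IsHistory t (S'.hist t) :=
    isHistory_hist hex (h.sorted hS) (h.nodup hS)
  -- the action that is scheduled
  obtain ⟨m₀, hm₀⟩ := h.fits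
  rw [hw] at hm₀
  obtain ⟨hn, act, hact, hal⟩ := fits_index hS hm₀
  have hwmem : w ∈ S'.exe := (h.mem_exe hS).2 (.inr (.inl rfl))
  refine ⟨hex, h.acyclic hS, h.nodup hS, h.sorted hS, ?_, ?_, ?_, ?_, ?_⟩
  · intro x hx
    rw [h.mem_exe hS]
    rcases (h.rev_eq hS).1 hx with rfl | ⟨h1, h2, h3⟩
    · exact ⟨.inr (.inr rfl), h.isRead'⟩
    · exact ⟨.inl ⟨(hS.rev_mem x h1).1, h2⟩, (hS.rev_mem x h1).2⟩
  · intro b c hbc hc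
    have : (((S.graph.del (S.dropped w r)).add a w).add w r').co b c := by
      rw [← h.graph_eq hS]
      exact hbc
    rcases this with (h1 | ⟨-, ⟨rfl, -⟩ | ⟨-, h1⟩⟩) | ⟨h1, -⟩
    · exact hS.co_init _ _ h1.1 hc
    · obtain ⟨x, hx⟩ := Event.isInit_iff.1 hc
      rw [hx] at hw
      cases hw
    · exact hS.co_init _ _ h1.1 hc
    · exact h.isRead'.not_isWrite h1
  · intro u c huc hcu
    rcases (h.rf_iff hS).1 huc with ⟨huc, hcd⟩ | ⟨rfl, rfl⟩
    · have hud : u ∉ S.dropped w r := fun h' => hcd ((h.upClosed hS).closed _ _ (.inr huc) h')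
      have huE : u ∈ S'.exe := pair_mem_right hcu
      have hcE : c ∈ S.exe := hS.exec.rf_mem huc
      have hur' : u ≠ r' := fun h' => h.isRead'.not_isWrite (h' ▸ hS.exec.rf_write huc)
      have huw : u ≠ w := by
        rintro rfl
        rcases (hS.exec.rf_wf _ _ huc).1 with h' | h'
        · exact hex.not_isInit huE h'
        · exact h.write_notMem h'
      have hcr' := h.pos_ne_of_mem hS hcE hcd
      have hcu' : S.Before c u := by
        rcases (h.before_iff hS).1 hcu with h1 | ⟨-, h1⟩ | ⟨h1, -⟩ | ⟨h1, -⟩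
        · exact h1.1
        · exact absurd h1 hur'
        · exact absurd h1 hcr'
        · exact absurd h1 huw
      obtain ⟨h1, h2⟩ := hS.locked u c huc hcu'
      refine ⟨fun y hy => ?_, fun z hz hzu => ?_⟩
      · obtain ⟨h3, -, h4, h5⟩ := h.porf_of_porf' hS hy hur' huw
        refine ⟨fun hy' => ?_, fun hy' => ?_⟩
        · rcases (h.rev_eq hS).1 hy' with rfl | h6
          · exact h4 rfl
          · exact (h1 y h3).1 h6.1
        · have h6 := ((h.mem_exe hS).1 hy').resolve_right fun h' => h'.elim h5 h4
          exact (h.before_iff hS).2 (.inl ⟨(h1 y h3).2 h6.1, h6.2, hud⟩)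
      · rcases (h.before_iff hS).1 hz with h3 | ⟨h3, rfl⟩ | ⟨h3, -⟩ | ⟨rfl, -⟩
        · rcases (h.before_iff hS).1 hzu with h4 | ⟨-, h4⟩ | ⟨h4, -⟩ | ⟨h4, -⟩
          · exact h.porf'_of_porf hS (h2 z h3.1 h4.1) hud
          · exact absurd h4 hur'
          · exact absurd h4 (h.pos_ne_of_mem hS (pair_mem_right h3.1) h3.2.2)
          · exact absurd h4 huw
        · rcases (h.before_iff hS).1 hzu with h4 | ⟨-, h4⟩ | ⟨-, -, h4⟩ | ⟨h4, -⟩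
          · exact absurd rfl (h.pos_ne_of_mem hS (pair_mem_left h4.1) h4.2.1)
          · exact absurd h4 hur'
          · exact (hS.rev_not_locked h.rev huc h3 h4).elim
          · exact absurd h4 huw
        · exact absurd h3 hcr'
        · exact absurd hzu fun h' => by
            rcases (h.before_iff hS).1 h' with h4 | ⟨h4, -⟩ | ⟨h4, -⟩ | ⟨h4, -⟩
            · exact h.write_notMem (pair_mem_left h4.1)
            · exact h.write_notMem (pair_mem_left h4)
            · exact h.ne_write h4.symm
            · exact huw h4
    · refine ⟨fun y hy => ?_, fun z hz hzu => ?_⟩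
      · have hyB := (h.mem_porfBefore_of_porf' hS).1 hy
        have hyr := h.ne_of_porf' hS hy
        refine ⟨fun hy' => ?_, fun hy' => ?_⟩
        · rcases (h.rev_eq hS).1 hy' with rfl | h6
          · exact hyr rfl
          · exact h6.2.2 hyB
        · have h6 := ((h.mem_exe hS).1 hy').resolve_right fun h' => h'.elim
            (fun h' => h.acyclic hS u (h' ▸ hy)) hyr
          exact (h.before_iff hS).2 (.inr (.inr (.inr ⟨rfl, .inr h6⟩)))
      · refine (h.mem_porfBefore_of_porf' hS).2 ?_
        have hzw := pair_ne (h.nodup hS) hzu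
        rcases (h.before_iff hS).1 hz with h3 | ⟨h3, rfl⟩ | ⟨h3, h4, h5⟩ | ⟨h3, -⟩
        · exact absurd rfl (h.pos_ne_of_mem hS (pair_mem_left h3.1) h3.2.1)
        · exact absurd rfl (pair_ne (h.nodup hS) hz)
        · exact h4
        · exact absurd h3 hzw
  · intro b c z hbc hbz hzc
    have hpo : b.PoBefore c := by
      obtain ⟨t, n, x, v, o, s, v', o', s', rfl, rfl⟩ := hbc
      exact ⟨rfl, Nat.lt_succ_self n⟩
    have hbE := (h.mem_exe hS).1 (pair_mem_left hbz)
    have hcE := (h.mem_exe hS).1 (pair_mem_right hzc)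
    have hbr' : b ≠ r' := by
      rintro rfl
      exact h.ne_of_porf' hS (.single (.inl ⟨.inr (pair_mem_left hbz), .inr (pair_mem_right hzc),
        hpo⟩)) rfl
    have hcr' : c ≠ r' := by
      rintro rfl
      obtain ⟨t, n, x, v, o, s, v', o', s', rfl, h'⟩ := hbc
      rw [h'] at h
      exact h.isRead'.elim
    have hbw : b ≠ w := by
      rintro rfl
      obtain ⟨t, n, x, v, o, s, v', o', s', h', rfl⟩ := hbc
      rw [h'] at h
      exact h.isWrite.elim
    have hb := hbE.resolve_right fun h' => h'.elim hbw hbr'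
    by_cases hcw : c = w
    · -- the new write is the write half of an RMW
      subst hcw
      obtain ⟨t', k, x, v, o, s, v', o', s', rfl, heq⟩ := hbc
      rw [hw] at heq
      cases heq
      have hp : S.PendingRmw P t := by
        refine ⟨act, hact, ?_⟩
        rcases act with _ | _ | _
        · obtain ⟨_, h⟩ := hal
          cases h
        · cases hal
          rfl
        · cases hal
      rcases (h.before_iff hS).1 hbz with h1 | ⟨h1, rfl⟩ | ⟨h1, -⟩ | ⟨rfl, -⟩
      · exact h.guarded hS (hS.rmw_pending _ _ _ z hp hn h1.1) hb.2
      · exact absurd (hS.rmw_pending _ _ _ _ hp hn h1) (h.not_guarded_read hS)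
      · exact absurd h1 hbr'
      · exact absurd rfl (pair_ne (h.nodup hS) hzc)
    · have hc := hcE.resolve_right fun h' => h'.elim hcw hcr'
      rcases (h.before_iff hS).1 hbz with h1 | ⟨h1, rfl⟩ | ⟨h1, -⟩ | ⟨rfl, -⟩
      · rcases (h.before_iff hS).1 hzc with h2 | ⟨-, h2⟩ | ⟨h2, -⟩ | ⟨h2, -⟩
        · exact h.guarded hS (hS.rmw_pair b c z hbc h1.1 h2.1) hb.2
        · exact absurd h2 hcr'
        · exact absurd h2 (h.pos_ne_of_mem hS (pair_mem_right h1.1) h1.2.2)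
        · exact absurd h2 hcw
      · rcases (h.before_iff hS).1 hzc with h2 | ⟨-, h2⟩ | ⟨-, -, h2⟩ | ⟨h2, -⟩
        · exact absurd rfl (h.pos_ne_of_mem hS (pair_mem_left h2.1) h2.2.1)
        · exact absurd h2 hcr'
        · exact absurd (hS.rmw_pair b c r hbc h1 h2) (h.not_guarded_read hS)
        · exact absurd h2 hcw
      · exact absurd h1 hbr'
      · rcases (h.before_iff hS).1 hzc with h4 | ⟨h4, -⟩ | ⟨h4, -⟩ | ⟨h4, -⟩
        · exact absurd (pair_mem_left h4.1) h.write_notMem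
        · exact absurd (pair_mem_left h4) h.write_notMem
        · exact absurd h4.symm h.ne_write
        · exact absurd h4 hcw
  · intro t' k l' z hp hk hz
    have hlast : ∀ c, ¬ S'.graph.po (.ev t' k l') c := by
      rintro c ⟨-, hc, hpo⟩
      rcases c with _ | ⟨t'', k', l''⟩
      · exact hpo.elim
      · obtain ⟨rfl, hlt⟩ := hpo
        have := (hhist' t').lt_length (hc.resolve_left id)
        omega
    -- no RMW other than that of `r'` becomes pending
    have hold : .ev t' k l' ∈ S.exe → .ev t' k l' ∉ S.dropped w r → False := by
      intro hb hbd
      have htw : t' ≠ t := by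
        rintro rfl
        refine hlast w ⟨.inr (pair_mem_left hz), .inr hwmem, ?_⟩
        rw [hw]
        exact ⟨rfl, hn ▸ (hS.isHistory t').lt_length hb⟩
      obtain ⟨tr, x₁, x₂, x₃, x₄, x₅, x₆, -, -, -, -, -, hr, hr', -⟩ := h.labels
      have htr : t' ≠ tr := by
        rintro rfl
        rcases lt_trichotomy k x₁ with hlt | rfl | hlt
        · refine hlast r' ⟨.inr (pair_mem_left hz), .inr ((h.mem_exe hS).2 (.inr (.inr rfl))), ?_⟩
          rw [hr']
          exact ⟨rfl, hlt⟩
        · exact hbd (.inl (hS.exec.eq_of_pos hb h.mem (by rw [hr]; rfl)))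
        · refine hbd ((h.upClosed hS).closed r _ (.inl ⟨.inr h.mem, .inr hb, ?_⟩) (.inl rfl))
          rw [hr]
          exact ⟨rfl, hlt⟩
      obtain ⟨m, hm, Hm, hmd⟩ := ExecGraph.isHistory_del hS.exec (h.upClosed hS) (hS.isHistory t')
      have Hm' : S'.graph.IsHistory t' ((S.hist t').take m) := by
        have h1 := Hm.add_of_ne (m := a) (n := n) (l := l) htw
        rw [← hw] at h1
        rw [h.graph_eq hS, hr']
        exact h1.add_of_ne htr
      have heq := (hhist' t').unique Hm'
      obtain ⟨act', hact', hrmw⟩ := hp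
      rw [nextAct, heq] at hact'
      rw [heq, List.length_take, min_eq_left hm] at hk
      subst hk
      rcases hm.lt_or_eq with hlt | heq'
      · -- the write half of the RMW has been dropped
        obtain ⟨l₁, hl₁⟩ := hmd hlt
        have hE₁ := (h.upClosed hS).subset hl₁
        obtain ⟨hh, H, hnext⟩ := hS.exec.history t'
        obtain rfl := H.unique (hS.isHistory t')
        obtain ⟨act₁, ha₁, hal₁⟩ := hnext _ _ ((H _ _).1 hE₁)
        rw [hact'] at ha₁
        cases ha₁
        have hpair : (Event.ev t' k l').RmwPair (.ev t' (k + 1) l₁) := by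
          rcases act' with _ | ⟨y, v', o', s', bb⟩ | _
          · exact hrmw.elim
          · obtain rfl : bb = true := hrmw
            cases hal₁
            obtain ⟨h₁, v₁, o₁, s₁, hh₁⟩ := P.rmw_wf _ _ _ _ _ _ hact'
            have hlen : h₁.length = k := by
              have := congrArg List.length hh₁
              rw [List.length_take, min_eq_left hlt.le, List.length_append] at this
              simpa using this.symm
            have hlk : ((S.hist t').take (k + 1))[k]? = some l' := by
              rw [List.getElem?_take, if_pos (Nat.lt_succ_self k)]
              exact (H _ _).1 hb
            rw [hh₁, ← hlen] at hlk
            simp only [List.getElem?_concat_length, Option.some.injEq] at hlk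
            subst hlk
            exact ⟨_, _, _, _, _, _, _, _, _, rfl, rfl⟩
          · exact hrmw.elim
        have hpo : S.graph.porf (.ev t' k l') (.ev t' (k + 1) l₁) :=
          .inl ⟨.inr hb, .inr hE₁, rfl, Nat.lt_succ_self k⟩
        by_cases hbB : .ev t' k l' ∈ S.graph.porfBefore w
        · -- then the next event of the thread is also before `w`
          obtain ⟨z', hz', hzw', hbz'⟩ := (Reversal.mem_porfBefore_iff hS h).1 hbB
          have hread : (Event.ev t' k l').IsRead := by
            obtain ⟨_, _, _, _, _, _, _, _, _, h1, -⟩ := hpair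
            rw [h1]
            trivial
          rcases reflTransGen_iff_eq_or_transGen.1 hbz' with rfl | hbz'
          · rw [hw] at hzw'
            exact htw hzw'.1
          · obtain ⟨c, hc, hcz⟩ := hS.exec.exists_po_of_read hread hbz'
            refine h.before_notMem ((Reversal.mem_porfBefore_iff hS h).2 ⟨z', hz', hzw', ?_⟩) hl₁
            obtain ⟨t₂, k₂, l₂, rfl⟩ := hS.exec.exists_pos hc.mem_right
            obtain ⟨rfl, hlt₂⟩ := hc.2.2
            rcases (Nat.succ_le_of_lt hlt₂).lt_or_eq with hlt₃ | rfl
            · exact .head (.inl ⟨.inr hE₁, hc.2.1, rfl, hlt₃⟩) hcz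
            · rwa [hS.exec.eq_of_pos hE₁ hc.mem_right rfl]
        · have hbr : S.Before (.ev t' k l') r := by
            refine (pair_total hb h.mem fun h' => hbd (.inl h')).resolve_right fun h' => ?_
            exact hbd (.inr ⟨h', hbB⟩)
          have hr₁ : S.Before r (.ev t' (k + 1) l₁) := by
            rcases hl₁ with h' | h'
            · rw [hr] at h'
              cases h'
              exact absurd rfl htr
            · exact h'.1
          exact h.not_guarded_read hS (hS.rmw_pair _ _ _ hpair hbr hr₁)
      · rw [heq', List.take_length] at hact'
        exact htw (hS.pending_eq_of_candidate ⟨act', hact', hrmw⟩ hcand)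
    have hr'E : S'.Before r' w := (h.before_iff hS).2 (.inr (.inr (.inr ⟨rfl, .inl rfl⟩)))
    have hrf : S'.rf w r' := (h.rf_iff hS).2 (.inr ⟨rfl, rfl⟩)
    rcases (h.before_iff hS).1 hz with h1 | ⟨h1, rfl⟩ | ⟨h1, h2, h3⟩ | ⟨rfl, h1⟩
    · exact (hold (pair_mem_left h1.1) h1.2.1).elim
    · exact (hold (pair_mem_left h1) (Reversal.not_dropped_of_before hS h1)).elim
    · rw [h1]
      exact ⟨w, hrf, hr'E, .inr ((h.mem_porfBefore_of_porf' hS).2 h2)⟩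
    · rcases h1 with h1 | h1
      · rw [h1]
        exact ⟨z, hrf, hr'E, .inl rfl⟩
      · exact (hold h1.1 h1.2).elim

end State

/-! ### The call tree -/

namespace State

variable {P : Program Tid Loc Val} {nev : Tid × ℕ → Tid × ℕ → Prop} {S S' : State Tid Loc Val}

lemma Inv.child (hS : S.Inv P) (h : S.Child P nev S') : S'.Inv P := by
  rcases h with ⟨t, n, l, m, ht, he, rfl⟩ | ⟨t, n, l, r, r', a, ht, h⟩
  · exact hS.forward (nextThread_candidate ht) he
  · exact hS.reversal (nextThread_candidate ht) rfl h

lemma Inv.mem_calls_iff (hS : S.Inv P) :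
    S' ∈ (S.explore P nev).calls ↔ S.graph.Consistent P ∧ S.Child P nev S' :=
  State.mem_calls_iff hS.exec hS.sorted hS.nodup

lemma callAt_concat (p : List ℕ) (i : ℕ) : S.callAt P nev (p ++ [i]) = some S' ↔
    ∃ S₁, S.callAt P nev p = some S₁ ∧ (S₁.explore P nev).calls[i]? = some S' := by
  induction p generalizing S with
  | nil =>
    simp only [List.nil_append, callAt, Option.some.injEq, exists_eq_left']
    cases (S.explore P nev).calls[i]? <;> simp
  | cons j p ih =>
    simp only [List.cons_append, callAt]
    cases (S.explore P nev).calls[j]? with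
    | none => simp
    | some S₂ => exact ih

end State

section CallTree

variable {P : Program Tid Loc Val} {nev : Tid × ℕ → Tid × ℕ → Prop} {S S' : State Tid Loc Val}
  {p q : List ℕ}

lemma call_concat {i : ℕ} : call P nev (p ++ [i]) = some S' ↔
    ∃ S, call P nev p = some S ∧ (S.explore P nev).calls[i]? = some S' :=
  State.callAt_concat p i

lemma call_nil : call P nev [] = some State.start := rfl

/-- Induction along the recursion: a property of the initial state that passes from a consistent
state to its children holds for all calls. -/
lemma call_induction {motive : List ℕ → State Tid Loc Val → Prop}
    (nil : motive [] State.start)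
    (child : ∀ p i S S', call P nev p = some S → call P nev (p ++ [i]) = some S' → S.Inv P →
      S.graph.Consistent P → S.Child P nev S' → motive p S → motive (p ++ [i]) S')
    (h : call P nev p = some S) : S.Inv P ∧ motive p S := by
  induction p using List.reverseRecOn generalizing S with
  | nil =>
    cases h
    exact ⟨State.inv_start, nil⟩
  | append_singleton p i ih =>
    obtain ⟨S₁, h₁, hi⟩ := call_concat.1 h
    obtain ⟨hinv, hm⟩ := ih h₁
    obtain ⟨hc, hch⟩ := hinv.mem_calls_iff.1 (List.mem_of_getElem? hi)
    exact ⟨hinv.child hch, child p i S₁ S h₁ h hinv hc hch hm⟩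

lemma inv_of_call (h : call P nev p = some S) : S.Inv P :=
  (call_induction (motive := fun _ _ => True) trivial (fun _ _ _ _ _ _ _ _ _ _ => trivial) h).1

end CallTree

/-! ### The depth of the recursion and the size of the stack -/

namespace State

variable {P : Program Tid Loc Val} {nev : Tid × ℕ → Tid × ℕ → Prop} {S S' : State Tid Loc Val}
  {m e w r r' a : Event Tid Loc Val}

/-- The events that cannot be deleted any more: writes that reversed a read, and the events before
them. -/
def fixedSet (S : State Tid Loc Val) : Set (Event Tid Loc Val) :=
  {y | y ∈ S.exe ∧ ∃ w r, S.rf w r ∧ S.Before r w ∧ (y = w ∨ TransGen S.graph.porf y w)}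

lemma finite_fixedSet (S : State Tid Loc Val) : S.fixedSet.Finite :=
  (List.finite_toSet S.exe).subset fun _ h => h.1

lemma fixedSet_addEv : S.fixedSet ⊆ (S.addEv m e).fixedSet := by
  rintro y ⟨hy, w, r, hwr, hrw, h⟩
  refine ⟨List.mem_append_left _ hy, w, r, .inl hwr, before_addEv.2 (.inl hrw), ?_⟩
  rw [graph_addEv]
  exact h.imp_right (transGen_mono (S.graph.sub_add m e).porf _ _)

/-- Since a deleted read may not read from a later deleted write, a reversal deletes no write that
reversed a read, and hence nothing that is before such a write. -/
lemma Reversal.fixedSet_ssubset (hS : S.Inv P) (h : S.Reversal P w r r' a S') :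
    S.fixedSet ⊂ S'.fixedSet := by
  have hrw : S'.Before r' w := (h.before_iff hS).2 (.inr (.inr (.inr ⟨rfl, .inl rfl⟩)))
  have hrf : S'.rf w r' := (h.rf_iff hS).2 (.inr ⟨rfl, rfl⟩)
  have hw : w ∈ S'.fixedSet :=
    ⟨(h.mem_exe hS).2 (.inr (.inl rfl)), w, r', hrf, hrw, .inl rfl⟩
  refine (Set.ssubset_iff_of_subset ?_).2 ⟨w, hw, fun h' => h.write_notMem h'.1⟩
  rintro y ⟨hy, u, c, huc, hcu, hyu⟩
  have hBfix : ∀ y, y ∈ S.exe → y ∈ S.graph.porfBefore w → y ∈ S'.fixedSet := fun y hy hyB =>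
    ⟨(h.mem_exe hS).2 (.inl ⟨hy, h.before_notMem hyB⟩), w, r', hrf, hrw,
      .inr ((h.mem_porfBefore_of_porf' hS).2 hyB)⟩
  by_cases huB : u ∈ S.graph.porfBefore w
  · refine hBfix y hy ?_
    rcases hyu with rfl | hyu
    · exact huB
    · exact Reversal.porfBefore_closed hS h hyu huB
  -- otherwise `u` is executed before `r`
  have huE : u ∈ S.exe := pair_mem_right hcu
  have hur : u ≠ r := fun h' => h.isRead.not_isWrite (h' ▸ hS.exec.rf_write huc)
  have hub : S.Before u r := by
    refine (pair_total huE h.mem hur).resolve_right fun hru => ?_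
    have hud : u ∈ S.dropped w r := .inr ⟨hru, huB⟩
    have hcd : c ∈ S.dropped w r := (h.upClosed hS).closed _ _ (.inr huc) hud
    exact (h.check c hcd).1 u huc ⟨hcu, hud⟩
  have hcr : S.Before c r := pair_trans hS.nodup hcu hub
  have hud : u ∉ S.dropped w r := Reversal.not_dropped_of_before hS hub
  have hcd : c ∉ S.dropped w r := Reversal.not_dropped_of_before hS hcr
  have hyd : y ∉ S.dropped w r := by
    rcases hyu with rfl | hyu
    · exact hud
    · exact fun hyd => hud ((h.upClosed hS).transGen hyu hyd)
  exact ⟨(h.mem_exe hS).2 (.inl ⟨hy, hyd⟩), u, c, (h.rf_iff hS).2 (.inl ⟨huc, hcd⟩),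
    (h.before_iff hS).2 (.inl ⟨hcu, hcd, hud⟩), hyu.imp_right fun hyu => h.porf'_of_porf hS hyu hud⟩

lemma ncard_fixedSet_le (hS : S.Inv P) : S.fixedSet.ncard ≤ S.exe.length := by
  classical
  have h1 : S.fixedSet ⊆ (S.exe.toFinset : Set (Event Tid Loc Val)) := fun y hy => by
    simpa using hy.1
  have h2 := Set.ncard_le_ncard h1 (Finset.finite_toSet _)
  rwa [Set.ncard_coe_finset, List.toFinset_card_of_nodup hS.nodup] at h2

lemma Inv.encard_E (hS : S.Inv P) : S.graph.E.encard = S.exe.length := by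
  classical
  have h1 : S.graph.E = (S.exe.toFinset : Set (Event Tid Loc Val)) := by
    ext
    simp
  rw [h1, Set.encard_coe_eq_coe_finsetCard, List.toFinset_card_of_nodup hS.nodup]

lemma length_le_of_child (hS : S.Inv P) (h : S.Child P nev S') :
    S'.exe.length ≤ S.exe.length + 1 := by
  rcases h with ⟨t, n, l, m, ht, he, rfl⟩ | ⟨t, n, l, r, r', a, ht, h⟩
  · simp [addEv]
  · obtain ⟨A, Y, X, hAY, hAX, hXY, -⟩ := h.exists_split hS
    have := hXY.length_le
    rw [hAY, hAX]
    simp only [List.length_append, List.length_cons, List.length_nil]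
    omega

/-- The number of stored items in terms of the number of events. -/
lemma Inv.size_le (hS : S.Inv P) {k : ℕ} (hk : S.exe.length ≤ k) :
    S.size ≤ ((k ^ 2 + 4 * k : ℕ) : ℕ∞) := by
  classical
  have hE := hS.encard_E
  have hrf : {p : Event Tid Loc Val × Event Tid Loc Val | S.rf p.1 p.2}.encard ≤ S.exe.length := by
    rw [← hE]
    refine Set.encard_le_encard_of_injOn (f := Prod.snd) (fun p hp => hS.exec.rf_mem hp) ?_
    rintro ⟨x, y⟩ hx ⟨x', y'⟩ hx' rfl
    exact Prod.ext (hS.exec.rf_functional hx hx') rfl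
  have hrev : S.rev.encard ≤ S.exe.length := by
    rw [← hE]
    exact Set.encard_le_encard fun r hr => (hS.rev_mem r hr).1
  have hco : {p : Event Tid Loc Val × Event Tid Loc Val | S.co p.1 p.2}.encard ≤
      S.exe.length + S.exe.length * S.exe.length := by
    have hsplit : {p : Event Tid Loc Val × Event Tid Loc Val | S.co p.1 p.2} ⊆
        {p | S.co p.1 p.2 ∧ p.1.IsInit} ∪ S.graph.E ×ˢ S.graph.E := by
      rintro ⟨x, y⟩ hxy
      obtain ⟨hx, hy, -⟩ := hS.exec.co_wf _ _ hxy
      rcases hx with hx | hx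
      · exact .inl ⟨hxy, hx⟩
      · exact .inr ⟨hx, hy.resolve_left (hS.co_init _ _ hxy)⟩
    refine (Set.encard_le_encard hsplit).trans ((Set.encard_union_le _ _).trans ?_)
    rw [Set.encard_prod, hE]
    refine add_le_add_left ?_ _
    rw [← hE]
    refine Set.encard_le_encard_of_injOn (f := Prod.snd)
      (fun p hp => (hS.exec.co_mem hp.1).2.resolve_left (hS.co_init _ _ hp.1)) ?_
    rintro ⟨x, y⟩ ⟨hx, hx1⟩ ⟨x', y'⟩ ⟨hx', hx1'⟩ rfl
    obtain ⟨u, rfl⟩ := Event.isInit_iff.1 hx1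
    obtain ⟨u', rfl⟩ := Event.isInit_iff.1 hx1'
    obtain ⟨-, -, -, -, z, hz, hz'⟩ := hS.exec.co_wf _ _ hx
    obtain ⟨-, -, -, -, z', hz1, hz1'⟩ := hS.exec.co_wf _ _ hx'
    simp only [Event.loc, Option.some.injEq] at hz hz1
    simp only at hz' hz1'
    rw [hz'] at hz1'
    simp only [Option.some.injEq] at hz1'
    rw [hz, hz1, hz1']
  unfold size
  calc _ ≤ (S.exe.length : ℕ∞) + S.exe.length +
        (S.exe.length + S.exe.length * S.exe.length) + S.exe.length := by gcongr
    _ = ((S.exe.length ^ 2 + 4 * S.exe.length : ℕ) : ℕ∞) := by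
      push_cast
      ring
    _ ≤ _ := by
      norm_cast
      gcongr

end State

section Depth

variable {P : Program Tid Loc Val} {nev : Tid × ℕ → Tid × ℕ → Prop} {S S' : State Tid Loc Val}
  {p q : List ℕ} {N : ℕ}

lemma length_exe_le
    (hN : ∀ G : ExecGraph Tid Loc Val, G.IsExecution P → G.Consistent P → G.E.encard ≤ N)
    (hS : S.Inv P) (hc : S.graph.Consistent P) : S.exe.length ≤ N := by
  have := hN _ hS.exec hc
  rw [hS.encard_E] at this
  exact_mod_cast this

/-- Every step adds an event, and a reversal enlarges the set of the events that cannot be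
deleted. -/
lemma depth_le
    (hN : ∀ G : ExecGraph Tid Loc Val, G.IsExecution P → G.Consistent P → G.E.encard ≤ N)
    (h : call P nev p = some S) :
    p.length ≤ (N + 1) * S.fixedSet.ncard + S.exe.length := by
  refine (call_induction (motive := fun p S => p.length ≤ (N + 1) * S.fixedSet.ncard + S.exe.length)
    (by simp) ?_ h).2
  intro p i S S' _ _ hS hc hch ih
  have hlen := length_exe_le hN hS hc
  rw [List.length_append, List.length_singleton]
  rcases hch with ⟨t, n, l, m, ht, he, rfl⟩ | ⟨t, n, l, r, r', a, ht, h⟩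
  · have h1 := Set.ncard_le_ncard (State.fixedSet_addEv (S := S) (m := m) (e := .ev t n l))
      (State.finite_fixedSet _)
    have h2 : (S.addEv m (.ev t n l)).exe.length = S.exe.length + 1 := by simp [State.addEv]
    rw [h2]
    have := Nat.mul_le_mul_left (N + 1) h1
    omega
  · have h1 := Set.ncard_lt_ncard (h.fixedSet_ssubset hS) (State.finite_fixedSet _)
    have := Nat.mul_le_mul_left (N + 1) (Nat.succ_le_of_lt h1)
    rw [Nat.succ_eq_add_one, Nat.mul_add] at this
    omega

/-- The recursion depth, and the number of events of a call. -/
lemma depth_bound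
    (hN : ∀ G : ExecGraph Tid Loc Val, G.IsExecution P → G.Consistent P → G.E.encard ≤ N)
    (h : call P nev p = some S) : p.length ≤ (N + 1) ^ 2 ∧ S.exe.length ≤ N + 1 := by
  refine (call_induction (motive := fun p S => p.length ≤ (N + 1) ^ 2 ∧ S.exe.length ≤ N + 1)
    (by simp [State.start]) ?_ h).2
  intro p i S S' hp _ hS hc hch _
  have h1 := length_exe_le hN hS hc
  have h2 := depth_le hN hp
  have h3 := Nat.mul_le_mul_left (N + 1) ((State.ncard_fixedSet_le hS).trans h1)
  have h4 := State.length_le_of_child hS hch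
  rw [List.length_append, List.length_singleton]
  constructor
  · nlinarith
  · omega

/-- Each argument on the stack has at most `(N + 1)² + 4 (N + 1)` items, and the stack has at most
`(N + 1)² + 1` arguments. -/
lemma stackSize_le
    (hN : ∀ G : ExecGraph Tid Loc Val, G.IsExecution P → G.Consistent P → G.E.encard ≤ N)
    (h : call P nev p = some S) : stackSize P nev p ≤ (N + 3) ^ 4 := by
  have hp := (depth_bound hN h).1
  have hterm : ∀ k ∈ Finset.range (p.length + 1),
      ((call P nev (p.take k)).map State.size).getD 0 ≤
        (((N + 1) ^ 2 + 4 * (N + 1) : ℕ) : ℕ∞) := by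
    intro k _
    cases hk : call P nev (p.take k) with
    | none => simp
    | some S' => exact (inv_of_call hk).size_le (depth_bound hN hk).2
  refine (Finset.sum_le_card_nsmul _ _ _ hterm).trans ?_
  rw [Finset.card_range, nsmul_eq_mul]
  norm_cast
  calc (p.length + 1) * ((N + 1) ^ 2 + 4 * (N + 1))
      ≤ ((N + 1) ^ 2 + 1) * ((N + 1) ^ 2 + 4 * (N + 1)) := by gcongr
    _ ≤ (N + 3) ^ 4 := by nlinarith [Nat.zero_le (N ^ 3), Nat.zero_le (N ^ 2)]

/-- The call tree is finitely branching and of bounded depth. -/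
lemma finite_calls
    (hN : ∀ G : ExecGraph Tid Loc Val, G.IsExecution P → G.Consistent P → G.E.encard ≤ N) :
    {p | call P nev p ≠ none}.Finite := by
  have hlevel : ∀ d, {p | call P nev p ≠ none ∧ p.length = d}.Finite := by
    intro d
    induction d with
    | zero => exact (Set.finite_singleton []).subset fun p hp => List.length_eq_zero_iff.1 hp.2
    | succ d ih =>
      have hfin : (⋃ p ∈ {p | call P nev p ≠ none ∧ p.length = d},
          (fun i => p ++ [i]) '' Set.Iio
            ((call P nev p).elim 0 fun S => (S.explore P nev).calls.length)).Finite :=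
        ih.biUnion fun p _ => (Set.finite_Iio _).image _
      refine hfin.subset ?_
      rintro p ⟨hp, hlen⟩
      obtain ⟨q, i, rfl⟩ : ∃ q i, p = q ++ [i] := by
        rcases List.eq_nil_or_concat p with rfl | ⟨q, i, rfl⟩
        · cases hlen
        · exact ⟨q, i, by simp⟩
      obtain ⟨S', hS'⟩ := Option.ne_none_iff_exists'.1 hp
      obtain ⟨S, hS, hi⟩ := call_concat.1 hS'
      simp only [List.length_append, List.length_singleton, Nat.add_right_cancel_iff] at hlen
      simp only [Set.mem_iUnion]
      refine ⟨q, ⟨by simp [hS], hlen⟩, i, ?_, rfl⟩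
      rw [hS]
      exact (List.getElem?_eq_some_iff.1 hi).1
  refine ((Set.finite_Iic ((N + 1) ^ 2)).biUnion fun d _ => hlevel d).subset fun p hp => ?_
  obtain ⟨S, hS⟩ := Option.ne_none_iff_exists'.1 hp
  simp only [Set.mem_iUnion]
  exact ⟨p.length, (depth_bound hN hS).1, hp, rfl⟩

/-- The graph of a call that outputs it is full. -/
lemma isFull_of_output [Finite Tid] [IsStrictTotalOrder (Tid × ℕ) nev]
    (hp : call P nev p = some S) (h : S.explore P nev = .output) : S.graph.IsFull P := by
  have hS := inv_of_call hp
  have hc : S.graph.Consistent P := State.consistent_of_explore (nev := nev) (by simp [h])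
  have hnone := (State.explore_eq_output_iff hc).1 h
  refine ⟨hS.exec, hc, fun t hh H => ?_⟩
  rw [H.unique (hS.isHistory t)]
  exact State.nextThread_eq_none hnone t

end Depth

/-! ### Different recursive calls of a call have different arguments -/

namespace ExecGraph

variable {P : Program Tid Loc Val} {G : ExecGraph Tid Loc Val}

/-- The place of a new write determines the event after which it has been inserted. -/
lemma insertCo_injective (hG : G.IsExecution P) {a a' w : Event Tid Loc Val} (hw : ¬ G.Mem w)
    (ha : G.Mem a) (ha' : G.Mem a') (h : State.insertCo G.co a w = State.insertCo G.co a' w) :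
    a = a' := by
  have key : ∀ {a a' : Event Tid Loc Val}, G.Mem a →
      State.insertCo G.co a w = State.insertCo G.co a' w → a = a' ∨ G.co a a' := by
    intro a a' ha h
    have h1 : State.insertCo G.co a w a w := .inr (.inl ⟨rfl, .inl rfl⟩)
    rw [h] at h1
    rcases h1 with h1 | ⟨-, h1⟩ | ⟨h1, -⟩
    · exact absurd (hG.co_mem h1).2 hw
    · exact h1
    · exact absurd (h1 ▸ ha) hw
  rcases key ha h with h1 | h1
  · exact h1
  rcases key ha' h.symm with h2 | h2
  · exact h2.symm
  · exact absurd (hG.co_trans _ _ _ h1 h2) (hG.co_irrefl _)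

end ExecGraph

namespace State

variable {P : Program Tid Loc Val} {nev : Tid × ℕ → Tid × ℕ → Prop} {S S' : State Tid Loc Val}

lemma nodup_writes (hnd : S.exe.Nodup) (x : Loc) :
    (S.writes P x).Nodup := by
  classical
  unfold writes
  rw [List.nodup_cons]
  constructor
  · rw [List.mem_filterMap]
    rintro ⟨b, -, hb⟩
    rcases b with _ | ⟨t, n, _ | _ | _⟩ <;> simp only [reduceCtorEq] at hb
    split_ifs at hb
    simp at hb
  · refine hnd.filterMap fun a a' b hb hb' => ?_
    rcases a with _ | ⟨t, n, _ | _ | _⟩ <;> simp only [Option.mem_def, reduceCtorEq] at hb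
    rcases a' with _ | ⟨t', n', _ | _ | _⟩ <;> simp only [Option.mem_def, reduceCtorEq] at hb'
    split_ifs at hb hb'
    simp only [Option.some.injEq] at hb hb'
    rw [← hb] at hb'
    exact (Prod.ext_iff.1 hb').1.symm

lemma Inv.nodup_calls (hS : S.Inv P) : (S.explore P nev).calls.Nodup := by
  classical
  by_cases hc : S.graph.Consistent P
  swap
  · rw [List.eq_nil_iff_forall_not_mem.2 fun S' hS' => hc (consistent_of_mem_calls hS')]
    exact List.nodup_nil
  have hcalls := fun S' => hS.mem_calls_iff (nev := nev) (S' := S')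
  rw [explore_of_consistent hc] at hcalls ⊢
  split
  · exact List.nodup_nil
  rename_i t ht
  split
  · exact List.nodup_nil
  · exact List.nodup_singleton _
  · rename_i x o s hact
    simp only [Outcome.calls]
    refine (nodup_writes hS.nodup x).map_on ?_
    rintro ⟨a, v⟩ ha ⟨a', v'⟩ ha' heq
    have h1 : (S.addRead a' (.ev t (S.hist t).length (.read x v' o s))).rf a
        (.ev t (S.hist t).length (.read x v o s)) := by
      rw [← heq]
      exact .inr ⟨rfl, rfl⟩
    rcases h1 with h1 | ⟨rfl, h1⟩
    · exact absurd ((hS.isHistory t).lt_length (hS.exec.rf_mem h1)) (lt_irrefl _)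
    · cases h1
      rfl
  · rename_i x v o s b hact
    -- the new write is not in the graph, and it has no reader before a reversal
    have hfresh : .ev t (S.hist t).length (.write x v o s b) ∉ S.exe := fun h =>
      lt_irrefl _ ((hS.isHistory t).lt_length h)
    simp only [ht, hact, Outcome.calls, writeCalls] at hcalls ⊢
    generalize hwdef : Event.ev t (S.hist t).length (.write x v o s b) = w at hfresh hcalls ⊢
    have hwM : ¬ S.graph.Mem w := by
      rintro (h | h)
      · rw [← hwdef] at h
        exact h
      · exact hfresh h
    have hplace : ∀ r, r ∈ S.reversals w x → ∀ p ∈ (S.remove (S.deleted w r)).writes P x,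
        ∃ r', S.Reversal P w r r' p.1 ((S.remove (S.deleted w r)).reverse r w p.1 v) ∧
          r' = r.setReadVal v := by
      intro r hr p hp
      have h1 := ((hcalls ((S.remove (S.deleted w r)).reverse r w p.1 v)).1
        (List.mem_append_right _ (List.mem_flatMap.2 ⟨r, hr, List.mem_map.2 ⟨p, hp, rfl⟩⟩))).2
      simp only [reversals, List.mem_filter, decide_eq_true_eq] at hr
      obtain ⟨hr1, hr2, hr3, hr4, hr5, hr6⟩ := hr
      obtain ⟨ha1, ha2⟩ := mem_writes.1 hp
      obtain ⟨tr, n, x', v₀, o', s', rfl⟩ := Event.isRead_iff.1 hr2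
      obtain rfl : x' = x := by simpa [Event.loc] using hr3
      have hfit : S.graph.Fits P (.init x') w := by
        refine ⟨t, _, _, _, hwdef.symm, hS.isHistory t, hact, rfl, fun _ =>
          ⟨.inl trivial, trivial, x', rfl, by rw [← hwdef]; rfl⟩, ?_⟩
        rintro _ _ _ _ ⟨⟩
      refine ⟨_, ⟨⟨_, hfit⟩, hr1, hr4, hr5, hr6, ⟨tr, n, x', v₀, v, o', s', t, _, o, s, b, rfl, rfl,
        hwdef.symm, rfl⟩, ?_, (writes_mem_loc ha2).1, x', (writes_mem_loc ha2).2, ?_⟩, rfl⟩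
      · simpa [ExecGraph.Mem, remove, graph] using ha1
      · rw [← hwdef]
        rfl
    have hreader : ∀ r, r ∈ S.reversals w x → ∀ p ∈ (S.remove (S.deleted w r)).writes P x,
        ∀ c, ((S.remove (S.deleted w r)).reverse r w p.1 v).rf w c ↔ c = r.setReadVal v := by
      intro r hr p hp c
      obtain ⟨r', hrev, hr'⟩ := hplace r hr p hp
      rw [hrev.rf_iff hS, hr']
      constructor
      · rintro (⟨h1, -⟩ | ⟨-, h1⟩)
        · exact absurd (hS.exec.rf_wf _ _ h1).1 hwM
        · exact h1
      · exact fun h => .inr ⟨rfl, h⟩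
    refine List.nodup_append.2 ⟨?_, ?_, ?_⟩
    · refine (nodup_writes hS.nodup x).map_on ?_
      rintro ⟨a, u⟩ ha ⟨a', u'⟩ ha' heq
      rw [mem_writes] at ha ha'
      obtain rfl : a = a' := ExecGraph.insertCo_injective hS.exec hwM ha.1 ha'.1
        (congrArg State.co heq)
      rw [writes_functional ha.2 ha'.2]
    · refine List.nodup_flatMap.2 ⟨fun r hr => ?_, ?_⟩
      · have hnd : ((S.remove (S.deleted w r)).writes P x).Nodup :=
          nodup_writes (hS.nodup.filter _) x
        refine hnd.map_on ?_
        rintro ⟨a, u⟩ ha ⟨a', u'⟩ ha' heq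
        obtain ⟨r', hrev, -⟩ := hplace r hr _ ha
        obtain ⟨r'', hrev', -⟩ := hplace r hr _ ha'
        rw [mem_writes] at ha ha'
        -- both graphs arise from the same graph by inserting `w` into `co`
        have h1 := congrArg State.co heq
        have h2 : (S.remove (S.deleted w r)).co = (S.graph.del (S.dropped w r)).co := by
          funext b c
          refine propext (and_congr_right fun h => ?_)
          have hrr : r.IsRead := hrev.isRead
          have hb : b ≠ r := fun hb => hrr.not_isWrite (hb ▸ (hS.exec.co_wf _ _ h).2.2.1)
          have hc : c ≠ r := fun hb => hrr.not_isWrite (hb ▸ (hS.exec.co_wf _ _ h).2.2.2.1)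
          simp [dropped, hb, hc]
        simp only [reverse, h2] at h1
        obtain rfl : a = a' := ExecGraph.insertCo_injective (hrev.exec_cut hS)
          (hrev.fits_write hS).not_mem hrev.place_mem hrev'.place_mem h1
        rw [writes_functional ha.2 ha'.2]
      · have hnd : (S.reversals w x).Nodup := hS.nodup.filter _
        refine List.Pairwise.imp_of_mem (R := (· ≠ ·)) ?_ hnd
        intro r₁ r₂ hr₁ hr₂ hne
        rw [Function.onFun, List.disjoint_left]
        rintro S' h1 h2
        obtain ⟨p₁, hp₁, rfl⟩ := List.mem_map.1 h1
        obtain ⟨p₂, hp₂, heq⟩ := List.mem_map.1 h2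
        -- the reversed read is the only reader of `w`
        have h3 := (hreader r₁ hr₁ p₁ hp₁ (r₁.setReadVal v)).2 rfl
        rw [← heq] at h3
        have h4 := (hreader r₂ hr₂ p₂ hp₂ _).1 h3
        obtain ⟨_, hrev₁, rfl⟩ := hplace r₁ hr₁ p₁ hp₁
        obtain ⟨_, hrev₂, rfl⟩ := hplace r₂ hr₂ p₂ hp₂
        refine hne (hS.exec.eq_of_pos hrev₁.mem hrev₂.mem ?_)
        rw [← hrev₁.pos_eq, ← hrev₂.pos_eq, h4]
    · intro S₁ h1 S₂ h2 heq
      obtain ⟨p₁, hp₁, rfl⟩ := List.mem_map.1 h1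
      obtain ⟨r, hr, h2⟩ := List.mem_flatMap.1 h2
      obtain ⟨p₂, hp₂, rfl⟩ := List.mem_map.1 h2
      have h3 := (hreader r hr p₂ hp₂ (r.setReadVal v)).2 rfl
      rw [← heq] at h3
      exact hwM (hS.exec.rf_wf _ _ h3).1

end State

/-! ### The way to a given graph -/

namespace ExecGraph

variable {P : Program Tid Loc Val} {G : ExecGraph Tid Loc Val} {m m' e e' w : Event Tid Loc Val}

lemma Fits.mono_of_ne (h : G.Fits P m w) {t t' : Tid} {n n' : ℕ} {l l' : Label Loc Val}
    (hw : w = .ev t n l) (he : e = .ev t' n' l') (hne : t ≠ t') : (G.add m' e).Fits P m w := by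
  obtain ⟨t₁, hh, a, l₁, rfl, H, hnext, hal, hm, hval⟩ := h
  cases hw
  subst he
  exact ⟨_, hh, a, _, rfl, H.add_of_ne hne, hnext, hal,
    fun hf => ⟨mem_add.2 (.inl (hm hf).1), (hm hf).2⟩, hval⟩

/-- A thread whose next action is a write has only one possible next event. -/
lemma Fits.eq_of_isWrite (h : G.Fits P m e) (h' : G.Fits P m' w) (hw : w.IsWrite) {t : Tid}
    {n n' : ℕ} {l l' : Label Loc Val} (he : e = .ev t n l) (hw' : w = .ev t n' l') : e = w := by
  obtain ⟨t₁, hh, a, l₁, rfl, H, hnext, hal, -⟩ := h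
  obtain ⟨t₂, hh', a', l₂, rfl, H', hnext', hal', -⟩ := h'
  cases he
  cases hw'
  obtain rfl := H.unique H'
  rw [hnext] at hnext'
  cases hnext'
  rcases a with _ | _ | _
  · obtain ⟨_, rfl⟩ := hal'
    exact hw.elim
  · cases hal
    cases hal'
    rfl
  · cases hal'
    exact hw.elim

lemma IsMax.eq (hG : G.IsExecution P) (h : G.IsMax m) (h' : G.IsMax m') (hm : G.Mem m)
    (hm' : G.Mem m') (hw : m.IsWrite) (hw' : m'.IsWrite) (hl : m.SameLoc m') : m = m' := by
  by_contra hne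
  rcases hG.co_total m m' hm hm' hw hw' hl hne with hc | hc
  · exact h _ hc
  · exact h' _ hc

/-- There is only one way to add the next event of a thread in a maximal way. -/
lemma Fits.add_eq_of_isMax (hG : G.IsExecution P) (h : G.Fits P m e) (h' : G.Fits P m' e')
    (hmax : ¬ e.IsFence → G.IsMax m) (hmax' : ¬ e'.IsFence → G.IsMax m') (hp : e.pos = e'.pos) :
    e = e' ∧ G.add m e = G.add m' e' := by
  obtain ⟨t₁, hh, a, l₁, rfl, H, hnext, hal, hm, hval⟩ := h
  obtain ⟨t₂, hh', a', l₂, rfl, H', hnext', hal', hm', hval'⟩ := h'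
  simp only [Event.pos, Option.some.injEq, Prod.mk.injEq] at hp
  obtain ⟨rfl, -⟩ := hp
  obtain rfl := H.unique H'
  rw [hnext] at hnext'
  cases hnext'
  rcases a with ⟨x, o, s⟩ | ⟨x, v, o, s, b⟩ | ⟨o, s⟩
  · obtain ⟨v, rfl⟩ := hal
    obtain ⟨v', rfl⟩ := hal'
    obtain ⟨h1, h2, h3⟩ := hm id
    obtain ⟨h1', h2', h3'⟩ := hm' id
    have h4 : (Event.ev t₁ hh.length (Label.read x v o s)).SameLoc
        (.ev t₁ hh.length (.read x v' o s)) := ⟨x, rfl, rfl⟩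
    obtain rfl := IsMax.eq hG (hmax id) (hmax' id) h1 h1' h2 h2' ((h3.trans h4).trans h3'.symm)
    obtain rfl := State.writes_functional (hval _ _ _ _ rfl) (hval' _ _ _ _ rfl)
    exact ⟨rfl, rfl⟩
  · cases hal
    cases hal'
    obtain ⟨h1, h2, h3⟩ := hm id
    obtain ⟨h1', h2', h3'⟩ := hm' id
    obtain rfl := IsMax.eq hG (hmax id) (hmax' id) h1 h1' h2 h2' (h3.trans h3'.symm)
    exact ⟨rfl, rfl⟩
  · cases hal
    cases hal'
    have h1 : ¬ (Event.ev t₁ hh.length (Label.fence o s) : Event Tid Loc Val).IsRead := id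
    have h2 : ¬ (Event.ev t₁ hh.length (Label.fence o s) : Event Tid Loc Val).IsWrite := id
    simp [ExecGraph.add, h1, h2]

end ExecGraph

/-- What the exploration has to build next on its way to a given graph: the graph `H`, called the
guide, that the current state has to become a part of; the write that is awaited next, if a read
has been postponed, with the position of the read that it will reverse; and the positions of all
reads that have been postponed. -/
structure Guide (Tid Loc Val : Type*) where
  H : ExecGraph Tid Loc Val
  target : Option (Event Tid Loc Val × (Tid × ℕ))
  postponed : Set (Tid × ℕ)

namespace Guide

/-- The positions of the events in a list. -/
def posSet (A : List (Event Tid Loc Val)) : Set (Tid × ℕ) := {q | ∃ b ∈ A, b.pos = some q}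

lemma posSet_concat {A : List (Event Tid Loc Val)} {e : Event Tid Loc Val} {p : Tid × ℕ}
    (he : e.pos = some p) : posSet (A ++ [e]) = insert p (posSet A) := by
  ext q
  simp only [posSet, List.mem_append, List.mem_singleton, Set.mem_ofPred_eq, Set.mem_insert_iff]
  constructor
  · rintro ⟨b, hb | rfl, hq⟩
    · exact .inr ⟨b, hb, hq⟩
    · rw [he] at hq
      cases hq
      exact .inl rfl
  · rintro (rfl | ⟨b, hb, hq⟩)
    · exact ⟨e, .inr rfl, he⟩
    · exact ⟨b, .inl hb, hq⟩

/-- The events of `H` that are neither in `A` nor before `w`. -/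
def rest (H : ExecGraph Tid Loc Val) (A : List (Event Tid Loc Val)) (w : Event Tid Loc Val) :
    Set (Event Tid Loc Val) := {x | x ∈ H.E ∧ x ∉ A ∧ ¬ TransGen H.porf x w}

variable {P : Program Tid Loc Val} {G : ExecGraph Tid Loc Val}
  {Q : Set (Tid × ℕ) → Guide Tid Loc Val → Prop} {A : List (Event Tid Loc Val)} {p : Tid × ℕ}
  {c c' c₁ c₂ : Guide Tid Loc Val} {e f w : Event Tid Loc Val}
  {rf rf' : Event Tid Loc Val → Event Tid Loc Val → Prop}

/-- A read whose source in the guide has not been executed yet is postponed: until this source `w`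
has been executed, the exploration has to follow a guide that consists of the events `A` executed so
far, of the events before `w`, and of the read, which reads from a `co`-maximal write for the time
being. The predicate `Q` collects properties of the new guide. -/
def Postpone (P : Program Tid Loc Val) (Q : Set (Tid × ℕ) → Guide Tid Loc Val → Prop)
    (A : List (Event Tid Loc Val)) (p : Tid × ℕ) (c c' : Guide Tid Loc Val) : Prop :=
  c.H.IsExecution P ∧ (∀ a b, c.H.porf a b → b ∈ A → a ∈ A ∨ a.IsInit) ∧
  ∃ f w m e, f ∈ c.H.E ∧ f.pos = some p ∧ f ∉ A ∧ c.H.rf w f ∧ w ∈ c.H.E ∧ w ∉ A ∧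
    e.pos = some p ∧ e.IsRead ∧ (c.H.del (rest c.H A w)).Fits P m e ∧
    (c.H.del (rest c.H A w)).IsMax m ∧
    c' = ⟨(c.H.del (rest c.H A w)).add m e, some (w, p), insert p c.postponed⟩ ∧
    Q (insert p (posSet A)) c'

/-- While a write is awaited, the exploration may execute an event that is not in the guide, if it
does so in a maximal way. Such an event will be deleted. -/
def Extend (P : Program Tid Loc Val) (Q : Set (Tid × ℕ) → Guide Tid Loc Val → Prop)
    (A : List (Event Tid Loc Val)) (p : Tid × ℕ) (c c' : Guide Tid Loc Val) : Prop :=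
  (∀ f ∈ c.H.E, f.pos ≠ some p) ∧ ∃ w q m e, c.target = some (w, q) ∧ e ≠ w ∧ e.pos = some p ∧
    c.H.Fits P m e ∧ (¬ e.IsFence → c.H.IsMax m) ∧
    c' = ⟨c.H.add m e, c.target, c.postponed⟩ ∧ Q (insert p (posSet A)) c'

/-- The guide is extended by an event at the position `p` unless it has one. -/
def Start (P : Program Tid Loc Val) (Q : Set (Tid × ℕ) → Guide Tid Loc Val → Prop)
    (A : List (Event Tid Loc Val)) (p : Tid × ℕ) (c c' : Guide Tid Loc Val) : Prop :=
  (c' = c ∧ ∃ f ∈ c.H.E, f.pos = some p) ∨ Extend P Q A p c c'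

/-- All the changes of the guide when the event at the position `p` is executed. -/
def Settle (P : Program Tid Loc Val) (Q : Set (Tid × ℕ) → Guide Tid Loc Val → Prop)
    (A : List (Event Tid Loc Val)) (p : Tid × ℕ) (c c' : Guide Tid Loc Val) : Prop :=
  ∃ c₁, Start P Q A p c c₁ ∧ ReflTransGen (Postpone P Q A p) c₁ c'

/-- The guide has the event `e`, with the incoming `rf` edges given by `rf`. -/
def Agrees (rf : Event Tid Loc Val → Event Tid Loc Val → Prop) (e : Event Tid Loc Val)
    (c : Guide Tid Loc Val) : Prop := e ∈ c.H.E ∧ ∀ x, rf x e ↔ c.H.rf x e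

/-- The events in the list have been executed one after the other on the way to `G`, which led to
the guide. -/
inductive Run (P : Program Tid Loc Val) (G : ExecGraph Tid Loc Val)
    (Q : Set (Tid × ℕ) → Guide Tid Loc Val → Prop)
    (rf : Event Tid Loc Val → Event Tid Loc Val → Prop) :
    List (Event Tid Loc Val) → Guide Tid Loc Val → Prop
  | nil : Run P G Q rf [] ⟨G, none, ∅⟩
  | snoc {A : List (Event Tid Loc Val)} {c c' : Guide Tid Loc Val} {p : Tid × ℕ}
      {e : Event Tid Loc Val} (h : Run P G Q rf A c) (hs : Settle P Q A p c c')
      (hp : e.pos = some p) (hA : ∀ b ∈ A, b.pos ≠ some p) (ha : Agrees rf e c') :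
      Run P G Q rf (A ++ [e]) c'

/-! ### Invariants of guides -/

/-- The invariants of a guide when the events in `A` have been executed and the positions in `T`
have been visited. -/
structure Valid (P : Program Tid Loc Val) (G : ExecGraph Tid Loc Val)
    (A : List (Event Tid Loc Val)) (T : Set (Tid × ℕ)) (c : Guide Tid Loc Val) : Prop where
  exec : c.H.IsExecution P
  acyclic : c.H.PoRfAcyclic
  finite : c.H.E.Finite
  sub : ∀ a ∈ A, a ∈ c.H.E
  of_none : c.target = none → c.H = G ∧ c.postponed = ∅
  target_fits : ∀ w q, c.target = some (w, q) → w.IsWrite ∧ ∃ m, c.H.Fits P m w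
  /-- Nothing that is still to be executed depends on a postponed read. -/
  loose : ∀ r ∈ c.H.E, ∀ q ∈ c.postponed, r.pos = some q → ∀ x ∈ c.H.E,
    (∀ q', x.pos = some q' → q' ∉ T) → ¬ TransGen c.H.porf r x
  postponed_sub : c.postponed ⊆ T

section Rest

variable {H : ExecGraph Tid Loc Val}

lemma upClosed_rest (hH : H.IsExecution P) (hA : ∀ a b, H.porf a b → b ∈ A → a ∈ A ∨ a.IsInit) :
    H.UpClosed (rest H A w) := by
  refine ⟨fun x hx => hx.1, fun x y hxy hx => ⟨hH.porf_mem_right hxy, fun hy => ?_, fun hy => ?_⟩⟩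
  · rcases hA x y hxy hy with h | h
    · exact hx.2.1 h
    · exact hH.not_isInit hx.1 h
  · exact hx.2.2 (.head hxy hy)

lemma mem_rest_of_rf (hH : H.IsExecution P) (hac : H.PoRfAcyclic) (hf : f ∉ A) (h : H.rf w f) :
    f ∈ rest H A w :=
  ⟨hH.rf_mem h, hf, fun h' => hac w (.head (.inr h) h')⟩

lemma target_mem_rest (hac : H.PoRfAcyclic) (hwE : w ∈ H.E) (hw : w ∉ A) : w ∈ rest H A w :=
  ⟨hwE, hw, hac w⟩

/-- An event not in `A` is the next event of its thread when only `A` and what is before the event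
is left. -/
lemma fits_target (hH : H.IsExecution P) (hac : H.PoRfAcyclic)
    (hA : ∀ a b, H.porf a b → b ∈ A → a ∈ A ∨ a.IsInit) (hwE : w ∈ H.E) (hw : w ∉ A)
    (hww : w.IsWrite) : ∃ m, (H.del (rest H A w)).Fits P m w := by
  obtain ⟨t, n, l, rfl⟩ := hH.exists_pos hwE
  rcases l with _ | ⟨x, v, o, s, b⟩ | _
  · exact hww.elim
  · obtain ⟨h, Hh, hnext⟩ := hH.history t
    obtain ⟨a, ha, hal⟩ := hnext _ _ ((Hh _ _).1 hwE)
    have hlen : (h.take n).length = n := by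
      rw [List.length_take, min_eq_left (Hh.lt_length hwE).le]
    refine ⟨.init x, t, h.take n, a, _, by rw [hlen], ?_, ha, hal,
      fun _ => ⟨.inl trivial, trivial, x, rfl, rfl⟩, ?_⟩
    · refine ExecGraph.isHistory_del_of_first (upClosed_rest hH hA) Hh
        (target_mem_rest hac hwE hw) fun m l' hm hd => ?_
      exact hd.2.2 (.single (.inl ⟨.inr hd.1, .inr hwE, rfl, hm⟩))
    · rintro _ _ _ _ ⟨⟩
  · exact hww.elim

end Rest

namespace Valid

variable {T : Set (Tid × ℕ)}

lemma mono (h : Valid P G A T c) {T' : Set (Tid × ℕ)} (hT : T ⊆ T') : Valid P G A T' c :=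
  { h with
    loose := fun r hr q hq hrq x hx hxT => h.loose r hr q hq hrq x hx fun q' hq' hT' =>
      hxT q' hq' (hT hT')
    postponed_sub := h.postponed_sub.trans hT }

lemma snoc (h : Valid P G A T c) (he : e ∈ c.H.E) : Valid P G (A ++ [e]) T c :=
  { h with
    sub := fun a ha => by
      rcases List.mem_append.1 ha with ha | ha
      · exact h.sub a ha
      · exact List.mem_singleton.1 ha ▸ he }

lemma extend (h : Valid P G A T c) (hx : Extend P Q A p c c') : Valid P G A (insert p T) c' := by
  obtain ⟨hno, w, q, m, e, htgt, hew, hep, hfit, hmax, rfl, -⟩ := hx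
  refine ⟨h.exec.add hfit, h.acyclic.add h.exec hfit, h.finite.insert _,
    fun a ha => .inr (h.sub a ha), fun h' => ?_, ?_, ?_,
    h.postponed_sub.trans (Set.subset_insert _ _)⟩
  · rw [htgt] at h'
    cases h'
  · intro w' q' hw'
    rw [htgt] at hw'
    cases hw'
    obtain ⟨hw, m', hm'⟩ := h.target_fits _ _ htgt
    refine ⟨hw, m', ?_⟩
    obtain ⟨t, hh, a, l, heq, -⟩ := id hfit
    obtain ⟨t', hh', a', l', heq', -⟩ := id hm'
    refine hm'.mono_of_ne heq' heq ?_
    rintro rfl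
    exact hew (hfit.eq_of_isWrite hm' hw heq heq')
  · intro r hr q' hq' hrq x hx hxT hrx
    have hxe : x ≠ e := by
      rintro rfl
      exact hxT p hep (Set.mem_insert _ _)
    obtain ⟨h1, h2⟩ := ExecGraph.transGen_porf_add h.exec hfit hrx
    exact h.loose r (hr.resolve_left h1) q' hq' hrq x (hx.resolve_left hxe)
      (fun q₁ h3 h4 => hxT q₁ h3 (Set.mem_insert_of_mem _ h4)) (h2 hxe)

lemma postpone (h : Valid P G A T c) (hpT : p ∈ T) (hx : Postpone P Q A p c c') :
    Valid P G A T c' := by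
  obtain ⟨-, hA, f, w, m, e, hf, hfp, hfA, hwf, hw, hwA, hep, her, hfit, hmax, rfl, -⟩ := hx
  have hup := upClosed_rest (w := w) h.exec hA
  have hK := h.exec.del hup
  refine ⟨hK.add hfit, (h.acyclic.del h.exec hup).add hK hfit,
    (h.finite.subset Set.sdiff_subset).insert _,
    fun a ha => .inr ⟨h.sub a ha, fun h' => h'.2.1 ha⟩, (by rintro ⟨⟩), ?_, ?_, ?_⟩
  · rintro w' q' ⟨⟩
    have hww := h.exec.rf_write hwf
    obtain ⟨m', hm'⟩ := fits_target h.exec h.acyclic hA hw hwA hww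
    refine ⟨hww, m', ?_⟩
    obtain ⟨t, hh, a, l, heq, H, -⟩ := id hfit
    obtain ⟨t', hh', a', l', heq', H', -⟩ := id hm'
    refine hm'.mono_of_ne heq' heq ?_
    rintro rfl
    -- otherwise the read and the write would be at the same position
    obtain rfl := H.unique H'
    have : f = w := h.exec.eq_of_pos hf hw (by rw [hfp, ← hep, heq, heq']; rfl)
    exact (h.exec.rf_read hwf).not_isWrite (this ▸ hww)
  · intro r hr q' hq' hrq x hx hxT hrx
    have hxe : x ≠ e := by
      rintro rfl
      exact hxT p hep hpT
    obtain ⟨h1, h2⟩ := ExecGraph.transGen_porf_add hK hfit hrx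
    have h3 := (ExecGraph.transGen_porf_del h.exec hup).1 (h2 hxe)
    have hrK := hr.resolve_left h1
    rcases hq' with rfl | hq'
    · exact hfit.pos_ne hrK (hrq.trans hep.symm)
    · exact h.loose r hrK.1 q' hq' hrq x (hx.resolve_left hxe).1 hxT h3.1
  · exact Set.insert_subset hpT h.postponed_sub

lemma start (h : Valid P G A T c) (hx : Start P Q A p c c') : Valid P G A (insert p T) c' := by
  rcases hx with ⟨rfl, -⟩ | hx
  · exact h.mono (Set.subset_insert _ _)
  · exact h.extend hx

lemma chain (h : Valid P G A T c) (hpT : p ∈ T) (hx : ReflTransGen (Postpone P Q A p) c c') :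
    Valid P G A T c' := by
  induction hx with
  | refl => exact h
  | tail _ h1 ih => exact ih.postpone hpT h1

lemma settle (h : Valid P G A T c) (hx : Settle P Q A p c c') : Valid P G A (insert p T) c' := by
  obtain ⟨c₁, h1, h2⟩ := hx
  exact (h.start h1).chain (Set.mem_insert _ _) h2

end Valid

/-- Postponing a read does not change the incoming `rf` edges of events executed before. -/
lemma Postpone.rf_iff (h : Postpone P Q A p c c') {a x : Event Tid Loc Val} (ha : a ∈ A)
    (hp : ∀ b ∈ A, b.pos ≠ some p) : c'.H.rf x a ↔ c.H.rf x a := by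
  obtain ⟨hE, hA, f, w, m, e, hf, hfp, hfA, hwf, hw, hwA, hep, her, hfit, hmax, rfl, -⟩ := h
  have hup := upClosed_rest (w := w) hE hA
  have hae : a ≠ e := fun h => hp a ha (h ▸ hep)
  simp only [ExecGraph.add, ExecGraph.del, hae, and_false, or_false]
  have ha' : a ∉ rest c.H A w := fun h => h.2.1 ha
  exact ⟨fun h => h.1, fun h => ⟨h, fun hx => ha' (hup.closed _ _ (.inr h) hx), ha'⟩⟩

lemma Extend.rf_iff (h : Extend P Q A p c c') {a x : Event Tid Loc Val}
    (ha : a.pos ≠ some p) : c'.H.rf x a ↔ c.H.rf x a := by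
  obtain ⟨hno, w, q, m, e, htgt, hew, hep, hfit, hmax, rfl, -⟩ := h
  have hae : a ≠ e := fun h => ha (h ▸ hep)
  simp [ExecGraph.add, hae]

lemma Start.rf_iff (h : Start P Q A p c c') {a x : Event Tid Loc Val}
    (ha : a.pos ≠ some p) : c'.H.rf x a ↔ c.H.rf x a := by
  rcases h with ⟨rfl, -⟩ | h
  · rfl
  · exact h.rf_iff ha

lemma chain_rf_iff (h : ReflTransGen (Postpone P Q A p) c c') {a x : Event Tid Loc Val}
    (ha : a ∈ A) (hp : ∀ b ∈ A, b.pos ≠ some p) : c'.H.rf x a ↔ c.H.rf x a := by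
  induction h with
  | refl => rfl
  | tail _ h1 ih => exact (h1.rf_iff ha hp).trans ih

lemma Settle.rf_iff (h : Settle P Q A p c c') {a x : Event Tid Loc Val} (ha : a ∈ A)
    (hp : ∀ b ∈ A, b.pos ≠ some p) : c'.H.rf x a ↔ c.H.rf x a := by
  obtain ⟨c₁, h1, h2⟩ := h
  exact (chain_rf_iff h2 ha hp).trans (h1.rf_iff (hp a ha))

lemma Run.valid (hG : G.IsExecution P) (hac : G.PoRfAcyclic) (hfin : G.E.Finite)
    (h : Run P G Q rf A c) : Valid P G A (posSet A) c ∧ ∀ a ∈ A, Agrees rf a c := by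
  induction h with
  | nil =>
    exact ⟨⟨hG, hac, hfin, by simp, fun _ => ⟨rfl, rfl⟩, (by rintro _ _ ⟨⟩),
      fun _ _ _ h => h.elim, Set.empty_subset _⟩, by simp⟩
  | snoc h hs hp hA ha ih =>
    refine ⟨?_, fun a ha' => ?_⟩
    · rw [posSet_concat hp]
      exact (ih.1.settle hs).snoc ha.1
    · rcases List.mem_append.1 ha' with ha' | ha'
      · exact ⟨(ih.1.settle hs).sub a ha',
          fun x => ((ih.2 a ha').2 x).trans (hs.rf_iff ha' hA).symm⟩
      · exact List.mem_singleton.1 ha' ▸ ha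

lemma Run.congr (h : Run P G Q rf A c) (hrf : ∀ a ∈ A, ∀ x, rf x a ↔ rf' x a) :
    Run P G Q rf' A c := by
  induction h with
  | nil => exact .nil
  | snoc h hs hp hA ha ih =>
    refine .snoc (ih fun a ha' => hrf a (List.mem_append_left _ ha')) hs hp hA ⟨ha.1, fun x => ?_⟩
    rw [← hrf _ (by simp), ha.2]

/-! ### The guide is determined by the executed events -/

lemma Extend.unique (hE : c.H.IsExecution P) (h : Extend P Q A p c c₁) (h' : Extend P Q A p c c₂) :
    c₁ = c₂ := by
  obtain ⟨-, w, q, m, e, h1, h2, h3, h4, h5, rfl, -⟩ := h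
  obtain ⟨-, w', q', m', e', h1', h2', h3', h4', h5', rfl, -⟩ := h'
  rw [(h4.add_eq_of_isMax hE h4' h5 h5' (h3.trans h3'.symm)).2]

lemma Start.unique (hE : c.H.IsExecution P) (h : Start P Q A p c c₁) (h' : Start P Q A p c c₂) :
    c₁ = c₂ := by
  rcases h with ⟨rfl, f, hf, hfp⟩ | h <;> rcases h' with ⟨rfl, f', hf', hfp'⟩ | h'
  · rfl
  · exact absurd hfp (h'.1 f hf)
  · exact absurd hfp' (h.1 f' hf')
  · exact h.unique hE h'

lemma Postpone.unique (h : Postpone P Q A p c c₁) (h' : Postpone P Q A p c c₂) : c₁ = c₂ := by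
  obtain ⟨hE, hA, f, w, m, e, h1, h2, h3, h4, h5, h6, h7, h8, h9, h10, rfl, -⟩ := h
  obtain ⟨-, -, f', w', m', e', h1', h2', h3', h4', h5', h6', h7', h8', h9', h10', rfl, -⟩ := h'
  obtain rfl := hE.eq_of_pos h1 h1' (h2.trans h2'.symm)
  obtain rfl := hE.rf_functional h4 h4'
  rw [(h9.add_eq_of_isMax (hE.del (upClosed_rest hE hA)) h9' (fun _ => h10) (fun _ => h10')
    (h7.trans h7'.symm)).2]

lemma Postpone.mem (h : Postpone P Q A p c c') {x : Event Tid Loc Val} (hx : x ∈ c'.H.E) :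
    x ∈ c.H.E ∨ x.pos = some p := by
  obtain ⟨hE, hA, f, w, m, e, h1, h2, h3, h4, h5, h6, h7, h8, h9, h10, rfl, -⟩ := h
  rcases hx with rfl | hx
  · exact .inr h7
  · exact .inl hx.1

lemma chain_mem (h : ReflTransGen (Postpone P Q A p) c c') {x : Event Tid Loc Val}
    (hx : x ∈ c'.H.E) : x ∈ c.H.E ∨ x.pos = some p := by
  induction h with
  | refl => exact .inl hx
  | tail _ h1 ih => exact (h1.mem hx).elim ih .inr

/-- Once a read has been postponed, its former source is not in the guide any more. -/
lemma chain_source_notMem (hac : c.H.PoRfAcyclic) (h : Postpone P Q A p c c₁)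
    (h' : ReflTransGen (Postpone P Q A p) c₁ c') (hf : f ∈ c.H.E) (hfp : f.pos = some p)
    (hwf : c.H.rf w f) : w ∉ c'.H.E ∧ w ∉ A ∧ ¬ w.IsInit := by
  obtain ⟨hE, hA, f', w', m, e, h1, h2, h3, h4, h5, h6, h7, h8, h9, h10, rfl, -⟩ := h
  obtain rfl := hE.eq_of_pos hf h1 (hfp.trans h2.symm)
  obtain rfl := hE.rf_functional hwf h4
  refine ⟨fun hw => ?_, h6, hE.not_isInit h5⟩
  have hwp : w.pos ≠ some p := fun hp =>
    (hE.rf_read hwf).not_isWrite (hE.eq_of_pos h5 hf (hp.trans hfp.symm) ▸ hE.rf_write hwf)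
  rcases (chain_mem h' hw).resolve_right hwp with rfl | hw'
  · exact hwp h7
  · exact hw'.2 (target_mem_rest hac h5 h6)

/-- A read is not postponed further once its source is the right one. -/
lemma chain_unique (hac₁ : c₁.H.PoRfAcyclic) (hac₂ : c₂.H.PoRfAcyclic)
    (h₁ : ReflTransGen (Postpone P Q A p) c c₁)
    (h₂ : ReflTransGen (Postpone P Q A p) c c₂) {e₁ e₂ : Event Tid Loc Val}
    (hp₁ : e₁.pos = some p) (hp₂ : e₂.pos = some p) (he₁ : e₁ ∈ c₁.H.E) (he₂ : e₂ ∈ c₂.H.E)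
    (hs₁ : ∀ w, c₁.H.rf w e₁ → w ∈ A ∨ w.IsInit ∨ w ∈ c₂.H.E)
    (hs₂ : ∀ w, c₂.H.rf w e₂ → w ∈ A ∨ w.IsInit ∨ w ∈ c₁.H.E) : c₁ = c₂ := by
  have key : ∀ {c₁ c₂ : Guide Tid Loc Val} {e₁ : Event Tid Loc Val}, c₁.H.PoRfAcyclic →
      ReflTransGen (Postpone P Q A p) c₁ c₂ → e₁.pos = some p → e₁ ∈ c₁.H.E →
      (∀ w, c₁.H.rf w e₁ → w ∈ A ∨ w.IsInit ∨ w ∈ c₂.H.E) → c₁ = c₂ := by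
    intro c₁ c₂ e₁ hac h hp he hs
    rcases ReflTransGen.cases_head h with rfl | ⟨c₃, h3, h4⟩
    · rfl
    · exfalso
      obtain ⟨hE, -, f, w, -, -, h5, h6, -, h7, -⟩ := id h3
      obtain rfl := hE.eq_of_pos he h5 (hp.trans h6.symm)
      obtain ⟨h8, h9, h10⟩ := chain_source_notMem hac h3 h4 he hp h7
      rcases hs w h7 with h | h | h
      · exact h9 h
      · exact h10 h
      · exact h8 h
  rcases ReflTransGen.total_of_right_unique (fun _ _ _ h h' => h.unique h') h₁ h₂ with h | h
  · exact key hac₁ h hp₁ he₁ hs₁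
  · exact (key hac₂ h hp₂ he₂ hs₂).symm

lemma Run.eq_of_nil (h : Run P G Q rf [] c) : c = ⟨G, none, ∅⟩ := by
  generalize hB : ([] : List (Event Tid Loc Val)) = B at h
  cases h with
  | nil => rfl
  | snoc => simp at hB

lemma Run.exists_of_concat (h : Run P G Q rf (A ++ [e]) c') : ∃ c p, Run P G Q rf A c ∧
    Settle P Q A p c c' ∧ e.pos = some p ∧ (∀ b ∈ A, b.pos ≠ some p) ∧ Agrees rf e c' := by
  generalize hB : A ++ [e] = B at h
  cases h with
  | nil => simp at hB
  | snoc h hs hp hA ha =>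
    obtain ⟨rfl, heq⟩ := List.append_inj' hB rfl
    cases heq
    exact ⟨_, _, h, hs, hp, hA, ha⟩

lemma Settle.unique (hv : Valid P G A (posSet A) c) (hs : Settle P Q A p c c₁)
    (hs' : Settle P Q A p c c₂) (hp : e.pos = some p) (ha : Agrees rf e c₁)
    (ha' : Agrees rf e c₂) : c₁ = c₂ := by
  have hv₁ := hv.settle hs
  have hv₂ := hv.settle hs'
  obtain ⟨d, hd, hs⟩ := hs
  obtain ⟨d', hd', hs'⟩ := hs'
  obtain rfl := hd.unique hv.exec hd'
  refine chain_unique hv₁.acyclic hv₂.acyclic hs hs' hp hp ha.1 ha'.1 (fun w hw => ?_)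
    fun w hw => ?_
  · exact .inr (hv₂.exec.rf_wf _ _ ((ha'.2 w).1 ((ha.2 w).2 hw))).1
  · exact .inr (hv₁.exec.rf_wf _ _ ((ha.2 w).1 ((ha'.2 w).2 hw))).1

lemma Run.unique (hG : G.IsExecution P) (hac : G.PoRfAcyclic) (hfin : G.E.Finite)
    (h₁ : Run P G Q rf A c₁) (h₂ : Run P G Q rf A c₂) : c₁ = c₂ := by
  induction A using List.reverseRecOn generalizing c₁ c₂ with
  | nil => rw [h₁.eq_of_nil, h₂.eq_of_nil]
  | append_singleton A e ih =>
    obtain ⟨c, p, h, hs, hp, -, ha⟩ := h₁.exists_of_concat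
    obtain ⟨c', p', h', hs', hp', -, ha'⟩ := h₂.exists_of_concat
    obtain rfl := ih h h'
    rw [hp] at hp'
    cases hp'
    exact hs.unique (h.valid hG hac hfin).1 hs' hp ha ha'

end Guide

/-! ### Removing and adding events -/

namespace ExecGraph

variable {P : Program Tid Loc Val} {G : ExecGraph Tid Loc Val} {m e y : Event Tid Loc Val}
  {D Z : Set (Event Tid Loc Val)}

lemma del_del (G : ExecGraph Tid Loc Val) (D D' : Set (Event Tid Loc Val)) :
    (G.del D).del D' = G.del (D ∪ D') := by
  ext a b
  · simp only [del, Set.mem_sdiff, Set.mem_union, not_or, and_assoc]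
  · simp only [del, Set.mem_union, not_or]
    tauto
  · simp only [del, Set.mem_union, not_or]
    tauto

lemma UpClosed.add (hZ : G.UpClosed Z) (hG : G.IsExecution P) (he : G.Fits P m e) :
    (G.add m e).UpClosed (insert e Z) := by
  refine ⟨Set.insert_subset_insert hZ.subset, fun a b hab ha => ?_⟩
  obtain ⟨h1, h2⟩ := porf_add hG he hab
  by_cases hb : b = e
  · exact .inl hb
  · exact .inr (hZ.closed a b (h2 hb) (ha.resolve_left h1))

lemma add_del (hG : G.IsExecution P) (he : G.Fits P m e) :
    (G.add m e).del (insert e Z) = G.del Z := by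
  have hne : ∀ {a}, G.Mem a → a ≠ e := fun h h' => he.not_mem (h' ▸ h)
  ext a b
  · simp only [add, del, Set.mem_sdiff, Set.mem_insert_iff, not_or]
    constructor
    · rintro ⟨h1 | h1, h2, h3⟩
      · exact absurd h1 h2
      · exact ⟨h1, h3⟩
    · exact fun h => ⟨.inr h.1, hne (mem_of_mem h.1), h.2⟩
  · simp only [add, del, Set.mem_insert_iff, not_or]
    constructor
    · rintro ⟨h1 | h1, h2, h3⟩
      · exact ⟨h1, h2.2, h3.2⟩
      · exact absurd h1.2.2 h3.1
    · rintro ⟨h1, h2, h3⟩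
      have := hG.rf_wf _ _ h1
      exact ⟨.inl h1, ⟨hne this.1, h2⟩, hne this.2.1, h3⟩
  · simp only [add, del, Set.mem_insert_iff, not_or]
    constructor
    · rintro ⟨h1 | ⟨-, h1 | h1⟩, h2, h3⟩
      · exact ⟨h1, h2.2, h3.2⟩
      · exact absurd h1.1 h3.1
      · exact absurd h1.1 h2.1
    · rintro ⟨h1, h2, h3⟩
      have := hG.co_mem h1
      exact ⟨.inl h1, ⟨hne this.1, h2⟩, hne this.2, h3⟩

lemma exists_max_of_nonempty (hG : G.IsExecution P) {W : Set (Event Tid Loc Val)}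
    (hW : W.Finite) (hne : W.Nonempty) : ∃ m ∈ W, ∀ b ∈ W, ¬ G.co m b := by
  let R : Event Tid Loc Val → Event Tid Loc Val → Prop := fun a b => G.co b a
  have : IsStrictOrder (Event Tid Loc Val) R :=
    { irrefl := fun a => hG.co_irrefl a
      trans := fun a b c h h' => hG.co_trans c b a h' h }
  obtain ⟨m₀, hm₀⟩ := hne
  obtain ⟨⟨m, hm⟩, -, hmax⟩ := (hW.wellFoundedOn (r := R)).has_min Set.univ ⟨⟨m₀, hm₀⟩, trivial⟩
  exact ⟨m, hm, fun b hb => hmax ⟨b, hb⟩ trivial⟩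

lemma finite_mem_of_loc (hfin : G.E.Finite) {x : Loc} {W : Set (Event Tid Loc Val)}
    (hW : ∀ m ∈ W, G.Mem m ∧ m.loc = some x) : W.Finite := by
  refine (hfin.insert (.init x)).subset fun m hm => ?_
  obtain ⟨h1 | h1, h2⟩ := hW m hm
  · obtain ⟨y, rfl⟩ := Event.isInit_iff.1 h1
    cases h2
    exact .inl rfl
  · exact .inr h1

lemma exists_isMax (hG : G.IsExecution P) (hfin : G.E.Finite) (x : Loc) :
    ∃ m, G.Mem m ∧ m.IsWrite ∧ m.loc = some x ∧ G.IsMax m := by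
  obtain ⟨m, ⟨h1, h2, h3⟩, hmax⟩ := exists_max_of_nonempty hG
    (W := {m | G.Mem m ∧ m.IsWrite ∧ m.loc = some x})
    (finite_mem_of_loc hfin fun m hm => ⟨hm.1, hm.2.2⟩) ⟨.init x, .inl trivial, trivial, rfl⟩
  refine ⟨m, h1, h2, h3, fun b hb => ?_⟩
  obtain ⟨-, h4, -, h5, y, h6, h7⟩ := hG.co_wf _ _ hb
  exact hmax b ⟨h4, h5, by rw [← h3, h6, h7]⟩ hb

/-- An event that nothing else depends on can be taken out and added again. -/
lemma exists_del_eq_add (hG : G.IsExecution P) (hfin : G.E.Finite)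
    (hinit : ∀ a b, G.co a b → ¬ b.IsInit) (hZ : G.UpClosed Z)
    (hyZ : G.UpClosed (insert y Z)) (hy : y ∈ G.E) (hy' : y ∉ Z) :
    ∃ m, (G.del (insert y Z)).Fits P m y ∧ (∀ x, G.rf x y → x = m) ∧ (y.IsWrite → G.co m y) ∧
      G.del Z = (G.del (insert y Z)).add m y := by
  have hK := hG.del hyZ
  have hKmem := fun b => mem_del (e := b) hG hyZ
  obtain ⟨t, n, l, rfl⟩ := hG.exists_pos hy
  obtain ⟨h, Hh, hnext⟩ := hG.history t
  obtain ⟨act, hact, hal⟩ := hnext _ _ ((Hh _ _).1 hy)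
  have hlen : (h.take n).length = n := by
    rw [List.length_take, min_eq_left (Hh.lt_length hy).le]
  have Hn : (G.del (insert (.ev t n l) Z)).IsHistory t (h.take n) := by
    refine isHistory_del_of_first hyZ Hh (Set.mem_insert _ _) fun k l' hk hd => ?_
    rcases hd with hd | hd
    · cases hd
      exact hk.false
    · exact hy' (hZ.closed _ _ (.inl ⟨.inr (hZ.subset hd), .inr hy, rfl, hk⟩) hd)
  have hfits : ∀ m, (¬ (Event.ev t n l).IsFence → (G.del (insert (.ev t n l) Z)).Mem m ∧
      m.IsWrite ∧ m.SameLoc (.ev t n l)) → (∀ x v o s, l = .read x v o s → P.Writes m x v) →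
      (G.del (insert (.ev t n l) Z)).Fits P m (.ev t n l) :=
    fun m h1 h2 => ⟨t, _, act, l, by rw [hlen], Hn, hact, hal, h1, h2⟩
  -- the parts of the last claim that do not depend on the kind of the event
  have hE : G.E \ Z = insert (.ev t n l) (G.E \ insert (.ev t n l) Z) := by
    ext b
    simp only [Set.mem_sdiff, Set.mem_insert_iff, not_or]
    constructor
    · rintro ⟨h1, h2⟩
      by_cases hb : b = .ev t n l
      · exact .inl hb
      · exact .inr ⟨h1, hb, h2⟩
    · rintro (rfl | ⟨h1, -, h2⟩)
      · exact ⟨hy, hy'⟩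
      · exact ⟨h1, h2⟩
  have hrf : ∀ a b, b ≠ .ev t n l → ((G.rf a b ∧ a ∉ Z ∧ b ∉ Z) ↔
      (G.rf a b ∧ a ∉ insert (.ev t n l) Z ∧ b ∉ insert (.ev t n l) Z)) := by
    intro a b hb
    simp only [Set.mem_insert_iff, not_or]
    constructor
    · rintro ⟨h1, h2, h3⟩
      refine ⟨h1, ⟨?_, h2⟩, hb, h3⟩
      rintro rfl
      exact (hyZ.closed _ _ (.inr h1) (Set.mem_insert _ _)).elim hb h3
    · exact fun h => ⟨h.1, h.2.1.2, h.2.2.2⟩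
  have hco : ∀ a b, a ≠ .ev t n l → b ≠ .ev t n l → ((G.co a b ∧ a ∉ Z ∧ b ∉ Z) ↔
      (G.co a b ∧ a ∉ insert (.ev t n l) Z ∧ b ∉ insert (.ev t n l) Z)) := by
    intro a b ha hb
    simp [ha, hb]
  rcases l with ⟨x, v, o, s⟩ | ⟨x, v, o, s, b⟩ | ⟨o, s⟩
  · obtain ⟨w, hw, hwu⟩ := hG.rf_unique _ hy trivial
    have hwy : w ≠ .ev t n (.read x v o s) := by
      rintro rfl
      exact hG.rf_write hw
    have hwZ : w ∉ Z := fun h => hy' (hZ.closed _ _ (.inr hw) h)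
    have hwK : (G.del (insert (.ev t n (.read x v o s)) Z)).Mem w :=
      (hKmem w).2 ⟨(hG.rf_wf _ _ hw).1, fun h => h.elim hwy hwZ⟩
    refine ⟨w, hfits w (fun _ => ⟨hwK, hG.rf_write hw, hG.rf_sameLoc hw⟩) ?_, hwu,
      fun h => h.elim, ?_⟩
    · rintro _ _ _ _ ⟨⟩
      obtain ⟨-, -, _, _, _, _, _, _, h1, h2⟩ := hG.rf_wf _ _ hw
      cases h2
      exact h1
    · ext a b
      · exact Set.ext_iff.1 hE a
      · by_cases hb : b = .ev t n (.read x v o s)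
        · subst hb
          simp only [del, add, Event.IsRead, true_and, and_true, Set.mem_insert_iff, true_or,
            not_true, and_false, false_or]
          exact ⟨fun h => hwu a h.1, fun h => h ▸ ⟨hw, hwZ, hy'⟩⟩
        · simpa [del, add, hb] using hrf a b hb
      · simp only [del, add, Event.IsWrite, false_and, or_false]
        have hns : ∀ c d, G.co c d → c ≠ .ev t n (.read x v o s) ∧ d ≠ .ev t n (.read x v o s) := by
          intro c d hcd
          obtain ⟨-, -, h1, h2, -⟩ := hG.co_wf _ _ hcd
          exact ⟨fun h => by subst h; exact h1, fun h => by subst h; exact h2⟩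
        constructor
        · exact fun h => (hco a b (hns a b h.1).1 (hns a b h.1).2).1 h
        · exact fun h => (hco a b (hns a b h.1).1 (hns a b h.1).2).2 h
  · obtain ⟨m, ⟨hm, hcomy⟩, hmm⟩ := exists_max_of_nonempty hG
      (W := {c | (G.del (insert (.ev t n (.write x v o s b)) Z)).Mem c ∧
        G.co c (.ev t n (.write x v o s b))})
      (finite_mem_of_loc (x := x) hfin fun c hc => by
        obtain ⟨h1, -, -, -, y, h2, h3⟩ := hG.co_wf _ _ hc.2
        cases h3
        exact ⟨h1, h2⟩)
      ⟨.init x, .inl trivial, (hG.co_total (.init x) _ (.inl trivial) (.inr hy) trivial trivial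
        ⟨x, rfl, rfl⟩ (by simp)).resolve_right fun h => hinit _ _ h trivial⟩
    obtain ⟨-, -, hmw, -, hml⟩ := hG.co_wf _ _ hcomy
    have hmy : m ≠ .ev t n (.write x v o s b) := fun h => ((hKmem m).1 hm).2 (.inl h)
    have hmZ : m ∉ Z := fun h => ((hKmem m).1 hm).2 (.inr h)
    refine ⟨m, hfits m (fun _ => ⟨hm, hmw, hml⟩) ?_, fun a ha => (hG.rf_read ha).elim,
      fun _ => hcomy, ?_⟩
    · rintro _ _ _ _ ⟨⟩
    · ext a b'
      · exact Set.ext_iff.1 hE a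
      · have hb : G.rf a b' → b' ≠ .ev t n (.write x v o s b) := by
          rintro h rfl
          exact hG.rf_read h
        simp only [del, add, Event.IsRead, false_and, or_false]
        exact ⟨fun h => (hrf a b' (hb h.1)).1 h, fun h => (hrf a b' (hb h.1)).2 h⟩
      · change _ ↔ _ ∨ (Event.IsWrite (.ev t n (.write x v o s b)) ∧ _)
        by_cases ha : a = .ev t n (.write x v o s b)
        · constructor
          · rintro ⟨h1, -, h3⟩
            subst ha
            refine .inr ⟨trivial, .inr ⟨rfl, hG.co_trans _ _ _ hcomy h1, fun h => h.elim hmy hmZ,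
              fun h => h.elim (fun h => ?_) h3⟩⟩
            exact hG.co_irrefl _ (h ▸ h1)
          · rintro (h | ⟨-, h | h⟩)
            · exact absurd ha fun h' => h.2.1 (.inl h')
            · rcases h.2 with h | h
              · exact absurd (h ▸ ha) hmy
              · exact absurd ha fun h' => h.2.1 (.inl h')
            · subst ha
              obtain ⟨-, h1, h2, h3⟩ := h
              obtain ⟨-, h4, -, h5, h6⟩ := hG.co_wf _ _ h1
              refine ⟨(hG.co_total _ _ (.inr hy) h4 trivial h5 (hml.symm.trans h6)
                fun h => h3 (.inl h.symm)).resolve_right fun h => ?_, hy', fun h => h3 (.inr h)⟩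
              exact hmm b' ⟨(hKmem _).2 ⟨h4, h3⟩, h⟩ h1
        · by_cases hb : b' = .ev t n (.write x v o s b)
          · subst hb
            constructor
            · rintro ⟨h1, h2, h3⟩
              obtain ⟨hc1, -, hc3, -, hc4⟩ := hG.co_wf _ _ h1
              have haK := (hKmem a).2 ⟨hc1, fun h => h.elim ha h2⟩
              refine .inr ⟨trivial, .inl ⟨rfl, ?_⟩⟩
              by_cases ham : a = m
              · exact .inl ham
              · exact .inr ((hK.co_total a m haK hm hc3 hmw (hc4.trans hml.symm)
                  ham).resolve_right fun h => hmm a ⟨haK, h1⟩ h.1)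
            · rintro (h | ⟨-, h | h⟩)
              · exact absurd (Set.mem_insert _ _) h.2.2
              · rcases h.2 with rfl | h
                · exact ⟨hcomy, hmZ, hy'⟩
                · exact ⟨hG.co_trans _ _ _ h.1 hcomy, fun h' => h.2.1 (.inr h'), hy'⟩
              · exact absurd h.1 ha
          · simp [del, ha, hb]
  · refine ⟨.ev t n (.fence o s), hfits _ (fun h => (h trivial).elim) ?_,
      fun a ha => (hG.rf_read ha).elim, fun h => h.elim, ?_⟩
    · rintro _ _ _ _ ⟨⟩
    · ext a b
      · exact Set.ext_iff.1 hE a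
      · have hb : G.rf a b → b ≠ .ev t n (.fence o s) := by
          rintro h rfl
          exact hG.rf_read h
        simp only [del, add, Event.IsRead, false_and, or_false]
        exact ⟨fun h => (hrf a b (hb h.1)).1 h, fun h => (hrf a b (hb h.1)).2 h⟩
      · have hns : ∀ c d, G.co c d → c ≠ .ev t n (.fence o s) ∧ d ≠ .ev t n (.fence o s) := by
          intro c d hcd
          obtain ⟨-, -, h1, h2, -⟩ := hG.co_wf _ _ hcd
          exact ⟨fun h => by subst h; exact h1, fun h => by subst h; exact h2⟩
        simp only [del, add, Event.IsWrite, false_and, or_false]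
        exact ⟨fun h => (hco a b (hns a b h.1).1 (hns a b h.1).2).1 h,
          fun h => (hco a b (hns a b h.1).1 (hns a b h.1).2).2 h⟩

/-- If, moreover, no event of the rest of the graph is `co`-after the event, or after the write from
which it reads, then the event is added in a maximal way. -/
lemma exists_del_eq_add_of_max (hG : G.IsExecution P) (hfin : G.E.Finite)
    (hinit : ∀ a b, G.co a b → ¬ b.IsInit) (hZ : G.UpClosed Z)
    (hyZ : G.UpClosed (insert y Z)) (hy : y ∈ G.E) (hy' : y ∉ Z)
    (hmax : ∀ e, (y.IsWrite ∧ e = y) ∨ G.rf e y → ∀ b, (G.del (insert y Z)).Mem b → ¬ G.co e b) :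
    ∃ m, (G.del (insert y Z)).Fits P m y ∧ (¬ y.IsFence → (G.del (insert y Z)).IsMax m) ∧
      (∀ x, G.rf x y → x = m) ∧ G.del Z = (G.del (insert y Z)).add m y := by
  obtain ⟨m, h1, h2, h3, h4⟩ := exists_del_eq_add hG hfin hinit hZ hyZ hy hy'
  have hK := hG.del hyZ
  refine ⟨m, h1, fun hf b hb => ?_, h2, h4⟩
  have hbK := (hK.co_mem hb).2
  have hbG := (mem_del hG hyZ).1 hbK
  rcases Event.isWrite_or_isRead_of_not_isFence hf with hw | hr
  · obtain ⟨-, -, -, h5, h6⟩ := hG.co_wf _ _ hb.1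
    obtain ⟨-, -, -, -, h7⟩ := hG.co_wf _ _ (h3 hw)
    have hyb : y ≠ b := fun h => hbG.2 (.inl h.symm)
    have h8 := (hG.co_total _ _ (.inr hy) hbG.1 hw h5 (h7.symm.trans h6) hyb).resolve_left
      (hmax y (.inl ⟨hw, rfl⟩) b hbK)
    have h9 : (G.del Z).co b y := ⟨h8, fun h => hbG.2 (.inr h), hy'⟩
    rw [h4] at h9
    rcases h9 with h9 | ⟨-, ⟨-, rfl | h9⟩ | ⟨h9, -⟩⟩
    · exact h9.2.2 (.inl rfl)
    · exact hK.co_irrefl _ hb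
    · exact hK.co_irrefl _ (hK.co_trans _ _ _ hb h9)
    · exact hyb h9.symm
  · obtain ⟨w, hw, -⟩ := hG.rf_unique y hy hr
    exact hmax w (.inr hw) b hbK (h2 w hw ▸ hb.1)

end ExecGraph

namespace Guide

/-! ### Runs without postponed reads -/

variable {P : Program Tid Loc Val} {G : ExecGraph Tid Loc Val}
  {Q : Set (Tid × ℕ) → Guide Tid Loc Val → Prop} {A Y : List (Event Tid Loc Val)} {p : Tid × ℕ}
  {c c' c₀ : Guide Tid Loc Val} {e f w : Event Tid Loc Val}
  {rf rf' : Event Tid Loc Val → Event Tid Loc Val → Prop}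

lemma Postpone.postponed_eq (h : Postpone P Q A p c c') : c'.postponed = insert p c.postponed := by
  obtain ⟨hE, hA, f, w, m, e, h1, h2, h3, h4, h5, h6, h7, h8, h9, h10, rfl, -⟩ := h
  rfl

lemma chain_postponed (h : ReflTransGen (Postpone P Q A p) c c') :
    c.postponed ⊆ c'.postponed := by
  induction h with
  | refl => exact subset_rfl
  | tail _ h ih => exact ih.trans (h.postponed_eq ▸ Set.subset_insert _ _)

lemma Extend.postponed_eq (h : Extend P Q A p c c') : c'.postponed = c.postponed := by
  obtain ⟨-, w, q, m, e, h1, h2, h3, h4, h5, rfl, -⟩ := h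
  rfl

lemma Start.postponed_eq (h : Start P Q A p c c') : c'.postponed = c.postponed := by
  rcases h with ⟨rfl, -⟩ | h
  · rfl
  · exact h.postponed_eq

lemma Start.target_eq (h : Start P Q A p c c') : c'.target = c.target := by
  rcases h with ⟨rfl, -⟩ | ⟨-, w, q, m, e, h1, h2, h3, h4, h5, rfl, -⟩
  · rfl
  · rfl

lemma Settle.postponed_subset (h : Settle P Q A p c c') : c.postponed ⊆ c'.postponed := by
  obtain ⟨d, hd, h⟩ := h
  exact hd.postponed_eq ▸ chain_postponed h

/-- Settling the guide does not change the `co` edges between events executed before. -/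
lemma Settle.co_iff (h : Settle P Q A p c c') (hA : ∀ b ∈ A, b.pos ≠ some p)
    {x y : Event Tid Loc Val} (hx : x ∈ A ∨ x.IsInit) (hy : y ∈ A ∨ y.IsInit) :
    c.H.co x y ↔ c'.H.co x y := by
  have hpos : ∀ {b : Event Tid Loc Val}, b ∈ A ∨ b.IsInit → b.pos ≠ some p := by
    rintro b (hb | hb)
    · exact hA b hb
    · rw [Event.pos_eq_none.2 hb]
      simp
  obtain ⟨d, hd, hch⟩ := h
  have h2 : c.H.co x y ↔ d.H.co x y := by
    rcases hd with ⟨rfl, -⟩ | ⟨hno, w, q, m', e', -, -, hep, -, -, rfl, -⟩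
    · rfl
    · exact ⟨.inl, fun h => h.resolve_right fun h' => h'.2.elim (fun h' => hpos hy (h'.1 ▸ hep))
        fun h' => hpos hx (h'.1 ▸ hep)⟩
  refine h2.trans ?_
  clear h2 hd
  induction hch with
  | refl => rfl
  | tail _ hpp ih =>
    refine ih.trans ?_
    obtain ⟨hE, hcl, f, w, m', e', h1, h2, h3, h4, h5, h6, h7, h8, h9, h10, rfl, -⟩ := hpp
    have hrest : ∀ {b : Event Tid Loc Val}, b ∈ A ∨ b.IsInit → b ∉ rest _ A w := fun hb hb' =>
      hb.elim hb'.2.1 (hE.not_isInit hb'.1)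
    constructor
    · exact fun h => .inl ⟨h, hrest hx, hrest hy⟩
    · rintro (h | h)
      · exact h.1
      · exact absurd h.1 h8.not_isWrite

/-- The events `Y` are executed after the events `A` without any read being postponed. -/
inductive Calm (P : Program Tid Loc Val) (Q : Set (Tid × ℕ) → Guide Tid Loc Val → Prop)
    (rf : Event Tid Loc Val → Event Tid Loc Val → Prop) (A : List (Event Tid Loc Val))
    (c₀ : Guide Tid Loc Val) : List (Event Tid Loc Val) → Guide Tid Loc Val → Prop
  | nil : Calm P Q rf A c₀ [] c₀
  | snoc {Y : List (Event Tid Loc Val)} {c c' : Guide Tid Loc Val} {p : Tid × ℕ}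
      {e : Event Tid Loc Val} (h : Calm P Q rf A c₀ Y c) (hs : Start P Q (A ++ Y) p c c')
      (hp : e.pos = some p) (hA : ∀ b ∈ A ++ Y, b.pos ≠ some p) (ha : Agrees rf e c') :
      Calm P Q rf A c₀ (Y ++ [e]) c'

lemma Calm.run (h : Calm P Q rf A c₀ Y c) (h₀ : Run P G Q rf A c₀) : Run P G Q rf (A ++ Y) c := by
  induction h with
  | nil => simpa using h₀
  | snoc h hs hp hA ha ih =>
    rw [← List.append_assoc]
    exact .snoc ih ⟨_, hs, .refl⟩ hp hA ha

lemma Run.exists_calm (h : Run P G Q rf (A ++ Y) c)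
    (hY : ∀ y ∈ Y, ∀ q ∈ c.postponed, y.pos ≠ some q) :
    ∃ c₀, Run P G Q rf A c₀ ∧ Calm P Q rf A c₀ Y c := by
  induction Y using List.reverseRecOn generalizing c with
  | nil => exact ⟨c, by simpa using h, .nil⟩
  | append_singleton Y e ih =>
    rw [← List.append_assoc] at h
    obtain ⟨d, p, h1, hs, hp, hA, ha⟩ := h.exists_of_concat
    obtain ⟨c₀, h2, h3⟩ := ih h1 fun y hy q hq =>
      hY y (List.mem_append_left _ hy) q (hs.postponed_subset hq)
    obtain ⟨d', hd', hch⟩ := hs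
    rcases ReflTransGen.cases_tail hch with rfl | ⟨d'', -, hlast⟩
    · exact ⟨c₀, h2, .snoc h3 hd' hp hA ha⟩
    · exact absurd hp (hY e (by simp) p (hlast.postponed_eq ▸ Set.mem_insert _ _))

/-- A run without postponed reads adds some of the executed events to the guide, each of them in a
maximal way. -/
lemma Calm.exists_del (hG : G.IsExecution P) (hac : G.PoRfAcyclic) (hfin : G.E.Finite)
    (h₀ : Run P G Q rf A c₀) (h : Calm P Q rf A c₀ Y c) :
    c.target = c₀.target ∧ c.postponed = c₀.postponed ∧ ∃ Z, c.H.UpClosed Z ∧ c.H.del Z = c₀.H ∧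
      (∀ z ∈ Z, z ∈ Y) ∧ ∀ d ∈ Z, ∀ e, (d.IsWrite ∧ e = d) ∨ c.H.rf e d →
        (e = d ∨ c₀.H.Mem e ∨ [e, d].Sublist Y) ∧
        ∀ b, c₀.H.Mem b ∨ [b, d].Sublist Y → ¬ c.H.co e b := by
  induction h with
  | nil =>
    exact ⟨rfl, rfl, ∅, ⟨Set.empty_subset _, by simp⟩, ExecGraph.del_empty, by simp, by simp⟩
  | @snoc Y c c' p e h hs hp hA ha ih =>
    obtain ⟨ht, hpp, Z, hZ, hdel, hZY, hmax⟩ := ih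
    have hv := ((h.run h₀).valid hG hac hfin).1
    refine ⟨hs.target_eq.trans ht, hs.postponed_eq.trans hpp, ?_⟩
    have hYe : ∀ {y}, y ∈ Y → y ≠ e := by
      rintro y hy rfl
      exact hA y (List.mem_append_right _ hy) hp
    have hsub : ∀ {b d}, d ∈ Y → [b, d].Sublist (Y ++ [e]) → [b, d].Sublist Y := fun hd h =>
      (pair_sublist_concat.1 h).resolve_right fun h' => hYe hd h'.2
    have hmem : ∀ {b}, c.H.Mem b → c₀.H.Mem b ∨ b ∈ Y := by
      intro b hb
      by_cases hbZ : b ∈ Z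
      · exact .inr (hZY b hbZ)
      · exact .inl (hdel ▸ (ExecGraph.mem_del hv.exec hZ).2 ⟨hb, hbZ⟩)
    have hmem' : ∀ {b}, c₀.H.Mem b → c.H.Mem b := fun hb =>
      ((ExecGraph.mem_del hv.exec hZ).1 (hdel ▸ hb)).1
    rcases hs with ⟨rfl, -⟩ | ⟨hno, w, q, m, e', htgt, -, hep, hfit, hm, rfl, -⟩
    · refine ⟨Z, hZ, hdel, fun z hz => List.mem_append_left _ (hZY z hz), fun d hd x hx => ?_⟩
      obtain ⟨h1, h2⟩ := hmax d hd x hx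
      exact ⟨h1.imp_right (Or.imp_right fun h => pair_sublist_concat.2 (.inl h)),
        fun b hb => h2 b (hb.imp_right (hsub (hZY d hd)))⟩
    · obtain rfl : e = e' := ha.1.resolve_right fun h => hno e h hp
      have hne : ∀ {b}, c.H.Mem b → b ≠ e := fun h h' => hfit.not_mem (h' ▸ h)
      refine ⟨insert e Z, hZ.add hv.exec hfit, (ExecGraph.add_del hv.exec hfit).trans hdel, ?_, ?_⟩
      · rintro z (rfl | hz)
        · simp
        · exact List.mem_append_left _ (hZY z hz)
      rintro d (rfl | hd) x hx
      · -- the new event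
        rcases hx with ⟨hdw, rfl⟩ | hx
        · refine ⟨.inl rfl, fun b hb => ?_⟩
          rintro (hc | ⟨-, ⟨rfl, hc⟩ | ⟨-, hc⟩⟩)
          · exact hne (hv.exec.co_mem hc).1 rfl
          · rcases hc with hc | hc
            · have hmf := hfit
              obtain ⟨_, _, _, _, _, _, _, _, h5, _⟩ := hmf
              exact hne (h5 fun h => h.not_isWrite hdw).1 hc.symm
            · exact hne (hv.exec.co_mem hc).1 rfl
          · exact hm (fun h => h.not_isWrite hdw) _ hc
        · rcases hx with hx | ⟨hr, rfl, -⟩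
          · exact absurd rfl (hne (hv.exec.rf_wf _ _ hx).2.1)
          · have hnf : ¬ d.IsFence := fun h => h.not_isRead hr
            obtain ⟨_, _, _, _, _, _, _, _, h5, _⟩ := id hfit
            refine ⟨.inr ((hmem (h5 hnf).1).imp_right fun h => pair_sublist_concat.2
              (.inr ⟨h, rfl⟩)), fun b hb => ?_⟩
            rintro (hc | ⟨h6, -⟩)
            · exact hm hnf _ hc
            · exact hr.not_isWrite h6
      · have hdc : d ∈ c.H.E := hZ.subset hd
        have hde : d ≠ e := hne (.inr hdc)
        have hx' : (d.IsWrite ∧ x = d) ∨ c.H.rf x d :=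
          hx.imp_right fun h => h.resolve_right fun h' => hde h'.2.2
        obtain ⟨h1, h2⟩ := hmax d hd x hx'
        refine ⟨h1.imp_right (Or.imp_right fun h => pair_sublist_concat.2 (.inl h)),
          fun b hb => ?_⟩
        have hb' := hb.imp_right (hsub (hZY d hd))
        have hbe : b ≠ e := hb'.elim (fun h => hne (hmem' h)) fun h => hYe (pair_mem_left h)
        have hxe : x ≠ e := hx'.elim (fun h => h.2 ▸ hde) fun h => hne (hv.exec.rf_wf _ _ h).1
        rintro (hc | ⟨-, ⟨hc, -⟩ | ⟨hc, -⟩⟩)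
        · exact h2 b hb' hc
        · exact hbe hc
        · exact hxe hc

end Guide

/-! ### States on the way to a given graph -/

namespace State

variable {P : Program Tid Loc Val} {G : ExecGraph Tid Loc Val}
  {Q : Set (Tid × ℕ) → Guide Tid Loc Val → Prop} {S S' : State Tid Loc Val}
  {c c' : Guide Tid Loc Val} {m e w r r' a : Event Tid Loc Val}

/-- The state lies on the way to `G`, where it has to follow the guide `c`. -/
structure OnTrack (P : Program Tid Loc Val) (G : ExecGraph Tid Loc Val)
    (Q : Set (Tid × ℕ) → Guide Tid Loc Val → Prop) (S : State Tid Loc Val)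
    (c : Guide Tid Loc Val) : Prop where
  run : Guide.Run P G Q S.rf S.exe c
  /-- The postponed reads are still reversible. -/
  reversible : ∀ e ∈ S.exe, ∀ q ∈ c.postponed, e.pos = some q → e ∈ S.rev
  co_iff : ∀ a b, S.graph.Mem a → S.graph.Mem b → (S.co a b ↔ c.H.co a b)

/-- The events of the guide that have not been executed yet. -/
def unseen (S : State Tid Loc Val) (c : Guide Tid Loc Val) : Set (Event Tid Loc Val) :=
  {x | x ∈ c.H.E ∧ x ∉ S.exe}

/-- The graph of the state is a part of the guide. -/
structure Follows (P : Program Tid Loc Val) (S : State Tid Loc Val) (c : Guide Tid Loc Val) :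
    Prop where
  exec : c.H.IsExecution P
  agrees : ∀ e ∈ S.exe, Guide.Agrees S.rf e c
  co_iff : ∀ a b, S.graph.Mem a → S.graph.Mem b → (S.co a b ↔ c.H.co a b)

namespace Follows

lemma closed (hS : S.Inv P) (h : S.Follows P c) {x y : Event Tid Loc Val} (hxy : c.H.porf x y)
    (hy : y ∈ S.exe) : x ∈ S.exe ∨ x.IsInit := by
  refine or_iff_not_imp_right.2 fun hxi => ?_
  have hx := (h.exec.porf_mem_left hxy).resolve_left hxi
  rcases hxy with hpo | hrf
  · obtain ⟨t, n, l, rfl⟩ := h.exec.exists_pos hx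
    obtain ⟨t', n', l', rfl⟩ := hS.exec.exists_pos (G := S.graph) hy
    obtain ⟨rfl, hlt⟩ := hpo.2.2
    obtain ⟨l₁, hl₁⟩ := hS.exec.exists_mem_of_lt (G := S.graph) hy hlt
    have : Event.ev t n l = .ev t n l₁ := h.exec.eq_of_pos hx (h.agrees _ hl₁).1 rfl
    exact this ▸ hl₁
  · exact ((hS.exec.rf_wf _ _ (((h.agrees y hy).2 x).2 hrf)).1).resolve_left hxi

lemma upClosed (hS : S.Inv P) (h : S.Follows P c) : c.H.UpClosed (S.unseen c) :=
  ⟨fun _ hx => hx.1, fun _ _ hxy hx => ⟨h.exec.porf_mem_right hxy, fun hy =>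
    (h.closed hS hxy hy).elim hx.2 (h.exec.not_isInit hx.1)⟩⟩

/-- The graph of a state is what has been executed of the guide. -/
lemma graph_eq (hS : S.Inv P) (h : S.Follows P c) : S.graph = c.H.del (S.unseen c) := by
  have hmem : ∀ {x}, S.graph.Mem x → c.H.Mem x ∧ x ∉ S.unseen c := fun hx =>
    ⟨hx.imp_right fun hx => (h.agrees _ hx).1,
      fun h' => hx.elim (h.exec.not_isInit h'.1) h'.2⟩
  have hmem' : ∀ {x}, c.H.Mem x → x ∉ S.unseen c → S.graph.Mem x := fun hx h' =>
    hx.imp_right fun hx => by_contra fun h'' => h' ⟨hx, h''⟩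
  ext x y
  · exact ⟨fun hx => ⟨(h.agrees _ hx).1, fun h' => h'.2 hx⟩,
      fun hx => by_contra fun h' => hx.2 ⟨hx.1, h'⟩⟩
  · constructor
    · intro hxy
      obtain ⟨h1, h2, -⟩ := hS.exec.rf_wf _ _ hxy
      exact ⟨((h.agrees y (hS.exec.rf_mem hxy)).2 x).1 hxy, (hmem h1).2, (hmem h2).2⟩
    · rintro ⟨h1, -, h3⟩
      have hy : y ∈ S.exe := by_contra fun h' => h3 ⟨h.exec.rf_mem h1, h'⟩
      exact ((h.agrees y hy).2 x).2 h1
  · constructor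
    · intro hxy
      obtain ⟨h1, h2⟩ := hS.exec.co_mem hxy
      exact ⟨(h.co_iff _ _ h1 h2).1 hxy, (hmem h1).2, (hmem h2).2⟩
    · rintro ⟨h1, h2, h3⟩
      obtain ⟨h4, h5⟩ := h.exec.co_mem h1
      exact (h.co_iff _ _ (hmem' h4 h2) (hmem' h5 h3)).2 h1

lemma sub (hS : S.Inv P) (h : S.Follows P c) : S.graph.Sub c.H := by
  rw [h.graph_eq hS]
  exact ExecGraph.del_sub _ _

lemma transGen_porf_iff (hS : S.Inv P) (h : S.Follows P c) {x y : Event Tid Loc Val}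
    (hy : y ∈ S.exe) : TransGen S.graph.porf x y ↔ TransGen c.H.porf x y := by
  rw [h.graph_eq hS, ExecGraph.transGen_porf_del h.exec (h.upClosed hS)]
  exact and_iff_left fun h' => h'.2 hy

end Follows

namespace OnTrack

lemma follows (hG : G.IsExecution P) (hac : G.PoRfAcyclic) (hfin : G.E.Finite)
    (h : S.OnTrack P G Q c) : S.Follows P c :=
  ⟨(h.run.valid hG hac hfin).1.exec, (h.run.valid hG hac hfin).2, h.co_iff⟩

/-- A forward step that stays on the way to `G` settles the guide for the new event. -/
lemma exists_settle (he : S.graph.Fits P m e)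
    (h : (S.addEv m e).OnTrack P G Q c') : ∃ c p, S.OnTrack P G Q c ∧ e.pos = some p ∧
      Guide.Settle P Q S.exe p c c' ∧ Guide.Agrees (S.addEv m e).rf e c' := by
  obtain ⟨c, p, hrun, hs, hp, hA, ha⟩ := h.run.exists_of_concat
  have hne : ∀ {b}, S.graph.Mem b → b ≠ e := fun h h' => he.not_mem (h' ▸ h)
  refine ⟨c, p, ⟨hrun.congr fun a ha x => ?_, fun b hb q hq hbq => ?_, fun x y hx hy => ?_⟩, hp,
    hs, ha⟩
  · exact ⟨fun h => h.resolve_right fun h' => hne (.inr ha) h'.2.2, .inl⟩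
  · rcases h.reversible b (List.mem_append_left _ hb) q (hs.postponed_subset hq) hbq with h' | h'
    · exact h'
    · exact absurd h'.1 (hne (.inr hb))
  · have h1 : S.co x y ↔ (S.addEv m e).co x y :=
      ⟨.inl, fun h => h.resolve_right fun h' => h'.2.elim (fun h' => hne hy h'.1)
        fun h' => hne hx h'.1⟩
    rw [h1, h.co_iff x y (hx.imp_right (List.mem_append_left _))
      (hy.imp_right (List.mem_append_left _))]
    exact (hs.co_iff hA hx.symm hy.symm).symm

end OnTrack

end State

namespace State

variable {P : Program Tid Loc Val} {G : ExecGraph Tid Loc Val}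
  {Q : Set (Tid × ℕ) → Guide Tid Loc Val → Prop} {S S' : State Tid Loc Val}
  {c c' : Guide Tid Loc Val} {m e w r r' a : Event Tid Loc Val}

/-! ### Going back across a reversal -/

namespace Reversal

/-- The dropped events in a final segment `L` of the execution order. -/
def droppedIn (S : State Tid Loc Val) (w r : Event Tid Loc Val) (L : List (Event Tid Loc Val)) :
    Set (Event Tid Loc Val) := {x | x ∈ S.dropped w r ∧ x ∈ L}

variable {L₁ L₂ : List (Event Tid Loc Val)} {y : Event Tid Loc Val}

lemma upClosed_droppedIn (hS : S.Inv P) (h : S.Reversal P w r r' a S') (hL : S.exe = L₁ ++ L₂) :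
    S.graph.UpClosed (droppedIn S w r L₂) := by
  have hup := h.upClosed hS
  refine ⟨fun x hx => hup.subset hx.1, fun x y hxy hx => ⟨hup.closed x y hxy hx.1, ?_⟩⟩
  have hx' : x ∈ S.exe := hup.subset hx.1
  have hy' : y ∈ S.exe := hS.exec.porf_mem_right hxy
  by_contra hy
  have hyx : S.Before y x := by
    rw [hL] at hy'
    rw [State.Before, hL]
    exact pair_sublist_append.2 (.inr (.inl ⟨(List.mem_append.1 hy').resolve_right hy, hx.2⟩))
  rcases hxy with hpo | hrf
  · exact pair_asymm hS.nodup (hS.sorted.before hx' hy' hpo.2.2) hyx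
  · exact (h.check y (hup.closed x y (.inr hrf) hx.1)).1 x hrf ⟨hyx, hx.1⟩

lemma droppedIn_cons (hy : y ∈ S.dropped w r) :
    droppedIn S w r (y :: L₂) = insert y (droppedIn S w r L₂) := by
  ext x
  simp only [droppedIn, Set.mem_ofPred_eq, List.mem_cons, Set.mem_insert_iff]
  constructor
  · rintro ⟨h1, rfl | h2⟩
    · exact .inl rfl
    · exact .inr ⟨h1, h2⟩
  · rintro (rfl | h)
    · exact ⟨hy, .inl rfl⟩
    · exact ⟨h.1, .inr h.2⟩

lemma droppedIn_cons_of_notMem (hy : y ∉ S.dropped w r) :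
    droppedIn S w r (y :: L₂) = droppedIn S w r L₂ := by
  ext x
  simp only [droppedIn, Set.mem_ofPred_eq, List.mem_cons]
  constructor
  · rintro ⟨h1, rfl | h2⟩
    · exact absurd h1 hy
    · exact ⟨h1, h2⟩
  · exact fun h => ⟨h.1, .inr h.2⟩

lemma notMem_droppedIn (hS : S.Inv P) (hL : S.exe = L₁ ++ y :: L₂) : y ∉ droppedIn S w r L₂ := by
  intro h
  have := hS.nodup
  rw [hL] at this
  exact (List.nodup_cons.1 (List.nodup_append.1 this).2.1).1 h.2

/-- By `CheckOptimal`, every dropped event was added in a maximal way. -/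
lemma exists_del_eq_add (hS : S.Inv P) (h : S.Reversal P w r r' a S') (hL : S.exe = L₁ ++ y :: L₂)
    (hy : y ∈ S.dropped w r) :
    ∃ m, (S.graph.del (droppedIn S w r (y :: L₂))).Fits P m y ∧
      (¬ y.IsFence → (S.graph.del (droppedIn S w r (y :: L₂))).IsMax m) ∧
      (∀ x, S.rf x y → x = m) ∧
      S.graph.del (droppedIn S w r L₂) = (S.graph.del (droppedIn S w r (y :: L₂))).add m y := by
  have h1 := h.upClosed_droppedIn hS hL
  have h2 := h.upClosed_droppedIn hS (L₁ := L₁ ++ [y]) (L₂ := L₂) (by simpa using hL)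
  have hyS : y ∈ S.exe := by simp [hL]
  rw [droppedIn_cons hy] at h1 ⊢
  refine ExecGraph.exists_del_eq_add_of_max hS.exec (List.finite_toSet S.exe) hS.co_init h2 h1 hyS
    (notMem_droppedIn hS hL) fun e he b hb hc => ?_
  obtain ⟨hb1, hb2⟩ := (ExecGraph.mem_del hS.exec h1).1 hb
  have hbS : b ∈ S.exe := hb1.resolve_left (hS.co_init _ _ hc)
  refine (h.check y hy).2 e he b ?_ hc
  have hry : y = r ∨ S.Before r y := (mem_dropped_iff.1 hy).imp_right And.left
  have hbr : b ≠ r → S.Before r b → b ∈ S.graph.porfBefore w ∨ b ∈ S.dropped w r := fun h1 h2 =>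
    or_iff_not_imp_left.2 fun h3 => mem_dropped_iff.2 (.inr ⟨h2, h3⟩)
  have hbd : b ∈ S.dropped w r → S.Before b y := by
    intro hbd
    have hbL : b ∉ y :: L₂ := fun h' =>
      hb2 ((droppedIn_cons hy (L₂ := L₂)) ▸ (⟨hbd, h'⟩ : b ∈ droppedIn S w r (y :: L₂)))
    rw [hL] at hbS
    rw [State.Before, hL]
    exact pair_sublist_append.2 (.inr (.inl ⟨(List.mem_append.1 hbS).resolve_right hbL, by simp⟩))
  by_cases hb : b = r
  · exact .inl (hbd (mem_dropped_iff.2 (.inl hb)))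
  rcases pair_total hbS h.mem hb with h' | h'
  · rcases hry with rfl | hry
    · exact .inl h'
    · exact .inl (pair_trans hS.nodup h' hry)
  · exact (hbr hb h').symm.imp hbd id

end Reversal

section

variable (hG : G.IsExecution P) (hac : G.PoRfAcyclic) (hfin : G.E.Finite)

include hG hac hfin

/-- If a reversal leads to a state on the way to `G`, then it starts from a state on the way to `G`
with its own graph as the guide, and the next write is awaited in order to reverse `r`. -/
lemma OnTrack.of_reversal (hS : S.Inv P) (hS' : S'.Inv P) (h : S.Reversal P w r r' a S')
    (ht : S'.OnTrack P G (fun _ _ => True) c') :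
    ∃ p D, r.pos = some p ∧ S.OnTrack P G (fun _ _ => True) ⟨S.graph, some (w, p), D⟩ := by
  obtain ⟨A, Y, X, hexe, hexe', hXY, hX, hA, hY⟩ := h.exists_split hS
  obtain ⟨⟨t, n⟩, hp⟩ : ∃ p, r.pos = some p := by
    obtain ⟨t, n, l, rfl⟩ := hS.exec.exists_pos (G := S.graph) h.mem
    exact ⟨_, rfl⟩
  have hp' := h.pos_eq.trans hp
  have hsplit : S'.exe = (A ++ [r']) ++ (X ++ [w]) := by simp [hexe']
  have hwr : S'.rf w r' := (h.rf_iff hS).2 (.inr ⟨rfl, rfl⟩)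
  have hup' := (ht.follows hG hac hfin).upClosed hS'
  have hAd : ∀ x ∈ A, x ∉ S.dropped w r := fun x hx => Reversal.not_dropped_of_before hS ((hA x).1 hx)
  have hAS : ∀ x ∈ A, x ∈ S.exe := fun x hx => by simp [hexe, hx]
  have hAS' : ∀ x ∈ A, x ∈ S'.exe := fun x hx => by simp [hexe', hx]
  have hnd' := hS'.nodup
  -- nothing is postponed after the reversed read, as the events before `w` are not reversible
  obtain ⟨c₀, hrun₀, hcalm⟩ := Guide.Run.exists_calm (hsplit ▸ ht.run) (by
    intro y hy q hq hyq
    have hyS' : y ∈ S'.exe := by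
      rw [hsplit]
      exact List.mem_append_right _ hy
    rcases (h.rev_eq hS).1 (ht.reversible y hyS' q hq hyq) with rfl | ⟨h1, -, h3⟩
    · rw [hsplit] at hnd'
      exact (List.nodup_append.1 hnd').2.2 y (by simp) y hy rfl
    · rcases List.mem_append.1 hy with hy | hy
      · exact h3 ((hX y).1 hy).2
      · rw [List.mem_singleton.1 hy] at h1
        exact h.write_notMem (hS.rev_mem _ h1).1)
  -- nor is anything added to the guide
  obtain ⟨hv, hag⟩ := ht.run.valid hG hac hfin
  obtain ⟨hv₀, hag₀⟩ := hrun₀.valid hG hac hfin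
  obtain ⟨ht₀, hpp₀, Z, hZ, hdel, hZY, -⟩ := hcalm.exists_del hG hac hfin hrun₀
  have hw₀ : w ∈ c₀.H.E := by
    have h1 := (hv₀.exec.rf_wf _ _ (((hag₀ r' (by simp)).2 w).1 hwr)).1
    obtain ⟨m, hm⟩ := h.fits
    exact h1.resolve_left hm.not_init
  have hZe : Z = ∅ := by
    refine Set.eq_empty_iff_forall_notMem.2 fun z hz => ?_
    have hwZ : w ∉ Z := (hdel ▸ hw₀ : w ∈ (c'.H.del Z).E).2
    rcases List.mem_append.1 (hZY z hz) with h1 | h1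
    · have h2 := (h.mem_porfBefore_of_porf' hS).2 ((hX z).1 h1).2
      exact hwZ (hZ.transGen (((ht.follows hG hac hfin).transGen_porf_iff hS' (by simp [hexe'])).1 h2) hz)
    · exact hwZ (List.mem_singleton.1 h1 ▸ hz)
  have hc : c₀ = c' := by
    obtain ⟨H, T, D⟩ := c₀
    obtain ⟨H', T', D'⟩ := c'
    subst hZe
    rw [ExecGraph.del_empty] at hdel
    cases hdel
    cases ht₀
    cases hpp₀
    rfl
  subst hc
  clear hZ hdel hZY hZe ht₀ hpp₀ hcalm
  have hr'A : r' ∉ A := by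
    intro hr
    rw [hsplit] at hnd'
    exact (List.nodup_append.1 (List.nodup_append.1 hnd').1).2.2 r' hr r' (by simp) rfl
  have hwA : w ∉ A := fun hw => h.write_notMem (hAS w hw)
  have hr₀ : r' ∈ c₀.H.E := hv₀.sub _ (by simp)
  have hrf₀ : c₀.H.rf w r' := ((hag₀ r' (by simp)).2 w).1 hwr
  have hAcl : ∀ x y, c₀.H.porf x y → y ∈ A → x ∈ A ∨ x.IsInit := by
    intro x y hxy hy
    have h0 : S'.graph.Mem x := by
      refine (hv₀.exec.porf_mem_left hxy).imp_right fun hx => by_contra fun hx' => ?_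
      exact (hup'.closed x y hxy ⟨hx, hx'⟩).2 (hAS' y hy)
    refine or_iff_not_imp_right.2 fun hxi => ?_
    rcases hxy with hpo | hrf
    · have hb := hS'.sorted.before (h0.resolve_left hxi) (hAS' y hy) hpo.2.2
      obtain ⟨A₁, A₂, rfl⟩ := List.append_of_mem hy
      rw [hexe'] at hb
      have h1 := pair_split (l₁ := A₁) (c := y) (l₂ := A₂ ++ r' :: X ++ [w]) (a := x)
        (by simpa [hexe'] using hS'.nodup)
      have h2 := h1.1.1 (by simpa using hb)
      simp [h2]
    · have h1 : S'.rf x y := ((hag y (hAS' y hy)).2 x).2 hrf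
      have h2 := ((h.rf_iff hS).1 h1).resolve_right fun h' => hr'A (h'.2 ▸ hy)
      exact (hA x).2 ((hS.rf_before_of_rev h.rev h2.1 ((hA y).1 hy)).resolve_left hxi)
  -- what is left of the guide when the read is postponed
  have hK : c₀.H.del (Guide.rest c₀.H A w) = S.graph.del (Reversal.droppedIn S w r (r :: Y)) := by
    have h1 : Guide.rest c₀.H A w = S'.unseen c₀ ∪ insert r' {w} := by
      ext x
      simp only [Guide.rest, State.unseen, Set.mem_ofPred_eq, Set.mem_union, Set.mem_insert_iff,
        Set.mem_singleton_iff]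
      constructor
      · rintro ⟨h1, h2, h3⟩
        by_cases hx : x ∈ S'.exe
        · rw [hexe'] at hx
          simp only [List.mem_append, List.mem_cons, List.not_mem_nil, or_false] at hx
          rcases hx with (hx | hx | hx) | hx
          · exact absurd hx h2
          · exact .inr (.inl hx)
          · exact absurd (((ht.follows hG hac hfin).transGen_porf_iff hS' (by simp [hexe'])).1
              ((h.mem_porfBefore_of_porf' hS).2 ((hX x).1 hx).2)) h3
          · exact .inr (.inr hx)
        · exact .inl ⟨h1, hx⟩
      · rintro (⟨h1, h2⟩ | rfl | rfl)
        · exact ⟨h1, fun h' => h2 (hAS' x h'), fun h' =>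
            (hup'.transGen h' ⟨h1, h2⟩).2 (by simp [hexe'])⟩
        · exact Guide.mem_rest_of_rf hv₀.exec hv₀.acyclic hr'A hrf₀
        · exact Guide.target_mem_rest hv₀.acyclic hw₀ hwA
    have h2 : S'.graph.del (insert r' {w}) = S.graph.del (S.dropped w r) := by
      have h3 := (h.exec_cut hS).add (h.fits_write hS)
      rw [h.graph_eq hS, ExecGraph.add_del h3 (h.fits_read hS),
        show ({w} : Set (Event Tid Loc Val)) = insert w ∅ by simp,
        ExecGraph.add_del (h.exec_cut hS) (h.fits_write hS), ExecGraph.del_empty]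
    have h3 : Reversal.droppedIn S w r (r :: Y) = S.dropped w r := by
      ext x
      refine ⟨fun hx => hx.1, fun hx => ⟨hx, ?_⟩⟩
      rcases Reversal.mem_dropped_iff.1 hx with rfl | ⟨hx, -⟩
      · simp
      · simp [(hY x).2 hx]
    rw [h1, ← ExecGraph.del_del, ← (ht.follows hG hac hfin).graph_eq hS', h2, h3]
  have hposne : ∀ {L₁ L₂ : List (Event Tid Loc Val)} {y : Event Tid Loc Val} {q : Tid × ℕ},
      S.exe = L₁ ++ y :: L₂ → y.pos = some q → ∀ b ∈ L₁, b.pos ≠ some q := by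
    intro L₁ L₂ y q hL hyq b hb hbq
    have h1 : b = y := hS.exec.eq_of_pos (G := S.graph) (show b ∈ S.exe by simp [hL, hb])
      (show y ∈ S.exe by simp [hL]) (hbq.trans hyq.symm)
    have h2 := hS.nodup
    rw [hL] at h2
    exact (List.nodup_append.1 h2).2.2 b hb y (by simp) h1
  -- before the reversal, the read is postponed once more
  have hstart : Guide.Run P G (fun _ _ => True) S.rf (A ++ [r])
      ⟨S.graph.del (Reversal.droppedIn S w r Y), some (w, (t, n)),
        insert (t, n) c₀.postponed⟩ := by
    obtain ⟨cA, p, hrunA, ⟨d, hd, hch⟩, hpp, hposA, -⟩ := hrun₀.exists_of_concat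
    rw [hp'] at hpp
    cases hpp
    obtain ⟨m, hm1, hm2, hm3, hm4⟩ :=
      h.exists_del_eq_add hS hexe (Reversal.mem_dropped_iff.2 (.inl rfl))
    have hrin : r ∉ Reversal.droppedIn S w r Y := Reversal.notMem_droppedIn hS hexe
    have hupY : S.graph.UpClosed (Reversal.droppedIn S w r Y) :=
      h.upClosed_droppedIn hS (L₁ := A ++ [r]) (by simpa using hexe)
    refine .snoc (hrunA.congr fun x hx y => ?_) ⟨d, hd, hch.tail ⟨hv₀.exec, hAcl, r', w, m, r, hr₀,
      hp', hr'A, hrf₀, hw₀, hwA, hp, h.isRead, ?_, ?_, ?_, trivial⟩⟩ hp hposA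
      ⟨⟨h.mem, hrin⟩, fun x => ?_⟩
    · rw [h.rf_iff hS]
      constructor
      · rintro (h1 | h1)
        · exact h1.1
        · exact absurd (h1.2 ▸ hx) hr'A
      · exact fun h1 => .inl ⟨h1, hAd x hx⟩
    · rw [hK]
      exact hm1
    · rw [hK]
      exact hm2 fun h' => h'.not_isRead h.isRead
    · rw [hK, hm4]
    · exact ⟨fun h1 => ⟨h1, fun h2 => hrin (hupY.closed _ _ (.inr h1) h2), hrin⟩, fun h1 => h1.1⟩
  -- then all events up to the reversal are in the guide or are added to it in a maximal way
  have hall : ∀ Y₁ Y₂, Y = Y₁ ++ Y₂ → Guide.Run P G (fun _ _ => True) S.rf ((A ++ [r]) ++ Y₁)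
      ⟨S.graph.del (Reversal.droppedIn S w r Y₂), some (w, (t, n)),
        insert (t, n) c₀.postponed⟩ := by
    intro Y₁
    induction Y₁ using List.reverseRecOn with
    | nil =>
      rintro Y₂ rfl
      simpa using hstart
    | append_singleton Y₁ y ih =>
      intro Y₂ hYY
      have hL : S.exe = ((A ++ [r]) ++ Y₁) ++ y :: Y₂ := by simp [hexe, hYY]
      have hyS : y ∈ S.exe := by simp [hL]
      obtain ⟨t', n', l', rfl⟩ := hS.exec.exists_pos (G := S.graph) hyS
      have hyin := Reversal.notMem_droppedIn (w := w) (r := r) hS hL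
      have hup2 : S.graph.UpClosed (Reversal.droppedIn S w r Y₂) :=
        h.upClosed_droppedIn hS (L₁ := (A ++ [r]) ++ Y₁ ++ [.ev t' n' l']) (by simpa using hL)
      rw [← List.append_assoc]
      refine .snoc (ih (_ :: Y₂) (by simpa using hYY)) ⟨_, ?_, .refl⟩ (Event.pos_ev _ _ _)
        (hposne hL rfl) ⟨⟨hyS, hyin⟩, fun x => ⟨fun h1 => ⟨h1, fun h2 =>
          hyin (hup2.closed _ _ (.inr h1) h2), hyin⟩, fun h1 => h1.1⟩⟩
      by_cases hyd : .ev t' n' l' ∈ S.dropped w r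
      · obtain ⟨m, hm1, hm2, -, hm4⟩ := h.exists_del_eq_add hS hL hyd
        refine .inr ⟨fun f hf => hm1.pos_ne hf, w, (t, n), m, _, rfl, ?_, rfl, hm1, hm2, ?_,
          trivial⟩
        · rintro rfl
          exact h.write_notMem hyS
        · rw [hm4]
      · refine .inl ⟨?_, _, ⟨hyS, fun h1 => hyd h1.1⟩, rfl⟩
        rw [Reversal.droppedIn_cons_of_notMem hyd]
  have hfinal := hall Y [] (by simp)
  have hD : Reversal.droppedIn S w r [] = ∅ := by simp [Reversal.droppedIn]
  rw [hD, ExecGraph.del_empty] at hfinal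
  refine ⟨(t, n), insert (t, n) c₀.postponed, hp, by simpa [hexe] using hfinal, ?_,
    fun _ _ _ _ => Iff.rfl⟩
  intro e he q hq heq
  have hmemq : ∀ b ∈ S.exe, b.pos = some q → e = b := fun b hb hbq =>
    hS.exec.eq_of_pos (G := S.graph) he hb (heq.trans hbq.symm)
  rcases hq with rfl | hq
  · exact hmemq r h.mem hp ▸ h.rev
  · obtain ⟨b, hb, hbq⟩ := hv₀.postponed_sub hq
    rcases List.mem_append.1 hb with hbA | hbA
    · obtain rfl := hmemq b (hAS b hbA) hbq
      rcases (h.rev_eq hS).1 (ht.reversible e (hAS' e hbA) q hq heq) with rfl | h1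
      · exact absurd hbA hr'A
      · exact h1.1
    · rw [List.mem_singleton.1 hbA, hp'] at hbq
      exact hmemq r h.mem (hp.trans hbq) ▸ h.rev

end

end State

/-! ### Optimality -/

namespace Guide

variable {P : Program Tid Loc Val} {G : ExecGraph Tid Loc Val}
  {Q : Set (Tid × ℕ) → Guide Tid Loc Val → Prop}
  {rf : Event Tid Loc Val → Event Tid Loc Val → Prop}

/-- Events that the guide has already can be executed without changing the guide. -/
lemma Run.append {A Y : List (Event Tid Loc Val)} {c : Guide Tid Loc Val} (h : Run P G Q rf A c)
    (hc : c.H.IsExecution P) (hA : ∀ a ∈ A ++ Y, Agrees rf a c) (hnd : (A ++ Y).Nodup) :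
    Run P G Q rf (A ++ Y) c := by
  induction Y using List.reverseRecOn with
  | nil => simpa using h
  | append_singleton Y e ih =>
    rw [← List.append_assoc] at hA hnd ⊢
    have he := hA e (by simp)
    obtain ⟨t, n, l, rfl⟩ := hc.exists_pos he.1
    refine .snoc (ih (fun a ha => hA a (List.mem_append_left _ ha)) (List.nodup_append.1 hnd).1)
      ⟨_, .inl ⟨rfl, _, he.1, rfl⟩, .refl⟩ (Event.pos_ev _ _ _) (fun b hb hbp => ?_) he
    have := hc.eq_of_pos (hA b (List.mem_append_left _ hb)).1 he.1 hbp
    exact (List.nodup_append.1 hnd).2.2 b hb _ (by simp) this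

/-- A graph is its own guide. -/
lemma Run.self (hG : G.IsExecution P) {A : List (Event Tid Loc Val)} (hA : ∀ a ∈ A, a ∈ G.E)
    (hnd : A.Nodup) : Run P G Q G.rf A ⟨G, none, ∅⟩ :=
  Run.append (A := []) .nil hG (fun a ha => ⟨hA a ha, fun _ => Iff.rfl⟩) hnd

end Guide

namespace State

variable {P : Program Tid Loc Val} {nev : Tid × ℕ → Tid × ℕ → Prop} {G : ExecGraph Tid Loc Val}
  {S S' S₁ S₂ : State Tid Loc Val} {c c' c₁ c₂ : Guide Tid Loc Val}

lemma ext' {S₁ S₂ : State Tid Loc Val} (h1 : S₁.exe = S₂.exe) (h2 : S₁.rf = S₂.rf)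
    (h3 : S₁.co = S₂.co) (h4 : S₁.rev = S₂.rev) : S₁ = S₂ := by
  obtain ⟨⟩ := S₁
  obtain ⟨⟩ := S₂
  cases h1
  cases h2
  cases h3
  cases h4
  rfl

lemma OnTrack.self (hS : S.Inv P) :
    S.OnTrack P S.graph (fun _ _ => True) ⟨S.graph, none, ∅⟩ :=
  ⟨Guide.Run.self hS.exec (fun _ h => h) hS.nodup, by simp, fun _ _ _ _ => Iff.rfl⟩

/-- Two states on the way to `G` with the same events and the same `rf` edges have the same `co`
edges. -/
lemma OnTrack.co_eq (hG : G.IsExecution P) (hac : G.PoRfAcyclic) (hfin : G.E.Finite)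
    (hS₁ : S₁.Inv P) (hS₂ : S₂.Inv P)
    (h₁ : S₁.OnTrack P G (fun _ _ => True) c₁) (h₂ : S₂.OnTrack P G (fun _ _ => True) c₂)
    (hexe : S₁.exe = S₂.exe) (hrf : S₁.rf = S₂.rf) : S₁.co = S₂.co := by
  have hrun := h₁.run
  rw [hexe, hrf] at hrun
  obtain rfl := hrun.unique hG hac hfin h₂.run
  have hmem : ∀ x, S₁.graph.Mem x ↔ S₂.graph.Mem x := fun x => by
    simp [ExecGraph.Mem, State.graph, hexe]
  funext x y
  refine propext ⟨fun h => ?_, fun h => ?_⟩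
  · obtain ⟨h1, h2⟩ := hS₁.exec.co_mem h
    exact (h₂.co_iff x y ((hmem x).1 h1) ((hmem y).1 h2)).2 ((h₁.co_iff x y h1 h2).1 h)
  · obtain ⟨h1, h2⟩ := hS₂.exec.co_mem h
    exact (h₁.co_iff x y ((hmem x).2 h1) ((hmem y).2 h2)).2 ((h₂.co_iff x y h1 h2).1 h)

section

variable (hG : G.IsExecution P) (hac : G.PoRfAcyclic) (hfin : G.E.Finite)

include hG hac hfin

lemma OnTrack.parent (hS : S.Inv P) (h : S.Child P nev S')
    (h' : S'.OnTrack P G (fun _ _ => True) c') :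
    ∃ c, S.OnTrack P G (fun _ _ => True) c := by
  have hS' := hS.child h
  rcases h with ⟨t, n, l, m, -, he, rfl⟩ | ⟨t, n, l, r, r', a, -, hr⟩
  · obtain ⟨c, p, hc, -⟩ := h'.exists_settle he
    exact ⟨c, hc⟩
  · obtain ⟨p, D, -, hc⟩ := h'.of_reversal hG hac hfin hS hS' hr
    exact ⟨_, hc⟩

/-- A forward step and a reversal cannot both stay on the way to `G`. -/
lemma OnTrack.not_forward_of_reversal (hS : S.Inv P) {t : Tid} {n n' : ℕ}
    {l l' : Label Loc Val} {m r r' a : Event Tid Loc Val}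
    (he : S.graph.Fits P m (.ev t n l)) (hr : S.Reversal P (.ev t n' l') r r' a S')
    (hS' : S'.Inv P) (h₁ : (S.addEv m (.ev t n l)).OnTrack P G (fun _ _ => True) c₁)
    (h₂ : S'.OnTrack P G (fun _ _ => True) c₂) : False := by
  obtain ⟨p, D, -, hc⟩ := h₂.of_reversal hG hac hfin hS hS' hr
  obtain ⟨c, q, hc', hq, ⟨d, hd, -⟩, -⟩ := h₁.exists_settle he
  obtain rfl := hc'.run.unique hG hac hfin hc.run
  rcases hd with ⟨-, f, hf, hfq⟩ | ⟨-, w, q', m', e, h1, h2, h3, h4, -⟩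
  · exact he.pos_ne hf (hfq.trans hq.symm)
  · cases h1
    obtain ⟨m₂, hw⟩ := hr.fits
    obtain ⟨t', n'', l'', rfl⟩ : ∃ t' n'' l'', e = .ev t' n'' l'' := by
      obtain ⟨_, _, _, _, h, -⟩ := h4
      exact ⟨_, _, _, h⟩
    rw [← hq] at h3
    simp only [Event.pos, Option.some.injEq, Prod.mk.injEq] at h3
    obtain ⟨rfl, -⟩ := h3
    exact h2 (h4.eq_of_isWrite hw hr.isWrite rfl rfl)

/-- At most one of the recursive calls stays on the way to `G`. -/
lemma OnTrack.child_unique (hS : S.Inv P) (h₁ : S.Child P nev S₁) (h₂ : S.Child P nev S₂)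
    (h₁' : S₁.OnTrack P G (fun _ _ => True) c₁) (h₂' : S₂.OnTrack P G (fun _ _ => True) c₂) :
    S₁ = S₂ := by
  have hS₁ := hS.child h₁
  have hS₂ := hS.child h₂
  rcases h₁ with ⟨t, n, l, m, ht, he, rfl⟩ | ⟨t, n, l, r, r', a, ht, hr⟩
  · rcases h₂ with ⟨t₂, n₂, l₂, m₂, ht₂, he₂, rfl⟩ | ⟨t₂, n₂, l₂, r₂, r₂', a₂, ht₂, hr₂⟩
    · rw [ht] at ht₂
      cases ht₂
      obtain rfl : n = n₂ := (fits_index hS he).1.trans (fits_index hS he₂).1.symm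
      obtain ⟨c, p, hc, hp, ⟨d, hd, hch⟩, hag⟩ := h₁'.exists_settle he
      obtain ⟨c', p', hc', hp', ⟨d', hd', hch'⟩, hag'⟩ := h₂'.exists_settle he₂
      obtain rfl := hc.run.unique hG hac hfin hc'.run
      cases hp
      cases hp'
      have hv := (hc.run.valid hG hac hfin).1
      obtain rfl := hd.unique hv.exec hd'
      have hv₁ := (h₁'.run.valid hG hac hfin).1
      have hv₂ := (h₂'.run.valid hG hac hfin).1
      have hsrc : ∀ {m l} (c : Guide Tid Loc Val), S.graph.Fits P m (.ev t n l) →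
          Guide.Agrees (S.addEv m (.ev t n l)).rf (.ev t n l) c →
          ∀ w, c.H.rf w (.ev t n l) → w ∈ S.exe ∨ w.IsInit := by
        intro m l c he hag w hw
        rcases (hag.2 w).2 hw with h1 | ⟨h1, rfl, -⟩
        · exact absurd (.inr (hS.exec.rf_mem h1)) he.not_mem
        · obtain ⟨_, _, _, _, h2, _, _, _, h5, _⟩ := he
          exact (h5 fun h => (h2 ▸ h).not_isRead (h2 ▸ h1)).1.symm
      obtain rfl := Guide.chain_unique hv₁.acyclic hv₂.acyclic hch hch' rfl rfl hag.1 hag'.1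
        (fun w hw => (hsrc _ he hag w hw).imp_right .inl)
        fun w hw => (hsrc _ he₂ hag' w hw).imp_right .inl
      have hee := hv₁.exec.eq_of_pos hag.1 hag'.1 rfl
      cases hee
      have hrf : (S.addEv m (.ev t n l)).rf = (S.addEv m₂ (.ev t n l)).rf := by
        funext x y
        refine propext ?_
        by_cases hy : y = .ev t n l
        · subst hy
          exact (hag.2 x).trans (hag'.2 x).symm
        · simp [addEv, ExecGraph.add, hy]
      exact ext' rfl hrf (h₁'.co_eq hG hac hfin hS₁ hS₂ h₂' rfl hrf) rfl
    · rw [ht] at ht₂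
      cases ht₂
      exact (OnTrack.not_forward_of_reversal hG hac hfin hS he hr₂ hS₂ h₁' h₂').elim
  · rcases h₂ with ⟨t₂, n₂, l₂, m₂, ht₂, he₂, rfl⟩ | ⟨t₂, n₂, l₂, r₂, r₂', a₂, ht₂, hr₂⟩
    · rw [ht] at ht₂
      cases ht₂
      exact (OnTrack.not_forward_of_reversal hG hac hfin hS he₂ hr hS₁ h₂' h₁').elim
    · rw [ht] at ht₂
      cases ht₂
      obtain ⟨p, D, hp, hc⟩ := h₁'.of_reversal hG hac hfin hS hS₁ hr
      obtain ⟨p', D', hp', hc'⟩ := h₂'.of_reversal hG hac hfin hS hS₂ hr₂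
      have := hc.run.unique hG hac hfin hc'.run
      simp only [Guide.mk.injEq, Option.some.injEq, Prod.mk.injEq, true_and] at this
      obtain ⟨⟨hw, rfl⟩, -⟩ := this
      obtain rfl := hS.exec.eq_of_pos (G := S.graph) hr.mem hr₂.mem (hp.trans hp'.symm)
      obtain ⟨t₁, n₁, x, v₀, v, o, s, t', n', o', s', b, e1, e2, e3, rfl⟩ := hr.labels
      obtain ⟨t₁', n₁', x', v₀', v', o₂, s₂, t'', n'', o'', s'', b', e1', e2', e3', rfl⟩ :=
        hr₂.labels
      cases hw
      rw [e3] at e3'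
      cases e3'
      exact ext' rfl rfl (h₁'.co_eq hG hac hfin hS₁ hS₂ h₂' rfl rfl) rfl

end

/-- No recursive call stays on the way to the graph of its caller. -/
lemma OnTrack.not_child_self (hS : S.Inv P) (h : S.Child P nev S') :
    ¬ S'.OnTrack P S.graph (fun _ _ => True) c := by
  intro h'
  have hS' := hS.child h
  have hfin : S.graph.E.Finite := List.finite_toSet S.exe
  have hself := (OnTrack.self hS).run
  rcases h with ⟨t, n, l, m, ht, he, rfl⟩ | ⟨t, n, l, r, r', a, ht, hr⟩
  · obtain ⟨c', q, hc', hq, ⟨d, hd, -⟩, -⟩ := h'.exists_settle he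
    obtain rfl := hc'.run.unique hS.exec hS.acyclic hfin hself
    rcases hd with ⟨-, f, hf, hfq⟩ | ⟨-, w, q', m', e, h1, -⟩
    · exact he.pos_ne hf (hfq.trans hq.symm)
    · cases h1
  · obtain ⟨p, D, -, hc⟩ := h'.of_reversal hS.exec hS.acyclic hfin hS hS' hr
    cases hc.run.unique hS.exec hS.acyclic hfin hself

end State

section CallTree

variable {P : Program Tid Loc Val} {nev : Tid × ℕ → Tid × ℕ → Prop} {G : ExecGraph Tid Loc Val}
  {S S' : State Tid Loc Val} {c : Guide Tid Loc Val} {p q : List ℕ}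

lemma exists_onTrack_of_append (hG : G.IsExecution P) (hac : G.PoRfAcyclic) (hfin : G.E.Finite)
    (h : call P nev (p ++ q) = some S) (hS : S.OnTrack P G (fun _ _ => True) c) :
    ∃ S' c', call P nev p = some S' ∧ S'.OnTrack P G (fun _ _ => True) c' := by
  induction q using List.reverseRecOn generalizing S c with
  | nil => exact ⟨S, c, by simpa using h, hS⟩
  | append_singleton q i ih =>
    rw [← List.append_assoc] at h
    obtain ⟨S₁, h1, h2⟩ := call_concat.1 h
    have hinv := inv_of_call h1
    obtain ⟨c', hc'⟩ := hS.parent hG hac hfin hinv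
      ((hinv.mem_calls_iff.1 (List.mem_of_getElem? h2)).2)
    exact ih h1 hc'

/-- No two calls have the same graph. -/
lemma eq_of_graph_eq (hp : call P nev p = some S) (hq : call P nev q = some S')
    (h : S.graph = S'.graph) : p = q := by
  have hS := inv_of_call hp
  have hS' := inv_of_call hq
  have hfin : S.graph.E.Finite := List.finite_toSet S.exe
  have hSt := State.OnTrack.self hS
  have hSt' := State.OnTrack.self hS'
  rw [← h] at hSt'
  have hanc : ∀ {p q : List ℕ} {S₁ : State Tid Loc Val} {c : Guide Tid Loc Val},
      p <+: q → call P nev q = some S₁ → S₁.OnTrack P S.graph (fun _ _ => True) c →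
      ∃ S' c', call P nev p = some S' ∧ S'.OnTrack P S.graph (fun _ _ => True) c' := by
    rintro p q S₁ c ⟨r, rfl⟩ h1 h2
    exact exists_onTrack_of_append hS.exec hS.acyclic hfin h1 h2
  -- the two positions agree as far as both are defined
  have key : ∀ k ≤ p.length, k ≤ q.length → p.take k = q.take k := by
    intro k
    induction k with
    | zero => simp
    | succ k ih =>
      intro h1 h2
      have h3 := ih (by omega) (by omega)
      obtain ⟨S₁, c₁, hS₁, hc₁⟩ := hanc (List.take_prefix (k + 1) p) hp hSt
      obtain ⟨S₂, c₂, hS₂, hc₂⟩ := hanc (List.take_prefix (k + 1) q) hq hSt'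
      rw [List.take_add_one, List.getElem?_eq_getElem h1, Option.toList_some] at hS₁ ⊢
      rw [List.take_add_one, List.getElem?_eq_getElem h2, Option.toList_some] at hS₂ ⊢
      rw [← h3] at hS₂ ⊢
      obtain ⟨S₀, h4, h5⟩ := call_concat.1 hS₁
      obtain ⟨S₀', h4', h6⟩ := call_concat.1 hS₂
      rw [h4] at h4'
      cases h4'
      have hinv := inv_of_call h4
      obtain rfl := State.OnTrack.child_unique hS.exec hS.acyclic hfin hinv
        (hinv.mem_calls_iff.1 (List.mem_of_getElem? h5)).2
        (hinv.mem_calls_iff.1 (List.mem_of_getElem? h6)).2 hc₁ hc₂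
      obtain ⟨hl, -⟩ := List.getElem?_eq_some_iff.1 h5
      rw [(List.getElem?_inj hl hinv.nodup_calls).1 (h5.trans h6.symm)]
  have hlt : ∀ {p q : List ℕ} {S₁ S₂ : State Tid Loc Val}, call P nev p = some S₁ →
      call P nev q = some S₂ → S₁.graph = S.graph →
      S₂.OnTrack P S.graph (fun _ _ => True) ⟨S.graph, none, ∅⟩ → p <+: q → p = q := by
    rintro p q S₁ S₂ h1 h2 h3 h4 ⟨r, rfl⟩
    rcases r with _ | ⟨i, r⟩
    · simp
    · exfalso
      obtain ⟨S₃, c₃, h5, h6⟩ := hanc (p := p ++ [i]) ⟨r, by simp⟩ h2 h4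
      obtain ⟨S₀, h7, h8⟩ := call_concat.1 h5
      rw [h1] at h7
      cases h7
      have hinv := inv_of_call h1
      rw [← h3] at h6
      exact State.OnTrack.not_child_self hinv
        (hinv.mem_calls_iff.1 (List.mem_of_getElem? h8)).2 h6
  rcases le_total p.length q.length with hle | hle
  · refine hlt hp hq rfl hSt' ?_
    have := key p.length le_rfl hle
    rw [List.take_length] at this
    rw [this]
    exact List.take_prefix _ _
  · refine (hlt hq hp h.symm hSt ?_).symm
    have := key q.length hle le_rfl
    rw [List.take_length] at this
    rw [← this]
    exact List.take_prefix _ _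

end CallTree

/-! ### Consistency on the way to a full graph -/

namespace ExecGraph

variable {P : Program Tid Loc Val} {G : ExecGraph Tid Loc Val} {m e : Event Tid Loc Val}

lemma Consistent.co_not_init (h : G.Consistent P) (hG : G.IsExecution P)
    {a b : Event Tid Loc Val} (hab : G.co a b) : ¬ b.IsInit := by
  intro hb
  obtain ⟨h1, -, -, -, x, h4, h5⟩ := hG.co_wf _ _ hab
  obtain ⟨y, rfl⟩ := Event.isInit_iff.1 hb
  cases h5
  rcases a with z | ⟨t, n, l⟩
  · cases h4
    exact hG.co_irrefl _ hab
  · exact h.coherent (.init x) ⟨_, .single (.inl ⟨.inl trivial, h1, trivial⟩),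
      .single (.single (.inl (.inr hab)))⟩

/-- A thread with a next action can execute it in a maximal way. -/
lemma exists_fits_isMax (hG : G.IsExecution P) (hfin : G.E.Finite) {t : Tid}
    {h : List (Label Loc Val)} (H : G.IsHistory t h) {a : Act Loc Val}
    (ha : P.next t h = some a) :
    ∃ m l, G.Fits P m (.ev t h.length l) ∧ a.Matches l ∧
      (¬ (Event.ev t h.length l).IsFence → G.IsMax m) := by
  rcases a with ⟨x, o, s⟩ | ⟨x, v, o, s, b⟩ | ⟨o, s⟩
  · obtain ⟨m, hm, hmw, hmx, hmax⟩ := exists_isMax hG hfin x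
    obtain ⟨v, hv⟩ := State.exists_writes (P := P) hmw hmx
    refine ⟨m, .read x v o s, ⟨t, h, _, _, rfl, H, ha, ⟨v, rfl⟩,
      fun _ => ⟨hm, hmw, x, hmx, rfl⟩, ?_⟩, ⟨v, rfl⟩, fun _ => hmax⟩
    rintro _ _ _ _ ⟨⟩
    exact hv
  · obtain ⟨m, hm, hmw, hmx, hmax⟩ := exists_isMax hG hfin x
    refine ⟨m, .write x v o s b, ⟨t, h, _, _, rfl, H, ha, rfl,
      fun _ => ⟨hm, hmw, x, hmx, rfl⟩, ?_⟩, rfl, fun _ => hmax⟩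
    rintro _ _ _ _ ⟨⟩
  · refine ⟨.ev t h.length (.fence o s), .fence o s, ⟨t, h, _, _, rfl, H, ha, rfl,
      fun h => (h trivial).elim, ?_⟩, rfl, fun h => (h trivial).elim⟩
    rintro _ _ _ _ ⟨⟩

lemma Fits.isHistory_add (hG : G.IsExecution P) (he : G.Fits P m e) {t : Tid}
    {h : List (Label Loc Val)} (H : (G.add m e).IsHistory t h) :
    (G.IsHistory t h ∧ ∀ n l, e ≠ .ev t n l) ∨
      ∃ h' l, h = h' ++ [l] ∧ e = .ev t h'.length l ∧ G.IsHistory t h' := by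
  obtain ⟨t', h', a, l, rfl, H', -⟩ := he
  by_cases ht : t = t'
  · subst ht
    exact .inr ⟨h', l, H.unique H'.add, rfl, H'⟩
  · obtain ⟨h₁, H₁, -⟩ := hG.history t
    rw [H.unique (H₁.add_of_ne ht)]
    refine .inl ⟨H₁, fun n l h => ?_⟩
    cases h
    exact ht rfl

end ExecGraph

namespace Guide

variable {P : Program Tid Loc Val} {G : ExecGraph Tid Loc Val} {T T' : Set (Tid × ℕ)}
  {A : List (Event Tid Loc Val)} {p : Tid × ℕ} {c c' : Guide Tid Loc Val}
  {rf : Event Tid Loc Val → Event Tid Loc Val → Prop}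

/-- The guide is consistent. Moreover, a thread that is in the middle of an RMW in the guide is
about to perform the awaited write, or it has executed its read already, from a `co`-maximal write,
so that the guide remains consistent if it completes the RMW. -/
def Good (P : Program Tid Loc Val) (T : Set (Tid × ℕ)) (c : Guide Tid Loc Val) : Prop :=
  c.H.Consistent P ∧ ∀ t h n x v o s, c.H.IsHistory t h → h.length = n + 1 →
    P.next t h = some (.write x v o s true) →
    (∃ w q, c.target = some (w, q) ∧ w.pos = some (t, n + 1)) ∨
      ((t, n) ∈ T ∧ ∀ l m, c.H.rf m (.ev t n l) → c.H.IsMax m)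

lemma Good.mono (h : Good P T c) (hT : T ⊆ T') : Good P T' c :=
  ⟨h.1, fun t hh n x v o s H hl hn => (h.2 t hh n x v o s H hl hn).imp_right
    fun h => ⟨hT h.1, h.2⟩⟩

lemma Settle.good (h : Good P (posSet A) c) (hs : Settle P (Good P) A p c c') :
    Good P (insert p (posSet A)) c' := by
  obtain ⟨d, hd, hch⟩ := hs
  rcases ReflTransGen.cases_tail hch with rfl | ⟨d', -, hlast⟩
  · rcases hd with ⟨rfl, -⟩ | ⟨-, w, q, m, e, -, -, -, -, -, -, hg⟩
    · exact h.mono (Set.subset_insert _ _)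
    · exact hg
  · obtain ⟨-, -, f, w, m, e, -, -, -, -, -, -, -, -, -, -, -, hg⟩ := hlast
    exact hg

lemma Run.good (hG : G.IsFull P) (h : Run P G (Good P) rf A c) : Good P (posSet A) c := by
  induction h with
  | nil =>
    refine ⟨hG.consistent, fun t h n x v o s H hl hn => ?_⟩
    rw [hG.finished t h H] at hn
    cases hn
  | snoc h hs hp hA ha ih =>
    rw [posSet_concat hp]
    exact hs.good ih

end Guide

namespace State

open Guide

variable {P : Program Tid Loc Val} {nev : Tid × ℕ → Tid × ℕ → Prop} {G : ExecGraph Tid Loc Val}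
  {S S' : State Tid Loc Val} {c c' d : Guide Tid Loc Val} {t : Tid}

lemma hist_eq_take (hS : S.Inv P) {H : ExecGraph Tid Loc Val} (hsub : ∀ e ∈ S.exe, e ∈ H.E)
    {h : List (Label Loc Val)} (Hh : H.IsHistory t h) :
    S.hist t = h.take (S.hist t).length ∧ (S.hist t).length ≤ h.length := by
  have key : ∀ n l, (S.hist t)[n]? = some l → h[n]? = some l := fun n l hl =>
    (Hh n l).1 (hsub _ ((hS.isHistory t n l).2 hl))
  have hlen : (S.hist t).length ≤ h.length := by
    by_contra! hlt
    have h1 := key h.length _ (List.getElem?_eq_getElem hlt)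
    simp at h1
  refine ⟨List.ext_getElem? fun n => ?_, hlen⟩
  by_cases hn : n < (S.hist t).length
  · rw [List.getElem?_take_of_lt hn, key n _ (List.getElem?_eq_getElem hn),
      List.getElem?_eq_getElem hn]
  · rw [List.getElem?_eq_none (by omega), List.getElem?_eq_none (by simp; omega)]

lemma mem_posSet_iff (hS : S.Inv P) {n : ℕ} :
    (t, n) ∈ posSet S.exe ↔ n < (S.hist t).length := by
  constructor
  · rintro ⟨b, hb, hbp⟩
    obtain ⟨l, rfl⟩ := Event.pos_eq_some.1 hbp
    exact (hS.isHistory t).lt_length hb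
  · exact fun hn => ⟨_, (hS.isHistory t).mem_of_lt hn, rfl⟩

/-- The scheduler completes an RMW at once. -/
lemma eq_of_pending (hS : S.Inv P) (hcand : S.Candidate P t) {H : ExecGraph Tid Loc Val}
    (hsub : ∀ e ∈ S.exe, e ∈ H.E) {t' : Tid} {h : List (Label Loc Val)} (Hh : H.IsHistory t' h)
    {n : ℕ} (hn : h.length = n + 1) {x : Loc} {v : Val} {o : MemOrd} {s : Scope}
    (hnext : P.next t' h = some (.write x v o s true)) (hmem : (t', n) ∈ posSet S.exe) :
    t' = t := by
  obtain ⟨h1, h2⟩ := hist_eq_take hS hsub Hh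
  have h3 := (mem_posSet_iff hS).1 hmem
  rw [List.take_of_length_le (by omega)] at h1
  have hpend : S.PendingRmw P t' :=
    ⟨.write x v o s true, by rw [State.nextAct, h1, hnext], by simp [Act.IsRmwWrite]⟩
  exact hS.pending_eq_of_candidate hpend hcand

lemma not_pos_of_length {p : Tid × ℕ} (hS : S.Inv P) (hp : p = (t, (S.hist t).length)) :
    ∀ b ∈ S.exe, b.pos ≠ some p := by
  rintro b hb hbp
  rw [hp] at hbp
  exact lt_irrefl _ ((mem_posSet_iff hS).1 ⟨b, hb, hbp⟩)

/-- The next event is in the guide or can be added to it. -/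
lemma exists_start (hG : G.IsFull P) (hS : S.Inv P) (hcand : S.Candidate P t)
    (hv : Valid P G S.exe (posSet S.exe) c) (hgood : Good P (posSet S.exe) c)
    (hno : ∀ w q, c.target = some (w, q) → w.pos ≠ some (t, (S.hist t).length)) :
    ∃ c', Start P (Good P) S.exe (t, (S.hist t).length) c c' ∧
      ∃ f ∈ c'.H.E, f.pos = some (t, (S.hist t).length) := by
  by_cases hf : ∃ f ∈ c.H.E, f.pos = some (t, (S.hist t).length)
  · exact ⟨c, .inl ⟨rfl, hf⟩, hf⟩
  push Not at hf
  obtain ⟨h, Hh, -⟩ := hv.exec.history t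
  -- the thread has executed all its events in the guide
  have hh : S.hist t = h := by
    obtain ⟨h1, h2⟩ := hist_eq_take hS hv.sub Hh
    rw [h1]
    refine List.take_of_length_le ?_
    by_contra! hlt
    exact hf _ (Hh.mem_of_lt hlt) rfl
  obtain ⟨a, ha⟩ := Option.ne_none_iff_exists'.1 hcand.1
  rw [State.nextAct, hh] at ha
  rw [hh] at hf hno ⊢
  obtain ⟨m, l, hfit, hal, hmax⟩ := ExecGraph.exists_fits_isMax hv.exec hv.finite Hh ha
  cases htgt : c.target with
  | none =>
    obtain ⟨rfl, -⟩ := hv.of_none htgt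
    rw [hG.finished t h Hh] at ha
    cases ha
  | some wq =>
    obtain ⟨w, q⟩ := wq
    have hew : Event.ev t h.length l ≠ w := fun hew => hno w q htgt (hew ▸ rfl)
    refine ⟨⟨c.H.add m (.ev t h.length l), c.target, c.postponed⟩, .inr ⟨hf, w, q, m, _, htgt, hew,
      rfl, hfit, hmax, rfl, ?_, ?_⟩, _, .inl rfl, rfl⟩
    · refine hgood.1.add hv.exec hfit hmax ?_
      rintro r w' ⟨t', n', x', v', o', s', v'', o'', s'', rfl, h2⟩ hrf
      simp only [Event.ev.injEq] at h2
      obtain ⟨rfl, hlen, rfl⟩ := h2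
      have hw : ∃ x v o s, P.next t h = some (.write x v o s true) := by
        rcases a with ⟨x, o, s⟩ | ⟨x, v, o, s, b⟩ | ⟨o, s⟩
        · obtain ⟨v, hv⟩ := hal
          cases hv
        · cases hal
          exact ⟨_, _, _, _, ha⟩
        · cases hal
      obtain ⟨x, v, o, s, hnext⟩ := hw
      rcases hgood.2 t h n' x v o s Hh hlen hnext with ⟨w₁, q₁, h3, h4⟩ | ⟨-, h3⟩
      · rw [htgt] at h3
        cases h3
        exact absurd (hlen ▸ h4) (hno _ _ htgt)
      · exact h3 _ _ hrf
    · intro t' h' n x v o s H' hlen hnext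
      rcases hfit.isHistory_add hv.exec H' with ⟨H₁, hne⟩ | ⟨h₁, l₁, rfl, heq, H₁⟩
      · rcases hgood.2 t' h' n x v o s H₁ hlen hnext with h3 | ⟨h3, -⟩
        · exact .inl h3
        · exfalso
          obtain rfl := eq_of_pending hS hcand hv.sub H₁ hlen hnext h3
          exact hne _ _ rfl
      · simp only [Event.ev.injEq] at heq
        obtain ⟨rfl, -, rfl⟩ := heq
        obtain rfl := Hh.unique H₁
        have hn : n = h.length := by simpa using hlen.symm
        subst hn
        refine .inr ⟨.inl rfl, fun l' m' hm' => ?_⟩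
        obtain ⟨h₂, v₂, o₂, s₂, h5⟩ := P.rmw_wf _ _ _ _ _ _ hnext
        obtain ⟨-, h6⟩ := List.append_inj' h5 rfl
        simp only [List.cons.injEq, and_true] at h6
        subst h6
        rcases hm' with hm' | ⟨-, rfl, -⟩
        · exact absurd rfl (hf _ (hv.exec.rf_mem hm'))
        · rintro b (hb | ⟨hb, -⟩)
          · exact hmax id _ hb
          · exact hb

end State

/-! ### Forward steps on the way to a full graph -/

namespace Guide

variable {P : Program Tid Loc Val} {G : ExecGraph Tid Loc Val}
  {Q : Set (Tid × ℕ) → Guide Tid Loc Val → Prop}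
  {A : List (Event Tid Loc Val)} {p : Tid × ℕ} {c c' : Guide Tid Loc Val}

lemma Postpone.good (h : Postpone P (Good P) A p c c') : Good P (insert p (posSet A)) c' := by
  obtain ⟨-, -, f, w, m, e, -, -, -, -, -, -, -, -, -, -, -, hg⟩ := h
  exact hg

lemma Postpone.exists_read (h : Postpone P Q A p c c') :
    ∃ e ∈ c'.H.E, e.pos = some p ∧ e.IsRead := by
  obtain ⟨-, -, f, w, m, e, -, -, -, -, -, -, hep, her, -, -, rfl, -⟩ := h
  exact ⟨e, .inl rfl, hep, her⟩

lemma chain_postponed_subset (h : ReflTransGen (Postpone P Q A p) c c') :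
    c'.postponed ⊆ insert p c.postponed := by
  induction h with
  | refl => exact Set.subset_insert _ _
  | tail _ h ih => exact h.postponed_eq ▸ Set.insert_subset (Set.mem_insert _ _) ih

end Guide

namespace State

open Guide

variable {P : Program Tid Loc Val} {nev : Tid × ℕ → Tid × ℕ → Prop} {G : ExecGraph Tid Loc Val}
  {Q : Set (Tid × ℕ) → Guide Tid Loc Val → Prop}
  {S S' : State Tid Loc Val} {c c' d : Guide Tid Loc Val} {t : Tid} {p : Tid × ℕ}
  {f w : Event Tid Loc Val}

lemma Follows.settle (h : S.Follows P c) (hs : Settle P Q S.exe p c c')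
    (hp : ∀ b ∈ S.exe, b.pos ≠ some p) {T : Set (Tid × ℕ)} (hv : Valid P G S.exe T c') :
    S.Follows P c' :=
  ⟨hv.exec, fun e he => ⟨hv.sub e he, fun x => ((h.agrees e he).2 x).trans (hs.rf_iff he hp).symm⟩,
    fun a b ha hb => (h.co_iff a b ha hb).trans (hs.co_iff hp ha.symm hb.symm)⟩

section GraphEq

variable {H : ExecGraph Tid Loc Val} {Z : Set (Event Tid Loc Val)}

lemma agrees_of_graph_eq (hZ : H.UpClosed Z) (h : S.graph = H.del Z)
    {y : Event Tid Loc Val} (hy : y ∈ S.exe) : y ∈ H.E ∧ ∀ x, S.rf x y ↔ H.rf x y := by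
  have hy' : y ∈ (H.del Z).E := h ▸ (show y ∈ S.graph.E from hy)
  have hrf : S.rf = (H.del Z).rf := by rw [← h]; rfl
  refine ⟨hy'.1, fun x => ?_⟩
  rw [hrf]
  exact ⟨fun h => h.1, fun h => ⟨h, fun hx => hy'.2 (hZ.closed _ _ (.inr h) hx), hy'.2⟩⟩

lemma co_iff_of_graph_eq (hH : H.IsExecution P) (hZ : H.UpClosed Z) (h : S.graph = H.del Z)
    {x y : Event Tid Loc Val} (hx : S.graph.Mem x) (hy : S.graph.Mem y) :
    S.co x y ↔ H.co x y := by
  have hco : S.co = (H.del Z).co := by rw [← h]; rfl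
  rw [h, ExecGraph.mem_del hH hZ] at hx hy
  rw [hco]
  exact ⟨fun h => h.1, fun h => ⟨h, hx.2, hy.2⟩⟩

end GraphEq

/-- A read whose source has not been executed yet can be postponed without losing consistency. -/
lemma exists_postpone (hS : S.Inv P) (hcand : S.Candidate P t) {T : Set (Tid × ℕ)}
    (hv : Valid P G S.exe T d) (hfol : S.Follows P d) (hcons : d.H.Consistent P)
    (hp : p = (t, (S.hist t).length)) (hf : f ∈ d.H.E) (hfp : f.pos = some p)
    (hwf : d.H.rf w f) (hwi : ¬ w.IsInit) (hwA : w ∉ S.exe) :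
    ∃ d', Postpone P (Good P) S.exe p d d' := by
  have hfA : f ∉ S.exe := fun h => not_pos_of_length hS hp f h hfp
  have hwE := ((hv.exec.rf_wf _ _ hwf).1).resolve_left hwi
  have hcl : ∀ a b, d.H.porf a b → b ∈ S.exe → a ∈ S.exe ∨ a.IsInit :=
    fun a b hab hb => hfol.closed hS hab hb
  have hup := upClosed_rest (w := w) hv.exec hcl
  have hK := hv.exec.del hup
  have hsubK : ∀ e ∈ S.exe, e ∈ (d.H.del (rest d.H S.exe w)).E := fun e he =>
    ⟨hv.sub e he, fun h => h.2.1 he⟩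
  have hfr := mem_rest_of_rf hv.exec hv.acyclic hfA hwf
  obtain ⟨l, rfl⟩ : ∃ l, f = .ev t (S.hist t).length l := Event.pos_eq_some.1 (hp ▸ hfp)
  obtain ⟨h, Hh, hnext⟩ := hv.exec.history t
  obtain ⟨a, ha, hal⟩ := hnext _ _ ((Hh _ _).1 hf)
  have hlen : (h.take (S.hist t).length).length = (S.hist t).length := by
    rw [List.length_take, min_eq_left (Hh.lt_length hf).le]
  have Hn : (d.H.del (rest d.H S.exe w)).IsHistory t (h.take (S.hist t).length) := by
    refine ExecGraph.isHistory_del_of_first hup Hh hfr fun k l' hk hd => ?_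
    have h1 := (hS.isHistory t).mem_of_lt hk
    have h2 := hv.exec.eq_of_pos (hv.sub _ h1) hd.1 rfl
    exact hd.2.1 (h2 ▸ h1)
  obtain ⟨m, l', hfit, hal', hmax⟩ :=
    ExecGraph.exists_fits_isMax hK (hv.finite.subset Set.sdiff_subset) Hn ha
  rw [hlen] at hfit hmax
  have hread := hv.exec.rf_read hwf
  have hread' : (Event.ev t (S.hist t).length l').IsRead := by
    rcases l with ⟨x, v, o, s⟩ | _ | _
    · rcases a with ⟨x', o', s'⟩ | _ | _
      · obtain ⟨v', rfl⟩ := hal'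
        trivial
      · cases hal
      · cases hal
    · exact hread.elim
    · exact hread.elim
  refine ⟨_, hfol.exec, hcl, _, w, m, _, hf, hfp, hfA, hwf, hwE, hwA, (hp ▸ rfl), hread', hfit,
    hmax fun h => h.not_isRead hread', rfl, ?_, ?_⟩
  · refine ((ExecGraph.del_sub _ _).consistent hcons).add hK hfit hmax ?_
    rintro r w' ⟨t', n', x', v', o', s', v'', o'', s'', -, h2⟩
    rw [h2] at hread'
    exact hread'.elim
  intro t' h' n x v o s H' hlen' hnext'
  obtain ⟨h₂, v₂, o₂, s₂, h5⟩ := P.rmw_wf _ _ _ _ _ _ hnext'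
  rcases hfit.isHistory_add hK H' with ⟨H₁, hne⟩ | ⟨h₁, l₁, rfl, heq, H₁⟩
  · -- a thread in the middle of an RMW, other than the thread of the postponed read
    left
    have hn : n < h'.length := by omega
    have hrK := H₁.mem_of_lt hn
    have hrS : .ev t' n h'[n] ∉ S.exe := fun hr => by
      obtain rfl := eq_of_pending hS hcand hsubK H₁ hlen' hnext' ⟨_, hr, rfl⟩
      exact hne _ _ rfl
    have hrr : (Event.ev t' n h'[n]).IsRead := by
      subst h5
      have : n = h₂.length := by simpa using hlen'.symm
      subst this
      simp [Event.IsRead]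
    have hrw : TransGen d.H.porf (.ev t' n h'[n]) w :=
      by_contra fun h => hrK.2 ⟨hrK.1, hrS, h⟩
    obtain ⟨z, hz, hzw⟩ := hv.exec.exists_po_of_read hrr hrw
    obtain ⟨tz, k, lz, rfl⟩ := hv.exec.exists_pos hz.mem_right
    obtain ⟨rfl, hk⟩ : t' = tz ∧ n < k := hz.2.2
    have hnK : ∀ l, .ev t' (n + 1) l ∉ (d.H.del (rest d.H S.exe w)).E := fun l hl =>
      absurd (H₁.lt_length hl) (by omega)
    have hrest : ∀ l, .ev t' (n + 1) l ∈ d.H.E → ¬ TransGen d.H.porf (.ev t' (n + 1) l) w :=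
      fun l hl h => hnK l ⟨hl, fun h' => h'.2.2 h⟩
    rcases (Nat.succ_le_of_lt hk).eq_or_lt with hk' | hk'
    · subst hk'
      rcases reflTransGen_iff_eq_or_transGen.1 hzw with rfl | h6
      · exact ⟨_, _, rfl, rfl⟩
      · exact absurd h6 (hrest _ hz.mem_right)
    · obtain ⟨l₃, hl₃⟩ := hv.exec.exists_mem_of_lt hz.mem_right hk'
      exact absurd (TransGen.head' (.inl ⟨.inr hl₃, hz.2.1, rfl, hk'⟩) hzw) (hrest _ hl₃)
  · right
    simp only [Event.ev.injEq] at heq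
    obtain ⟨rfl, h6, rfl⟩ := heq
    have hn : n = (S.hist t).length := by
      rw [h6]
      simpa using hlen'.symm
    subst hn
    refine ⟨.inl hp.symm, fun l₃ m' hm' => ?_⟩
    obtain ⟨-, h7⟩ := List.append_inj' h5 rfl
    simp only [List.cons.injEq, and_true] at h7
    subst h7
    rcases hm' with hm' | ⟨-, rfl, -⟩
    · exact absurd (hK.rf_mem hm') fun h => hfit.pos_ne h rfl
    · rintro b (hb | ⟨hb, -⟩)
      · exact hmax id _ hb
      · exact hb

/-- Reads are postponed until their source has been executed. -/
lemma exists_chain (hS : S.Inv P) (hcand : S.Candidate P t)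
    (hp : p = (t, (S.hist t).length))
    (hv : Valid P G S.exe (insert p (posSet S.exe)) d) (hfol : S.Follows P d)
    (hcons : d.H.Consistent P) (hf : ∃ f ∈ d.H.E, f.pos = some p) :
    ∃ d', ReflTransGen (Postpone P (Good P) S.exe p) d d' ∧
      ∃ f ∈ d'.H.E, f.pos = some p ∧ ∀ w, d'.H.rf w f → w ∈ S.exe ∨ w.IsInit := by
  induction hk : ({x | x ∈ d.H.E ∧ x.pos ≠ some p} : Set (Event Tid Loc Val)).ncard
    using Nat.strong_induction_on generalizing d with
  | _ k ih =>
    obtain ⟨f, hf, hfp⟩ := hf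
    by_cases hsrc : ∀ w, d.H.rf w f → w ∈ S.exe ∨ w.IsInit
    · exact ⟨d, .refl, f, hf, hfp, hsrc⟩
    push Not at hsrc
    obtain ⟨w, hwf, hwA, hwi⟩ := hsrc
    obtain ⟨d', hd'⟩ := exists_postpone hS hcand hv hfol hcons hp hf hfp hwf hwi hwA
    have hv' := hv.postpone (Set.mem_insert _ _) hd'
    have hfol' := hfol.settle ⟨d, .inl ⟨rfl, f, hf, hfp⟩, .single hd'⟩ (not_pos_of_length hS hp) hv'
    obtain ⟨e, he, hep, -⟩ := hd'.exists_read
    have hwd' := (chain_source_notMem hv.acyclic hd' .refl hf hfp hwf).1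
    have hwp : w.pos ≠ some p := fun h =>
      (hv.exec.rf_read hwf).not_isWrite (hv.exec.eq_of_pos
        ((hv.exec.rf_wf _ _ hwf).1.resolve_left hwi) hf (h.trans hfp.symm) ▸ hv.exec.rf_write hwf)
    have hlt : ({x | x ∈ d'.H.E ∧ x.pos ≠ some p} : Set (Event Tid Loc Val)).ncard < k := by
      rw [← hk]
      refine Set.ncard_lt_ncard ⟨fun x hx => ⟨(hd'.mem hx.1).resolve_right hx.2, hx.2⟩, fun h => ?_⟩
        (hv.finite.subset fun x hx => hx.1)
      exact hwd' (h ⟨(hv.exec.rf_wf _ _ hwf).1.resolve_left hwi, hwp⟩).1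
    obtain ⟨d'', h1, h2⟩ := ih _ hlt hv' hfol' hd'.good.1 ⟨e, he, hep⟩ rfl
    exact ⟨d'', .head hd' h1, h2⟩

/-- If the next event is not the awaited write, then some forward step stays on the way to `G`. -/
lemma OnTrack.exists_forward (hG : G.IsFull P) (hfin : G.E.Finite) (hS : S.Inv P)
    (ht : S.nextThread P nev = some t) (h : S.OnTrack P G (Good P) c)
    (hno : ∀ w q, c.target = some (w, q) → w.pos ≠ some (t, (S.hist t).length)) :
    ∃ S' c', S.Child P nev S' ∧ S'.OnTrack P G (Good P) c' := by
  have hcand := nextThread_candidate ht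
  have hv := (h.run.valid hG.isExecution hG.consistent.poRfAcyclic hfin).1
  have hfol := h.follows hG.isExecution hG.consistent.poRfAcyclic hfin
  have hgood := h.run.good hG
  obtain ⟨p, hp⟩ : ∃ p, p = (t, (S.hist t).length) := ⟨_, rfl⟩
  have hpA := not_pos_of_length hS hp
  obtain ⟨c₁, hst, hf₁⟩ := exists_start hG hS hcand hv hgood hno
  rw [← hp] at hst hf₁
  have hs₁ : Settle P (Good P) S.exe p c c₁ := ⟨c₁, hst, .refl⟩
  have hv₁ := hv.settle hs₁
  obtain ⟨d, hch, f, hf, hfp, hsrc⟩ := exists_chain hS hcand hp hv₁ (hfol.settle hs₁ hpA hv₁)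
    (hs₁.good hgood).1 hf₁
  have hs : Settle P (Good P) S.exe p c d := ⟨c₁, hst, hch⟩
  have hvd := hv.settle hs
  have hfold := hfol.settle hs hpA hvd
  have hup := hfold.upClosed hS
  have hfu : f ∈ S.unseen d := ⟨hf, fun h => hpA f h hfp⟩
  have hins : insert f (S.unseen d \ {f}) = S.unseen d := Set.insert_sdiff_self_of_mem hfu
  obtain ⟨l, rfl⟩ : ∃ l, f = .ev t (S.hist t).length l := Event.pos_eq_some.1 (hp ▸ hfp)
  -- everything before the event has been executed
  have hZ : d.H.UpClosed (S.unseen d \ {.ev t (S.hist t).length l}) := by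
    refine ⟨fun x hx => hx.1.1, fun x y hxy hx => ⟨hup.closed x y hxy hx.1, ?_⟩⟩
    rintro rfl
    rcases hxy with hpo | hrf
    · obtain ⟨t', n', l', rfl⟩ := hvd.exec.exists_pos hx.1.1
      obtain ⟨rfl, hlt⟩ := hpo.2.2
      have h1 := (hS.isHistory t').mem_of_lt hlt
      exact hx.1.2 (hvd.exec.eq_of_pos hx.1.1 (hvd.sub _ h1) rfl ▸ h1)
    · exact (hsrc x hrf).elim hx.1.2 (hvd.exec.not_isInit hx.1.1)
  obtain ⟨m, hfit, -, -, heq⟩ := ExecGraph.exists_del_eq_add hvd.exec hvd.finite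
    (fun a b hab => (hs.good hgood).1.co_not_init hvd.exec hab) hZ (hins.symm ▸ hup) hf
    fun h => h.2 rfl
  rw [hins, ← hfold.graph_eq hS] at hfit heq
  rw [← graph_addEv] at heq
  refine ⟨_, d, .forward t _ l m ht hfit rfl, .snoc (h.run.congr fun a ha x => ?_) hs hfp hpA
    (agrees_of_graph_eq hZ heq.symm (by simp [addEv])), ?_,
    fun x y hx hy => co_iff_of_graph_eq hvd.exec hZ heq.symm hx hy⟩
  · refine ⟨.inl, fun h' => h'.resolve_right fun h' => hpA a ha (h'.2.2 ▸ hfp)⟩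
  · intro e he q hq heq'
    have hq' := chain_postponed_subset hch hq
    rw [hst.postponed_eq] at hq'
    rcases List.mem_append.1 he with he | he
    · rcases hq' with rfl | hq'
      · exact absurd heq' (hpA e he)
      · exact .inl (h.reversible e he q hq' heq')
    · obtain rfl := List.mem_singleton.1 he
      obtain rfl : p = q := by
        rw [hfp] at heq'
        exact Option.some.inj heq'
      refine .inr ⟨rfl, ?_⟩
      rcases ReflTransGen.cases_tail hch with rfl | ⟨d', -, hlast⟩
      · rw [hst.postponed_eq] at hq
        obtain ⟨b, hb, hbp⟩ := hv.postponed_sub hq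
        exact absurd hbp (hpA b hb)
      · obtain ⟨e, he', hep, her⟩ := hlast.exists_read
        exact hvd.exec.eq_of_pos he' hf (hep.trans hfp.symm) ▸ her

end State

/-! ### Reversals on the way to a full graph -/

namespace Guide

variable {P : Program Tid Loc Val} {G : ExecGraph Tid Loc Val}
  {Q : Set (Tid × ℕ) → Guide Tid Loc Val → Prop} {L : List (Event Tid Loc Val)} {q : Tid × ℕ}
  {c : Guide Tid Loc Val} {w : Event Tid Loc Val}
  {rf : Event Tid Loc Val → Event Tid Loc Val → Prop}

/-- If a write is awaited, then some read has been postponed, and none after the last one. -/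
lemma Run.exists_last_postpone (h : Run P G Q rf L c) (ht : c.target = some (w, q)) :
    ∃ A r Y cA d₀ d c₁, L = A ++ r :: Y ∧ Run P G Q rf A cA ∧ Start P Q A q cA d₀ ∧
      ReflTransGen (Postpone P Q A q) d₀ d ∧ Postpone P Q A q d c₁ ∧ r.pos = some q ∧
      (∀ b ∈ A, b.pos ≠ some q) ∧ Agrees rf r c₁ ∧ c₁.target = some (w, q) ∧
      Calm P Q rf (A ++ [r]) c₁ Y c := by
  induction h with
  | nil => cases ht
  | @snoc A' c c' p e hrun hs hp hA ha ih =>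
    obtain ⟨d₀, hd₀, hch⟩ := hs
    rcases ReflTransGen.cases_tail hch with rfl | ⟨d, hd, hlast⟩
    · obtain ⟨A, r, Y, cA, d₁, d, c₁, rfl, h1, h2, h3, h4, h5, h6, h7, h8, h9⟩ :=
        ih (hd₀.target_eq.symm.trans ht)
      refine ⟨A, r, Y ++ [e], cA, d₁, d, c₁, by simp, h1, h2, h3, h4, h5, h6, h7, h8, ?_⟩
      exact .snoc h9 (by simpa using hd₀) hp (by simpa using hA) ha
    · have hpq : p = q := by
        obtain ⟨-, -, f, w', m, e', -, -, -, -, -, -, -, -, -, -, rfl, -⟩ := hlast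
        cases ht
        rfl
      subst hpq
      exact ⟨A', e, [], c, d₀, d, c', rfl, hrun, hd₀, hd, hlast, hp, hA, ha, ht, .nil⟩

end Guide

namespace State

open Guide

variable {P : Program Tid Loc Val} {nev : Tid × ℕ → Tid × ℕ → Prop} {G : ExecGraph Tid Loc Val}
  {S S' : State Tid Loc Val} {c c' d : Guide Tid Loc Val} {t : Tid} {q : Tid × ℕ}
  {w : Event Tid Loc Val}

/-- If the next event is the awaited write, then the reversal of the read that was postponed last
stays on the way to `G`. -/
lemma OnTrack.exists_reversal (hG : G.IsFull P) (hfin : G.E.Finite) (hS : S.Inv P)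
    (ht : S.nextThread P nev = some t) (h : S.OnTrack P G (Good P) c)
    (htgt : c.target = some (w, q)) (hwp : w.pos = some (t, (S.hist t).length)) :
    ∃ S' c', S.Child P nev S' ∧ S'.OnTrack P G (Good P) c' := by
  have hac := hG.consistent.poRfAcyclic
  have hv := (h.run.valid hG.isExecution hac hfin).1
  have hfol := h.follows hG.isExecution hac hfin
  obtain ⟨hww, m₀, hwfit⟩ := hv.target_fits w q htgt
  obtain ⟨A, r, Y, cA, d₀, d, c₁, hexe, hrunA, hst, hch, hpost, hrq, hqA, hag, htgt₁, hcalm⟩ :=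
    h.run.exists_last_postpone htgt
  have hrun₁ := Run.snoc hrunA ⟨d₀, hst, hch.tail hpost⟩ hrq hqA hag
  have hs : Settle P (Good P) A q cA d := ⟨d₀, hst, hch⟩
  have hvd := (hrunA.valid hG.isExecution hac hfin).1.settle hs
  have hgd := hs.good (hrunA.good hG)
  have hv₁ := (hrun₁.valid hG.isExecution hac hfin).1
  obtain ⟨-, hpp, Z, hZ, hdel, hZY, hmaxZ⟩ := hcalm.exists_del hG.isExecution hac hfin hrun₁
  obtain ⟨-, hcl, f, w', m, r', hf, hfq, hfA, hwf, hwE, hwA, hrq', hread, hfit, hmax, rfl, -⟩ :=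
    hpost
  obtain rfl : w' = w := by
    cases htgt₁
    rfl
  have hup := upClosed_rest (w := w') hvd.exec hcl
  have hK := hvd.exec.del hup
  obtain rfl : r = r' := hag.1.resolve_right fun h => hfit.pos_ne h (hrq.trans hrq'.symm)
  clear hrq' htgt₁
  rename' w' => w
  have hnd := hS.nodup
  have hnd' := hexe ▸ hnd
  have hAS : ∀ x ∈ A, x ∈ S.exe := fun x hx => by simp [hexe, hx]
  have hYS : ∀ x ∈ Y, x ∈ S.exe := fun x hx => by simp [hexe, hx]
  have hrS : r ∈ S.exe := by simp [hexe]
  have hrY : r ∉ Y := (List.nodup_cons.1 (List.nodup_append.1 hnd').2.1).1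
  have hAY : ∀ x ∈ A, x ∉ Y := fun x hx hy =>
    (List.nodup_append.1 hnd').2.2 x hx x (List.mem_cons_of_mem _ hy) rfl
  have hrK : r ∉ (d.H.del (rest d.H A w)).E := hfit.notMem
  have hKmem : ∀ x, ¬ x.IsInit → TransGen d.H.porf x w → x ∈ (d.H.del (rest d.H A w)).E :=
    fun x hx hxw => ⟨(hvd.exec.transGen_porf_mem_left hxw).resolve_left hx, fun h' => h'.2.2 hxw⟩
  have hKmem' : ∀ x ∈ (d.H.del (rest d.H A w)).E, x ∈ A ∨ TransGen d.H.porf x w := fun x hx =>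
    or_iff_not_imp_left.2 fun h1 => by_contra fun h2 => hx.2 ⟨hx.1, h1, h2⟩
  have hKc : ∀ x ∈ (d.H.del (rest d.H A w)).E, x ∈ c.H.E ∧ x ∉ Z := fun x hx => by
    have : x ∈ (c.H.del Z).E := by
      rw [hdel]
      exact .inr hx
    exact this
  obtain ⟨lw, hlw⟩ := Event.pos_eq_some.1 hwp
  -- everything before the awaited write has been executed
  have hlast : ∀ y, ¬ y.IsInit → TransGen d.H.porf y w → y ∈ S.exe ∧ ∃ z ∈ S.exe, z.PoBefore w ∧
      ReflTransGen c.H.porf y z := by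
    intro y hyi hyw
    obtain ⟨z, hyz, hzw⟩ := TransGen.tail'_iff.1 hyw
    have hzi : ¬ z.IsInit := by
      rcases reflTransGen_iff_eq_or_transGen.1 hyz with rfl | h1
      · exact hyi
      · exact hvd.exec.not_isInit (hvd.exec.transGen_porf_mem_right h1)
    have hzK := hKmem z hzi (.single hzw)
    have hpo : d.H.po z w := hzw.resolve_right fun h => (hvd.exec.rf_read h).not_isWrite hww
    have hzS : z ∈ S.exe := by
      obtain ⟨t', n', l', rfl⟩ := hvd.exec.exists_pos hzK.1
      rw [hlw] at hpo
      obtain ⟨rfl, hlt⟩ := hpo.2.2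
      have h1 := (hS.isHistory t').mem_of_lt hlt
      exact hv.exec.eq_of_pos (hKc _ hzK).1 (hv.sub _ h1) rfl ▸ h1
    have hyz' : ReflTransGen c.H.porf y z := by
      rcases reflTransGen_iff_eq_or_transGen.1 hyz with rfl | h1
      · exact .refl
      · have h2 := (ExecGraph.transGen_porf_del hvd.exec hup).2 ⟨h1, hzK.2⟩
        have h3 : TransGen ((d.H.del (rest d.H A w)).add m r).porf y z :=
          transGen_mono (ExecGraph.sub_add _ _ _).porf _ _ h2
        have hdel' : c.H.del Z = (d.H.del (rest d.H A w)).add m r := hdel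
        rw [← hdel'] at h3
        exact (transGen_mono (ExecGraph.del_sub _ _).porf _ _ h3).to_reflTransGen
    refine ⟨?_, z, hzS, hpo.2.2, hyz'⟩
    rcases reflTransGen_iff_eq_or_transGen.1 hyz' with rfl | h1
    · exact hzS
    · exact (hS.exec.transGen_porf_mem_left ((hfol.transGen_porf_iff hS hzS).2 h1)).resolve_left
        hyi
  -- hence the guide is the graph of the state
  obtain ⟨H, T, D⟩ := c
  have hgr : S.graph = H := by
    have hun : S.unseen ⟨H, T, D⟩ = ∅ := by
      refine Set.eq_empty_iff_forall_notMem.2 fun x hx => hx.2 ?_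
      by_cases hxZ : x ∈ Z
      · exact hYS x (hZY x hxZ)
      have hx' : x ∈ (H.del Z).E := ⟨hx.1, hxZ⟩
      rw [hdel] at hx'
      rcases hx' with rfl | hx'
      · exact hrS
      · exact (hKmem' x hx').elim (hAS x) fun h1 => (hlast x (hvd.exec.not_isInit hx'.1) h1).1
    rw [hfol.graph_eq hS, hun, ExecGraph.del_empty]
  subst hgr
  cases htgt
  simp only at hpp hdel hKc hlast hZ hmaxZ hwfit
  have hB : ∀ y, ¬ y.IsInit → (y ∈ S.graph.porfBefore w ↔ TransGen d.H.porf y w) := by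
    intro y hyi
    rw [ExecGraph.Fits.mem_porfBefore_iff hS.exec hwfit hww]
    constructor
    · rintro ⟨z, hz, hzw, hyz⟩
      have hzi : ¬ z.IsInit := by
        rcases reflTransGen_iff_eq_or_transGen.1 hyz with rfl | h1
        · exact hyi
        · exact hS.exec.not_isInit (hS.exec.transGen_porf_mem_right h1)
      have hzS := hz.resolve_left hzi
      have hzd : z ∈ d.H.E := by
        obtain ⟨t', n', l', rfl⟩ := hS.exec.exists_pos hzS
        obtain ⟨rfl, hlt⟩ : t' = t ∧ n' < (S.hist t).length := by
          rw [hlw] at hzw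
          exact hzw
        rw [hlw] at hwE
        obtain ⟨l₁, hl₁⟩ := hvd.exec.exists_mem_of_lt hwE hlt
        have h1 := (hlast _ id (.single (.inl ⟨.inr hl₁, .inr (hlw ▸ hwE), by
          rw [hlw]
          exact ⟨rfl, hlt⟩⟩))).1
        exact hS.exec.eq_of_pos (G := S.graph) hzS h1 rfl ▸ hl₁
      have hpo : d.H.porf z w := .inl ⟨.inr hzd, .inr hwE, hzw⟩
      rcases reflTransGen_iff_eq_or_transGen.1 hyz with rfl | h1
      · exact .single hpo
      · have hzK := hKmem z hzi (.single hpo)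
        have h2 := (ExecGraph.transGen_porf_del hS.exec hZ).2 ⟨h1, (hKc z hzK).2⟩
        rw [hdel] at h2
        have h3 := (ExecGraph.transGen_porf_add hK hfit h2).2 fun h => hrK (h ▸ hzK)
        exact ((ExecGraph.transGen_porf_del hvd.exec hup).1 h3).1.tail hpo
    · intro hyw
      obtain ⟨-, z, hzS, hzw, hyz⟩ := hlast y hyi hyw
      exact ⟨z, .inr hzS, hzw, hyz⟩
  have hZK : ∀ x, ¬ x.IsInit → x ∈ S.graph.porfBefore w → x ∈ (d.H.del (rest d.H A w)).E :=
    fun x hxi hx => hKmem x hxi ((hB x hxi).1 hx)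
  have hrB : r ∉ S.graph.porfBefore w := fun h1 => hrK (hZK r hread.not_isInit h1)
  have hrY' : ∀ x, S.Before r x ↔ x ∈ Y := fun x => by
    rw [State.Before, hexe]
    exact (pair_split hnd').2
  have hdrop : S.dropped w r = insert r Z := by
    ext x
    rw [Reversal.mem_dropped_iff, Set.mem_insert_iff, hrY']
    refine or_congr_right ⟨fun ⟨h1, h2⟩ => by_contra fun h3 => ?_, fun h1 => ⟨hZY x h1, fun h2 =>
      (hKc x (hZK x (hS.exec.not_isInit (hZ.subset h1)) h2)).2 h1⟩⟩
    have h4 : x ∈ (S.graph.del Z).E := ⟨hYS x h1, h3⟩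
    rw [hdel] at h4
    rcases h4 with rfl | h4
    · exact hrY h1
    · exact (hKmem' x h4).elim (fun h5 => hAY x h5 h1) fun h5 =>
        h2 ((hB x (hvd.exec.not_isInit h4.1)).2 h5)
  have hKS : d.H.del (rest d.H A w) = S.graph.del (S.dropped w r) := by
    rw [hdrop, Set.insert_eq, Set.union_comm, ← ExecGraph.del_del, hdel,
      show ({r} : Set (Event Tid Loc Val)) = insert r ∅ by simp, ExecGraph.add_del hK hfit,
      ExecGraph.del_empty]
  -- `CheckOptimal` holds, since the dropped events were added in a maximal way
  have hcheck : S.CheckOptimal (S.dropped w r) w := by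
    intro e he
    have hKMem : ∀ x, x ∈ S.graph.porfBefore w → ¬ x.IsInit →
        ((d.H.del (rest d.H A w)).add m r).Mem x := fun x hx hxi => .inr (.inr (hZK x hxi hx))
    have hAMem : ∀ x ∈ A, (d.H.del (rest d.H A w)).Mem x := fun x hx =>
      .inr ⟨hvd.sub x hx, fun h' => h'.2.1 hx⟩
    rw [hdrop] at he ⊢
    rcases he with rfl | he
    · have hsrc : ∀ x, S.rf x e → x = m := by
        intro x hx
        rcases (hag.2 x).1 hx with h1 | h1
        · exact absurd (hK.rf_mem h1) hrK
        · exact h1.2.1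
      have hmK : (d.H.del (rest d.H A w)).Mem m := by
        obtain ⟨_, _, _, _, _, _, _, _, h5, _⟩ := id hfit
        exact (h5 fun h => h.not_isRead hread).1
      refine ⟨fun x hx hxx => ?_, fun e' he' b hb hc => ?_⟩
      · obtain rfl := hsrc x hx
        rcases hxx.2 with rfl | hxZ
        · exact pair_ne hnd hxx.1 rfl
        · exact (hKc x (hmK.resolve_left (hS.exec.not_isInit (hZ.subset hxZ)))).2 hxZ
      · obtain rfl := hsrc e' (he'.resolve_left fun h' => hread.not_isWrite h'.1)
        have hbi := hS.co_init _ _ hc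
        have hbK : (d.H.del (rest d.H A w)).Mem b := by
          rcases hb with hb | hb
          · refine hAMem b ?_
            rw [State.Before, hexe] at hb
            exact (pair_split hnd').1.1 hb
          · exact .inr (hZK b hbi hb)
        have h1 : (S.graph.del Z).co e' b := ⟨hc, fun h' => hmK.elim
          (hS.exec.not_isInit (hZ.subset h')) fun h2 => (hKc _ h2).2 h',
          fun h' => (hKc _ (hbK.resolve_left hbi)).2 h'⟩
        rw [hdel] at h1
        rcases h1 with h1 | h1
        · exact hmax _ h1
        · exact hread.not_isWrite h1.1
    · refine ⟨fun x hx hxx => ?_, fun e' he' b hb hc => ?_⟩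
      · rcases (hmaxZ e he x (.inr hx)).1 with rfl | h1 | h1
        · exact pair_ne hnd hxx.1 rfl
        · rcases hxx.2 with rfl | hxZ
          · exact hread.not_isWrite (hS.exec.rf_write hx)
          · rw [← hdel] at h1
            exact ((ExecGraph.mem_del hS.exec hZ).1 h1).2 hxZ
        · refine pair_asymm hnd hxx.1 ?_
          rw [hexe]
          exact h1.trans ((List.sublist_cons_self r Y).trans (List.sublist_append_right A _))
      · have hbi := hS.co_init _ _ hc
        refine (hmaxZ e he e' he').2 b ?_ hc
        rcases hb with hb | hb
        · have heY := hZY e he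
          rw [State.Before, hexe] at hb
          rcases pair_sublist_append.1 hb with h1 | ⟨h1, -⟩ | h1
          · exact absurd heY (hAY e (pair_mem_right h1))
          · exact .inl (ExecGraph.mem_add.2 (.inl (hAMem b h1)))
          · rcases pair_sublist_cons.1 h1 with h1 | ⟨rfl, -⟩
            · exact .inr h1
            · exact .inl (ExecGraph.mem_add.2 (.inr rfl))
        · exact .inl (hKMem b hb hbi)
  -- the read and the write in detail
  have hfr := mem_rest_of_rf hvd.exec hvd.acyclic hfA hwf
  have hfw : f ≠ w := fun h => (hvd.exec.rf_read hwf).not_isWrite (h ▸ hww)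
  have hpred : ∀ x, d.H.po x f → x ∉ rest d.H A w := by
    intro x hx hxr
    obtain ⟨t₁, h₁, -, l₁, rfl, H₁, -⟩ := id hfit
    obtain ⟨tx, nx, lx, rfl⟩ := hvd.exec.exists_pos hxr.1
    rw [← hfq] at hrq
    obtain ⟨lf, rfl⟩ := Event.pos_eq_some.1 hrq.symm
    obtain ⟨rfl, hlt⟩ := hx.2.2
    have h1 := H₁.mem_of_lt hlt
    have h2 := hvd.exec.eq_of_pos h1.1 hxr.1 rfl
    exact h1.2 (h2 ▸ hxr)
  obtain ⟨-, -, x, v, tf, nf, o, s, hwv, hfl⟩ := hvd.exec.rf_wf _ _ hwf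
  obtain ⟨v₀, hrl⟩ : ∃ v₀, r = .ev tf nf (.read x v₀ o s) := by
    obtain ⟨t₁, h₁, a₁, l₁, hr₁, H₁, hn₁, hal₁, -⟩ := id hfit
    have hq : (tf, nf) = (t₁, h₁.length) := by
      rw [hfl, ← hrq, hr₁] at hfq
      exact Option.some.inj hfq
    cases hq
    obtain ⟨hd, Hd, hnext⟩ := hvd.exec.history tf
    have hfd : .ev tf h₁.length (.read x v o s) ∈ d.H.E := hfl ▸ hf
    obtain ⟨a₂, hn₂, hal₂⟩ := hnext _ _ ((Hd _ _).1 hfd)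
    have H₂ := ExecGraph.isHistory_del_of_first hup Hd (hfl ▸ hfr) fun k l' hk hl' =>
      hpred _ ⟨.inr hl'.1, .inr hf, hfl ▸ ⟨rfl, hk⟩⟩ hl'
    rw [H₁.unique H₂, hn₂] at hn₁
    cases hn₁
    rcases a₁ with ⟨x', o', s'⟩ | _ | _
    · obtain ⟨v₁, rfl⟩ := hal₁
      obtain ⟨v₂, hv₂⟩ := hal₂
      cases hv₂
      exact ⟨_, hr₁⟩
    · cases hal₂
    · cases hal₂
  obtain ⟨o', s', b, hwl⟩ : ∃ o' s' b, w = .ev t (S.hist t).length (.write x v o' s' b) := by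
    rcases hwv with ⟨h1, -⟩ | ⟨_, _, o', s', b, h1⟩
    · exact absurd (hlw.symm.trans h1) (by simp)
    · rw [h1] at hlw
      cases hlw
      exact ⟨o', s', b, h1⟩
  -- the place of the new write in `co`
  have hins : insert w (rest d.H A w \ {w}) = rest d.H A w :=
    Set.insert_sdiff_self_of_mem (target_mem_rest hvd.acyclic hwE hwA)
  have hV : d.H.UpClosed (rest d.H A w \ {w}) := by
    refine ⟨fun y hy => hy.1.1, fun y z hyz hy => ⟨hup.closed y z hyz hy.1, ?_⟩⟩
    rintro rfl
    exact hy.1.2.2 (.single hyz)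
  have hinit : ∀ a b, d.H.co a b → ¬ b.IsInit := fun a b hab => hgd.1.co_not_init hvd.exec hab
  obtain ⟨a, hafit, -, -, haeq⟩ := ExecGraph.exists_del_eq_add hvd.exec hvd.finite hinit hV
    (hins.symm ▸ hup) hwE fun h => h.2 rfl
  have hins' : insert f ((rest d.H A w \ {w}) \ {f}) = rest d.H A w \ {w} :=
    Set.insert_sdiff_self_of_mem ⟨hfr, hfw⟩
  have hV' : d.H.UpClosed ((rest d.H A w \ {w}) \ {f}) := by
    refine ⟨fun y hy => hy.1.1.1, fun y z hyz hy => ⟨hV.closed y z hyz hy.1, ?_⟩⟩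
    rintro rfl
    rcases hyz with hpo | hrf
    · exact hpred y hpo hy.1.1
    · exact hy.1.2 (hvd.exec.rf_functional hrf hwf)
  obtain ⟨m', -, hm', -, hfeq⟩ := ExecGraph.exists_del_eq_add hvd.exec hvd.finite hinit hV'
    (hins'.symm ▸ hV) hf fun h => h.2 rfl
  obtain rfl := hm' w hwf
  rw [hins] at hafit haeq
  rw [hins', haeq, hKS] at hfeq
  rw [hKS] at hafit
  have hR : S.Reversal P w r f a ((S.remove (S.deleted w r)).reverse r w a v) := by
    refine ⟨⟨m₀, hwfit⟩, hrS, h.reversible r hrS q (hpp ▸ Set.mem_insert _ _) hrq, hrB, hcheck,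
      ⟨tf, nf, x, v₀, v, o, s, t, _, o', s', b, hrl, hfl, hwl, rfl⟩, ?_⟩
    obtain ⟨_, _, _, _, _, _, _, _, h5, _⟩ := hafit
    obtain ⟨h6, h7, h8⟩ := h5 fun h => h.not_isWrite hww
    exact ⟨h6.imp_right fun h9 => ⟨h9.1, fun h10 => h9.2 (.inr h10)⟩, h7, h8⟩
  rw [← hR.graph_eq hS] at hfeq
  generalize (S.remove (S.deleted w r)).reverse r w a v = S' at hR hfeq
  obtain ⟨A', Y', X, hexe', hexe'', -, hX, hA', -⟩ := hR.exists_split hS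
  obtain rfl : A = A' := by
    have hrA : r ∉ A := fun h => (List.nodup_append.1 hnd').2.2 r h r (by simp) rfl
    exact ((List.append_cons_inj_of_notMem hrA hrY).1 (hexe.symm.trans hexe')).1
  have hexe₁ : S'.exe = (A ++ [f]) ++ (X ++ [w]) := by simp [hexe'']
  have hagr : ∀ y ∈ S'.exe, Agrees S'.rf y d := fun y hy =>
    agrees_of_graph_eq hV' hfeq.symm hy
  have hrunf : Run P G (Good P) S'.rf (A ++ [f]) d := by
    refine .snoc (hrunA.congr fun y hy z => ?_) hs hfq hqA (hagr f (by simp [hexe'']))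
    have hyd : y ∉ S.dropped w r := Reversal.not_dropped_of_before hS ((hA' y).1 hy)
    rw [hR.rf_iff hS]
    exact ⟨fun h => .inl ⟨h, hyd⟩, fun h => h.elim And.left fun h => absurd (h.2 ▸ hy) hfA⟩
  refine ⟨S', d, .reversal t (S.hist t).length lw r f a ht (hlw ▸ hR), ?_, ?_,
    fun x y hx hy => co_iff_of_graph_eq hvd.exec hV' hfeq.symm hx hy⟩
  · have hnd₁ := hR.nodup hS
    rw [hexe₁] at hagr hnd₁ ⊢
    exact hrunf.append hvd.exec hagr hnd₁
  · -- reads that are still postponed are not before the write, since nothing depends on them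
    intro e he p hp hep
    have hed := (hagr e he).1
    have hpT := hvd.postponed_sub hp
    have hpw : ∀ p', w.pos = some p' → p' ∉ insert q (posSet A) := by
      rintro p' hp' (rfl | ⟨b', hb', hbp⟩)
      · exact hfw (hvd.exec.eq_of_pos hf hwE (hfq.trans hp'.symm))
      · exact hwA (hvd.exec.eq_of_pos (hvd.sub b' hb') hwE (hbp.trans hp'.symm) ▸ hb')
    refine (hR.rev_eq hS).2 (or_iff_not_imp_left.2 fun hef => ?_)
    have heA : e ∈ A := by
      rcases hpT with rfl | ⟨b', hb', hbp⟩
      · exact absurd (hvd.exec.eq_of_pos hed hf (hep.trans hfq.symm)) hef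
      · exact hvd.exec.eq_of_pos (hvd.sub b' hb') hed (hbp.trans hep.symm) ▸ hb'
    have heS := hAS e heA
    refine ⟨h.reversible e heS p (hpp ▸ Set.mem_insert_of_mem _ hp) hep,
      Reversal.not_dropped_of_before hS ((hA' e).1 heA), fun heB => ?_⟩
    exact hvd.loose e hed p hp hep w hwE hpw
      ((hB e (hS.exec.not_isInit (G := S.graph) heS)).1 heB)

/-- If no thread has a next action on the way to `G`, then `G` has been reached. -/
lemma OnTrack.graph_eq_of_finished (hG : G.IsFull P) (hfin : G.E.Finite) (hS : S.Inv P)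
    (h : S.OnTrack P G (Good P) c) (hno : ∀ t, S.nextAct P t = none) : S.graph = G := by
  have hv := (h.run.valid hG.isExecution hG.consistent.poRfAcyclic hfin).1
  have hfol := h.follows hG.isExecution hG.consistent.poRfAcyclic hfin
  have hdone : ∀ t hh, c.H.IsHistory t hh → S.hist t = hh ∧ P.next t hh = none := by
    intro t hh Hh
    obtain ⟨h1, h2⟩ := hist_eq_take hS hv.sub Hh
    have h3 := hno t
    rw [State.nextAct, h1] at h3
    obtain ⟨h₁, H₁, hnext⟩ := hv.exec.history t
    obtain rfl := Hh.unique H₁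
    rcases h2.eq_or_lt with h2 | h2
    · rw [h2, List.take_length] at h1 h3
      exact ⟨h1, h3⟩
    · obtain ⟨a, ha, -⟩ := hnext _ _ (List.getElem?_eq_getElem h2)
      rw [h3] at ha
      cases ha
  have htgt : c.target = none := by
    by_contra hne
    obtain ⟨⟨w, q⟩, hw⟩ := Option.ne_none_iff_exists'.1 hne
    obtain ⟨-, m, t, hh, a, l, -, Hh, ha, -⟩ := hv.target_fits w q hw
    rw [(hdone t hh Hh).2] at ha
    cases ha
  obtain ⟨rfl, -⟩ := hv.of_none htgt
  have hun : S.unseen c = ∅ := by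
    refine Set.eq_empty_iff_forall_notMem.2 fun x hx => hx.2 ?_
    obtain ⟨t, n, l, rfl⟩ := hv.exec.exists_pos hx.1
    obtain ⟨hh, Hh, -⟩ := hv.exec.history t
    have h1 := (Hh n l).1 hx.1
    rw [← (hdone t hh Hh).1] at h1
    exact (hS.isHistory t n l).2 h1
  rw [hfol.graph_eq hS, hun, ExecGraph.del_empty]

/-- As long as the exploration goes on, some recursive call stays on the way to `G`. -/
lemma OnTrack.exists_child (hG : G.IsFull P) (hfin : G.E.Finite) (hS : S.Inv P)
    (ht : S.nextThread P nev = some t) (h : S.OnTrack P G (Good P) c) :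
    ∃ S' c', S.Child P nev S' ∧ S'.OnTrack P G (Good P) c' := by
  by_cases hw : ∃ w q, c.target = some (w, q) ∧ w.pos = some (t, (S.hist t).length)
  · obtain ⟨w, q, h1, h2⟩ := hw
    exact h.exists_reversal hG hfin hS ht h1 h2
  · push Not at hw
    exact h.exists_forward hG hfin hS ht hw

end State

/-- Every full consistent graph is output. -/
lemma exists_output [Finite Tid] {P : Program Tid Loc Val} {nev : Tid × ℕ → Tid × ℕ → Prop}
    [IsStrictTotalOrder (Tid × ℕ) nev] {N : ℕ} {G : ExecGraph Tid Loc Val}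
    (hN : ∀ G : ExecGraph Tid Loc Val, G.IsExecution P → G.Consistent P → G.E.encard ≤ N)
    (hG : G.IsFull P) :
    ∃ p S, call P nev p = some S ∧ S.explore P nev = .output ∧ S.graph = G := by
  have hfin : G.E.Finite := Set.finite_of_encard_le_coe (hN G hG.isExecution hG.consistent)
  have key : ∀ k p S c, call P nev p = some S → S.OnTrack P G (Guide.Good P) c →
      (N + 1) ^ 2 - p.length = k →
      ∃ p S, call P nev p = some S ∧ S.explore P nev = .output ∧ S.graph = G := by
    intro k
    induction k using Nat.strong_induction_on with
    | _ k ih =>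
      intro p S c hp hc hk
      have hS := inv_of_call hp
      have hcons : S.graph.Consistent P :=
        ((hc.follows hG.isExecution hG.consistent.poRfAcyclic hfin).sub hS).consistent
          (hc.run.good hG).1
      rcases hnt : S.nextThread P nev with _ | t
      · exact ⟨p, S, hp, (State.explore_eq_output_iff hcons).2 hnt,
          hc.graph_eq_of_finished hG hfin hS (State.nextThread_eq_none hnt)⟩
      · obtain ⟨S', c', hchild, hc'⟩ := hc.exists_child hG hfin hS hnt
        obtain ⟨i, hi⟩ := List.mem_iff_getElem?.1 (hS.mem_calls_iff.2 ⟨hcons, hchild⟩)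
        have hp' : call P nev (p ++ [i]) = some S' := call_concat.2 ⟨S, hp, hi⟩
        have hlen := (depth_bound hN hp').1
        rw [List.length_append, List.length_singleton] at hlen
        exact ih _ (by rw [List.length_append, List.length_singleton]; omega) _ S' c' hp' hc' rfl
  exact key _ [] State.start ⟨G, none, ∅⟩ call_nil
    ⟨.nil, by simp [State.start], fun a b ha hb => by
      have hmem : ∀ {x : Event Tid Loc Val}, (State.start : State Tid Loc Val).graph.Mem x →
          x.IsInit := fun hx => hx.resolve_right (by simp [State.start, State.graph])
      exact ⟨fun h => h.elim, fun h =>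
        (hG.consistent.co_not_init hG.isExecution h (hmem hb)).elim⟩⟩ rfl

/-! ### Predecessors -/

/-- Since the graph of a call determines the call, it determines the graph of the caller. -/
lemma exists_prev (P : Program Tid Loc Val) (nev : Tid × ℕ → Tid × ℕ → Prop) :
    ∃ Prev : ExecGraph Tid Loc Val → ExecGraph Tid Loc Val,
      Prev ExecGraph.empty = ExecGraph.empty ∧
      ∀ p i S S', call P nev p = some S → call P nev (p ++ [i]) = some S' →
        Prev S'.graph = S.graph := by
  classical
  let R : ExecGraph Tid Loc Val → ExecGraph Tid Loc Val → Prop := fun G' G =>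
    ∃ p i S S', call P nev p = some S ∧ call P nev (p ++ [i]) = some S' ∧ S'.graph = G' ∧
      S.graph = G
  have hR : ∀ G' G₁ G₂, R G' G₁ → R G' G₂ → G₁ = G₂ := by
    rintro _ _ _ ⟨p, i, S, S', h1, h2, rfl, rfl⟩ ⟨q, j, T, T', h3, h4, h5, rfl⟩
    have h6 := eq_of_graph_eq h4 h2 h5
    obtain ⟨rfl, -⟩ := List.append_inj' h6 rfl
    rw [h1] at h3
    cases h3
    rfl
  refine ⟨fun G' => if h : ∃ G, R G' G then h.choose else .empty, ?_, ?_⟩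
  · refine dif_neg ?_
    rintro ⟨G, p, i, S, S', h1, h2, h3, rfl⟩
    have hstart : (State.start : State Tid Loc Val).graph = .empty := by
      simp [State.start, State.graph, ExecGraph.empty]
    have := eq_of_graph_eq h2 call_nil (h3.trans hstart.symm)
    simp at this
  · intro p i S S' h1 h2
    have h : ∃ G, R S'.graph G := ⟨_, p, i, S, S', h1, h2, rfl, rfl⟩
    exact (dif_pos h).trans (hR _ _ _ h.choose_spec ⟨p, i, S, S', h1, h2, rfl, rfl⟩)

lemma iterate_prev {P : Program Tid Loc Val} {nev : Tid × ℕ → Tid × ℕ → Prop}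
    {Prev : ExecGraph Tid Loc Val → ExecGraph Tid Loc Val}
    (hPrev : ∀ p i S S', call P nev p = some S → call P nev (p ++ [i]) = some S' →
      Prev S'.graph = S.graph) {p : List ℕ} {S : State Tid Loc Val} (h : call P nev p = some S) :
    Prev^[p.length] S.graph = ExecGraph.empty := by
  induction p using List.reverseRecOn generalizing S with
  | nil =>
    rw [call_nil] at h
    cases h
    simp [State.start, State.graph, ExecGraph.empty]
  | append_singleton p i ih =>
    obtain ⟨S₀, h1, -⟩ := call_concat.1 h
    rw [List.length_append, List.length_singleton, Function.iterate_succ_apply,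
      hPrev p i S₀ S h1 h, ih h1]

end SRC11

open SRC11

theorem mainTheorem1 {Tid Loc Val : Type*} [Finite Tid] (P : Program Tid Loc Val)
    (nev : Tid × ℕ → Tid × ℕ → Prop) [IsStrictTotalOrder (Tid × ℕ) nev]
    (N : ℕ) (hN : ∀ G : ExecGraph Tid Loc Val, G.IsExecution P → G.Consistent P → G.E.encard ≤ N) :
    -- the exploration terminates
    {p | call P nev p ≠ none}.Finite ∧
    -- soundness
    (∀ p S, call P nev p = some S → S.explore P nev ≠ .pruned →
      S.graph.IsExecution P ∧ S.graph.Consistent P) ∧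
    (∀ p S, call P nev p = some S → S.explore P nev = .output → S.graph.IsFull P) ∧
    -- completeness
    (∀ G : ExecGraph Tid Loc Val, G.IsFull P →
      ∃ p S, call P nev p = some S ∧ S.explore P nev = .output ∧ S.graph = G) ∧
    -- each explored graph has a unique predecessor, which leads back to the empty graph
    (∃ Prev : ExecGraph Tid Loc Val → ExecGraph Tid Loc Val,
      Prev ExecGraph.empty = ExecGraph.empty ∧
      (∀ p i S S', call P nev p = some S → call P nev (p ++ [i]) = some S' →
        Prev S'.graph = S.graph) ∧
      ∀ G : ExecGraph Tid Loc Val, G.IsFull P → ∃ k : ℕ, Prev^[k] G = ExecGraph.empty) ∧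
    -- optimality: no two calls have the same graph
    (∀ p q S S', call P nev p = some S → call P nev q = some S' → S.graph = S'.graph → p = q) ∧
    -- polynomial space
    (∀ p S, call P nev p = some S → p.length ≤ (N + 1) ^ 2 ∧ stackSize P nev p ≤ (N + 3) ^ 4) := by
  refine ⟨finite_calls hN, fun p S hp h => ⟨(inv_of_call hp).exec, State.consistent_of_explore h⟩,
    fun p S hp h => isFull_of_output hp h, fun G hG => exists_output hN hG, ?_,
    fun p q S S' hp hq h => eq_of_graph_eq hp hq h,
    fun p S hp => ⟨(depth_bound hN hp).1, stackSize_le hN hp⟩⟩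
  obtain ⟨Prev, h1, h2⟩ := exists_prev P nev
  refine ⟨Prev, h1, h2, fun G hG => ?_⟩
  obtain ⟨p, S, hp, -, rfl⟩ := exists_output (nev := nev) hN hG
  exact ⟨p.length, iterate_prev h2 hp⟩
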